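/- Let $n\ge 2$. A path is a continuous map $\gamma\colon[a,b]\to\mathbb R^n$ on a compact interval; $|\gamma|$ is its image, $\partial\gamma=\{\gamma(a),\gamma(b)\}$, and $\ell(\gamma)$ is its length. It is rectifiable if $\ell(\gamma)<\infty$, and simple if it is injective. A strict subpath of $\gamma$ is a restriction $\gamma|_{[c,d]}$ with $[c,d]\subset(a,b)$. For a rectifiable $\gamma$ and a Borel function $\rho\colon\mathbb R^n\to[0,\infty]$, $\int_\gamma\rho\,ds$ is the line integral with respect to arclength. The $n$-modulus of a path family $\Gamma$ is $\mathrm{Mod}_n\Gamma=\inf_\rho\int_{\mathbb R^n}\rho^n$, the infimum over all Borel $\rho\colon\mathbb R^n\to[0,\infty]$ with $\int_\gamma\rho\,ds\ge1$ for all rectifiable $\gamma\in\Gamma$ (and $\mathrm{Mod}_n\Gamma=\infty$ if there is no such $\rho$). For sets $F_1,F_2\subset\Omega$ with $\Omega\subset\mathbb R^n$ open, $\Gamma(F_1,F_2;\Omega)$ is the family of paths $\gamma\colon[a,b]\to\overline\Omega$ with $\gamma(a)\in F_1$, $\gamma(b)\in F_2$ and $\gamma((a,b))\subset\Omega$. For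 $E\subset\mathbb R^n$, $\mathcal F_0(E)$ is the family of paths $\gamma$ with $(|\gamma|\setminus\partial\gamma)\cap E=\emptyset$, and $\mathcal F_\sigma(E)$ is the family of paths $\gamma$ with $|\gamma|\cap E$ countable. A continuum is a compact connected set; a set is non-degenerate if it has more than one point; and $\Delta(F_1,F_2)=\operatorname{dist}(F_1,F_2)/\min\{\operatorname{diam}F_1,\operatorname{diam}F_2\}$. A set $E$ is in $\mathrm{NED}(\Omega)$ if $\mathrm{Mod}_n\Gamma(F_1,F_2;\Omega)=\mathrm{Mod}_n(\Gamma(F_1,F_2;\Omega)\cap\mathcal F_0(E))$ for all non-empty, disjoint continua $F_1,F_2\subset\Omega$. It is in $\mathrm{NED}^w(\Omega)$ if there is a constant $M\ge1$ such that $\mathrm{Mod}_n\Gamma(F_1,F_2;\Omega)\le M\cdot\mathrm{Mod}_n(\Gamma(F_1,F_2;\Omega)\cap\mathcal F_0(E))$ for all such $F_1,F_2$. The classes $\mathrm{CNED}(\Omega)$ and $\mathrm{CNED}^w(\Omega)$ are defined in the same way with $\mathcal F_\sigma(E)$ in place of $\mathcal F_0(E)$. Below, $({}^*\mathrm{NED},\mathcal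 F_*)$ is, throughout, either $(\mathrm{NED},\mathcal F_0)$ or $(\mathrm{CNED},\mathcal F_\sigma)$. **Conclusion A$(E,\rho,\gamma)$.** For every open $U\supset|\gamma|\setminus\partial\gamma$, every $\varepsilon>0$ and every path family $\Gamma'$ with $\mathrm{Mod}_n\Gamma'=0$ there exist a countable collection of paths $\{\gamma_i\}_{i\in I}$ and a simple path $\widetilde\gamma\in\mathcal F_*(E)$ such that $\partial\widetilde\gamma=\partial\gamma$; $|\widetilde\gamma|\setminus\partial\gamma\subset(|\gamma|\setminus E)\cup\bigcup_{i}|\gamma_i|$; $\bigcup_{i}|\gamma_i|\subset U$; $\sum_i\ell(\gamma_i)<\varepsilon$; $\sum_i\int_{\gamma_i}\rho\,ds<\varepsilon$; $\gamma_i\notin\Gamma'$ for all $i\in I$; $I$ is finite if $E\cap\partial\gamma=\emptyset$; and the trace of each strict subpath of $\widetilde\gamma$ meets $|\gamma_i|$ for only finitely many $i\in I$. **Conclusion B$(E,\rho,\gamma)$.** For every open $U\supset|\gamma|$ and every $\varepsilon>0$ there exists a simple path $\widetilde\gamma\in\mathcal F_*(E)$ with $\partial\widetilde\gamma=\partial\gamma$,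 $|\widetilde\gamma|\subset U$, $\ell(\widetilde\gamma)\le\ell(\gamma)+\varepsilon$ and $\int_{\widetilde\gamma}\rho\,ds\le\int_\gamma\rho\,ds+\varepsilon$. **Theorem 6.1.** Let $E\subset\mathbb R^n$ be a closed set. The following are equivalent. (I) $E\in{}^*\mathrm{NED}(\Omega)$ for all open sets $\Omega\subset\mathbb R^n$. (II) $E\in{}^*\mathrm{NED}(\mathbb R^n)$. (III) $E\in{}^*\mathrm{NED}^w(\Omega)$ for some open set $\Omega\supset E$. (IV) There exist constants $t,\phi>0$ such that for each $x_0\in\mathbb R^n$ there exists $r_0>0$ with the property that $\mathrm{Mod}_n(\Gamma(F_1,F_2;\mathbb R^n)\cap\mathcal F_*(E))\ge\phi$ for every pair of non-degenerate, disjoint continua $F_1,F_2\subset B(x_0,r_0)$ with $\Delta(F_1,F_2)\le t$. (V) For each Borel function $\rho\colon\mathbb R^n\to[0,\infty]$ in $L^n_{\mathrm{loc}}(\mathbb R^n)$ there exists a path family $\Gamma_0$ with $\mathrm{Mod}_n\Gamma_0=0$ such that Conclusion A$(E,\rho,\gamma)$ holds for each rectifiable path $\gamma\notin\Gamma_0$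 with distinct endpoints. Moreover, if $\{\eta_j\}_{j\in J}$ is a finite collection of paths outside $\Gamma_0$ and $\gamma$ is a path with $|\gamma|\subset\bigcup_{j\in J}|\eta_j|$, then $\gamma\notin\Gamma_0$. (VI) For each Borel function $\rho\colon\mathbb R^n\to[0,\infty]$ in $L^n_{\mathrm{loc}}(\mathbb R^n)$ there exists a path family $\Gamma_0$ with $\mathrm{Mod}_n\Gamma_0=0$ such that Conclusion B$(E,\rho,\gamma)$ holds for each rectifiable path $\gamma\notin\Gamma_0$ with distinct endpoints. (VII) $E$ has Lebesgue measure zero, and for each Borel function $\rho\colon\mathbb R^n\to[0,\infty]$ in $L^n_{\mathrm{loc}}(\mathbb R^n)$ there exists a path family $\Gamma_0$ with $\mathrm{Mod}_n\Gamma_0=0$ such that Conclusion B$(E,\rho,\gamma)$ holds for each rectifiable path $\gamma\notin\Gamma_0$ with distinct endpoints that do not lie in $E$. Moreover, the implications (V) $\Rightarrow$ (VI) $\Leftrightarrow$ (VII) $\Rightarrow$ (I) $\Rightarrow$ (II) $\Rightarrow$ (III) hold for all Lebesgue measurable sets $E\subset\mathbb R^n$, not necessarily closed. -/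

import Mathlib

open Set MeasureTheory
open scoped ENNReal NNReal

noncomputable section

namespace NegExt

/-- Euclidean space of dimension `n`. -/
abbrev Eu (n : ℕ) : Type := EuclideanSpace ℝ (Fin n)

/-- A path (curve) in Euclidean space: a continuous map on a compact interval `[a, b]`. -/
structure Curve (n : ℕ) where
  a : ℝ
  b : ℝ
  le : a ≤ b
  toFun : C(Icc a b, Eu n)

namespace Curve

variable {n : ℕ}

/-- The left endpoint of the parameter interval, as an element of that interval. -/
def left (γ : Curve n) : Icc γ.a γ.b := ⟨γ.a, left_mem_Icc.2 γ.le⟩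

/-- The right endpoint of the parameter interval, as an element of that interval. -/
def right (γ : Curve n) : Icc γ.a γ.b := ⟨γ.b, right_mem_Icc.2 γ.le⟩

/-- The initial point of a path. -/
def start (γ : Curve n) : Eu n := γ.toFun γ.left

/-- The terminal point of a path. -/
def finish (γ : Curve n) : Eu n := γ.toFun γ.right

/-- The trace `|γ|`. -/
def trace (γ : Curve n) : Set (Eu n) := range γ.toFun

/-- The set of endpoints `∂γ`. -/
def bdry (γ : Curve n) : Set (Eu n) := {γ.start, γ.finish}

/-- A path is simple if it is injective. -/
def IsSimple (γ : Curve n) : Prop := Function.Injective γ.toFun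

/-- The length of a path: its total variation. -/
def length (γ : Curve n) : ℝ≥0∞ := eVariationOn γ.toFun univ

/-- A path is rectifiable if its length is finite. -/
def IsRectifiable (γ : Curve n) : Prop := γ.length < ∞

/-- The arclength parametrization of a rectifiable path; it is to be used on `[0, ℓ(γ)]`. -/
def arclengthParam (γ : Curve n) : ℝ → Eu n :=
  naturalParameterization γ.toFun univ γ.left

/-- The line integral `∫_γ ρ ds = ∫_0^{ℓ(γ)} ρ(γ_s(t)) dt`, where `γ_s` is the arclength
parametrization. It is meaningful only for rectifiable paths, and only used for these. -/
def lineIntegral (γ : Curve n) (ρ : Eu n → ℝ≥0∞) : ℝ≥0∞ :=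
  ∫⁻ t in Icc 0 γ.length.toReal, ρ (γ.arclengthParam t)

/-- `η` is a strict subpath of `γ : [a, b] → ℝⁿ`: it is the restriction of `γ` to a closed
interval contained in the open interval `(a, b)`. -/
def IsStrictSubpath (η γ : Curve n) : Prop :=
  γ.a < η.a ∧ η.b < γ.b ∧
    ∀ (t : ℝ) (h : t ∈ Icc η.a η.b) (h' : t ∈ Icc γ.a γ.b), η.toFun ⟨t, h⟩ = γ.toFun ⟨t, h'⟩

end Curve

variable {n : ℕ}

/-- A Borel function `ρ` is admissible for the path family `Γ` if `∫_γ ρ ds ≥ 1` for each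
rectifiable path `γ ∈ Γ`. -/
def IsAdmissible (Γ : Set (Curve n)) (ρ : Eu n → ℝ≥0∞) : Prop :=
  Measurable ρ ∧ ∀ γ ∈ Γ, γ.IsRectifiable → 1 ≤ γ.lineIntegral ρ

/-- The `n`-modulus of a path family in `ℝⁿ`: the infimum of `∫ ρ ^ n` over all admissible `ρ`
(it is `∞` if there are no admissible functions). -/
def modulus (Γ : Set (Curve n)) : ℝ≥0∞ :=
  ⨅ (ρ : Eu n → ℝ≥0∞) (_ : IsAdmissible Γ ρ), ∫⁻ x, ρ x ^ n

/-- A continuum: a compact connected set (non-empty, by the convention for `IsConnected`). -/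
def IsContinuum (F : Set (Eu n)) : Prop := IsCompact F ∧ IsConnected F

/-- The family `Γ(F₁, F₂; U)` of paths joining `F₁` to `F₂` inside `U`: the paths
`γ : [a, b] → closure U` with `γ(a) ∈ F₁`, `γ(b) ∈ F₂` and `γ((a, b)) ⊆ U`. -/
def joining (F₁ F₂ U : Set (Eu n)) : Set (Curve n) :=
  {γ | γ.start ∈ F₁ ∧ γ.finish ∈ F₂ ∧ γ.trace ⊆ closure U ∧
    ∀ t : Icc γ.a γ.b, γ.a < (t : ℝ) → (t : ℝ) < γ.b → γ.toFun t ∈ U}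

/-- The family `𝓕₀(E)` of paths that do not meet `E` except possibly at the endpoints. -/
def avoiding (E : Set (Eu n)) : Set (Curve n) := {γ | Disjoint (γ.trace \ γ.bdry) E}

/-- The family `𝓕_σ(E)` of paths that meet `E` in countably many points. -/
def countablyMeeting (E : Set (Eu n)) : Set (Curve n) := {γ | (E ∩ γ.trace).Countable}

/-- The two kinds of negligibility: `NED` and `CNED`. -/
inductive Kind : Type
  | ned
  | cned

/-- The family `𝓕_*(E)`, which is `𝓕₀(E)` in the case of `NED` and `𝓕_σ(E)` in the case of
`CNED`. -/
def Kind.family (k : Kind) (E : Set (Eu n)) : Set (Curve n) :=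
  match k with
  | .ned => avoiding E
  | .cned => countablyMeeting E

/-- `E ∈ NED(Ω)`, respectively `E ∈ CNED(Ω)`. -/
def IsNegligible (k : Kind) (Ω E : Set (Eu n)) : Prop :=
  ∀ F₁ F₂ : Set (Eu n), IsContinuum F₁ → IsContinuum F₂ → F₁ ⊆ Ω → F₂ ⊆ Ω → Disjoint F₁ F₂ →
    modulus (joining F₁ F₂ Ω) = modulus (joining F₁ F₂ Ω ∩ k.family E)

/-- `E ∈ NED^w(Ω)`, respectively `E ∈ CNED^w(Ω)`. -/
def IsWeaklyNegligible (k : Kind) (Ω E : Set (Eu n)) : Prop :=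
  ∃ M : ℝ≥0, 1 ≤ M ∧ ∀ F₁ F₂ : Set (Eu n), IsContinuum F₁ → IsContinuum F₂ →
    F₁ ⊆ Ω → F₂ ⊆ Ω → Disjoint F₁ F₂ →
      modulus (joining F₁ F₂ Ω) ≤ M * modulus (joining F₁ F₂ Ω ∩ k.family E)

/-- The Euclidean distance `inf {|x - y| : x ∈ F₁, y ∈ F₂}` of two (non-empty) sets. -/
def setDist (F₁ F₂ : Set (Eu n)) : ℝ := sInf (image2 dist F₁ F₂)

/-- The relative distance of two non-degenerate (bounded) sets. -/
def relDist (F₁ F₂ : Set (Eu n)) : ℝ :=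
  setDist F₁ F₂ / min (Metric.diam F₁) (Metric.diam F₂)

/-- The uniform local lower bound of Loewner type for the families of paths in `𝓕_*(E)`. -/
def LocalLoewnerBound (k : Kind) (E : Set (Eu n)) : Prop :=
  ∃ t φ : ℝ, 0 < t ∧ 0 < φ ∧ ∀ x₀ : Eu n, ∃ r₀ : ℝ, 0 < r₀ ∧
    ∀ F₁ F₂ : Set (Eu n), IsContinuum F₁ → IsContinuum F₂ → F₁.Nontrivial → F₂.Nontrivial →
      Disjoint F₁ F₂ → F₁ ⊆ Metric.ball x₀ r₀ → F₂ ⊆ Metric.ball x₀ r₀ → relDist F₁ F₂ ≤ t →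
        ENNReal.ofReal φ ≤ modulus (joining F₁ F₂ univ ∩ k.family E)

/-- `ρ` is a Borel function `ℝⁿ → [0, ∞]` in `Lⁿ_loc(ℝⁿ)`. -/
def IsBorelLnLoc (ρ : Eu n → ℝ≥0∞) : Prop :=
  Measurable ρ ∧ ∀ K : Set (Eu n), IsCompact K → ∫⁻ x in K, ρ x ^ n < ∞

/-- Conclusion `A(E, ρ, γ)`. The auxiliary paths are indexed by a subset of `ℕ`; this is no loss
of generality, since each strict subpath of the simple path meets only finitely many of them. -/
def ConclusionA (k : Kind) (E : Set (Eu n)) (ρ : Eu n → ℝ≥0∞) (γ : Curve n) : Prop :=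
  ∀ U : Set (Eu n), IsOpen U → γ.trace \ γ.bdry ⊆ U → ∀ ε : ℝ, 0 < ε →
    ∀ Γ' : Set (Curve n), modulus Γ' = 0 →
      ∃ (I : Set ℕ) (δ : ℕ → Curve n) (γ' : Curve n), γ'.IsSimple ∧
        γ' ∈ k.family E ∧
        γ'.bdry = γ.bdry ∧
        γ'.trace \ γ.bdry ⊆ (γ.trace \ E) ∪ ⋃ i ∈ I, (δ i).trace ∧
        ⋃ i ∈ I, (δ i).trace ⊆ U ∧
        ∑' i : I, (δ i).length < ENNReal.ofReal ε ∧
        ∑' i : I, (δ i).lineIntegral ρ < ENNReal.ofReal ε ∧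
        (∀ i ∈ I, δ i ∉ Γ') ∧
        (Disjoint E γ.bdry → I.Finite) ∧
        ∀ η : Curve n, η.IsStrictSubpath γ' →
          {i ∈ I | (η.trace ∩ (δ i).trace).Nonempty}.Finite

/-- Conclusion `B(E, ρ, γ)`. -/
def ConclusionB (k : Kind) (E : Set (Eu n)) (ρ : Eu n → ℝ≥0∞) (γ : Curve n) : Prop :=
  ∀ U : Set (Eu n), IsOpen U → γ.trace ⊆ U → ∀ ε : ℝ, 0 < ε →
    ∃ γ' : Curve n, γ'.IsSimple ∧
      γ' ∈ k.family E ∧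
      γ'.bdry = γ.bdry ∧
      γ'.trace ⊆ U ∧
      γ'.length ≤ γ.length + ENNReal.ofReal ε ∧
      γ'.lineIntegral ρ ≤ γ.lineIntegral ρ + ENNReal.ofReal ε

/-- For each `ρ`, conclusion `A` holds for all rectifiable paths with distinct endpoints outside
an exceptional family `Γ₀` of modulus zero, whose complement is stable in the following sense: a
path whose trace is covered by the traces of finitely many paths outside `Γ₀` is outside `Γ₀`. -/
def ModificationA (k : Kind) (E : Set (Eu n)) : Prop :=
  ∀ ρ : Eu n → ℝ≥0∞, IsBorelLnLoc ρ → ∃ Γ₀ : Set (Curve n), modulus Γ₀ = 0 ∧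
    (∀ γ : Curve n, γ.IsRectifiable → γ.start ≠ γ.finish → γ ∉ Γ₀ → ConclusionA k E ρ γ) ∧
    ∀ (J : Set (Curve n)) (γ : Curve n), J.Finite → (∀ η ∈ J, η ∉ Γ₀) →
      γ.trace ⊆ ⋃ η ∈ J, η.trace → γ ∉ Γ₀

/-- For each `ρ`, conclusion `B` holds for all rectifiable paths with distinct endpoints outside
an exceptional family `Γ₀` of modulus zero. -/
def ModificationB (k : Kind) (E : Set (Eu n)) : Prop :=
  ∀ ρ : Eu n → ℝ≥0∞, IsBorelLnLoc ρ → ∃ Γ₀ : Set (Curve n), modulus Γ₀ = 0 ∧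
    ∀ γ : Curve n, γ.IsRectifiable → γ.start ≠ γ.finish → γ ∉ Γ₀ → ConclusionB k E ρ γ

/-- The same as `ModificationB`, but only for paths whose endpoints do not lie in `E`. -/
def ModificationBOff (k : Kind) (E : Set (Eu n)) : Prop :=
  ∀ ρ : Eu n → ℝ≥0∞, IsBorelLnLoc ρ → ∃ Γ₀ : Set (Curve n), modulus Γ₀ = 0 ∧
    ∀ γ : Curve n, γ.IsRectifiable → γ.start ≠ γ.finish → γ.start ∉ E → γ.finish ∉ E →
      γ ∉ Γ₀ → ConclusionB k E ρ γ

end NegExt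

end

/-!
The implication from the local Loewner bound to the modification of almost every path carries the
theorem; the other steps of the cycle are comparisons of moduli.

Two facts about rectifiable paths replace parametrizations almost everywhere. For a simple
rectifiable path, length and line integrals are integrals against the one-dimensional Hausdorff
measure `μH[1]` on the trace (`Curve.IsSimple.length_eq`, `Curve.IsSimple.lineIntegral_eq`), and
for a general one they dominate these integrals. If two points can be joined by a Lipschitz path in
a compact set `K` (`LipJoined`), then they are the endpoints of a simple rectifiable path in `K`:
a path with the least Lipschitz constant has no loops (`LipJoined.exists_injOn`). So modifying a
path amounts to building a compact set that joins its endpoints.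

*From modification to negligibility.* A path of `Γ(F₁, F₂; Ω)` on which an admissible `ρ` is small
is replaced, at a small cost, by a path in `𝓕_*(E)` (`ModificationB.isNegligible`). The same
property on segments, with `ρ` the characteristic function of the complement of `E`, shows that `E`
is a null set (`ModificationB.volume_eq_zero`). If modification is only known for endpoints outside
the null set `E`, then almost every path is cut at countably many points outside `E` that
accumulate at its endpoints (`ModificationBOff.modificationB`).

*From weak negligibility to the local Loewner bound.* Near a point of `E` small balls lie in `Ω`,
and `Γ(F₁, F₂; Ω)` has modulus bounded below there by the Loewner property of balls
(`exists_modulus_joining_ge`): if `ρ` is small in `Lⁿ`, then a covering argument gives points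
`x ∈ F₁` and `y ∈ F₂` at which all averages of `ρ ^ n` are controlled, and integration in polar
coordinates gives a point `z` for which the path `[x, z] ∪ [z, y]` is short for `ρ`.

*From the local Loewner bound to modification.* The bound fails at density points of `E`, so `E` is
a null set (`LocalLoewnerBound.volume_eq_zero`). A family of modulus at least `φ` contains paths
that stay at their scale `s` and whose length and `ρ`-length are at most a constant times
`detourCost`, that is `s + ‖ρ‖_{Lⁿ(B(z, C s))}` (`exists_detour_constants`). Cover `E` by balls of a
small radius `s` with bounded overlap. The sum of `detourCost / s` times the characteristic
functions of the doubled balls has a small `Lⁿ`-norm since a neighbourhood of `E` has small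
measure, and its integral along a path bounds the total cost of detours around the balls that the
path meets. Hence these costs tend to zero with `s` along almost every path (`exists_covers`). The
balls are dealt with one after the other: the arc up to its first point in `B(z, s) ∩ E` and the arc
after its last point in that ball are two continua of bounded relative distance, and a detour
between them leaves the ball behind for good (`exists_bypass`, `exists_finite_detours`). If an
endpoint lies in `E`, then again the path is cut at countably many points outside `E`
(`ArcModifiable.conclusionA`).
-/

namespace NegExt

open Filter Topology

/-! ### Arclength and one-dimensional Hausdorff measure -/

section

variable {n : ℕ}

namespace Curve

variable (γ : Curve n)

theorem isCompact_trace : IsCompact γ.trace := by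
  have : CompactSpace (Icc γ.a γ.b) := isCompact_iff_compactSpace.1 isCompact_Icc
  exact isCompact_range γ.toFun.continuous

theorem start_mem_trace : γ.start ∈ γ.trace := ⟨_, rfl⟩

theorem finish_mem_trace : γ.finish ∈ γ.trace := ⟨_, rfl⟩

theorem isPreconnected_trace : IsPreconnected γ.trace := by
  have : PreconnectedSpace (Icc γ.a γ.b) := Subtype.preconnectedSpace isPreconnected_Icc
  exact isPreconnected_range γ.toFun.continuous

theorem bdry_subset_trace : γ.bdry ⊆ γ.trace := by
  rintro x (rfl | rfl)
  exacts [γ.start_mem_trace, γ.finish_mem_trace]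

/-- The length of the initial part of a path. -/
noncomputable def variation : Icc γ.a γ.b → ℝ := variationOnFromTo γ.toFun univ γ.left

variable {γ}

theorem IsRectifiable.boundedVariationOn (h : γ.IsRectifiable) :
    BoundedVariationOn γ.toFun univ := h.ne

theorem IsRectifiable.continuous_variation (h : γ.IsRectifiable) : Continuous γ.variation := by
  have hl := h.boundedVariationOn.locallyBoundedVariationOn
  refine continuous_iff_continuousAt.2 fun b => ?_
  have hf : ContinuousAt γ.toFun b := γ.toFun.continuous.continuousAt
  have h1 := variationOnFromTo.tendsto_left (mem_univ γ.left) (mem_univ b) hl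
    (hf.tendsto.mono_left nhdsWithin_le_nhds)
  have h2 := variationOnFromTo.tendsto_right (mem_univ γ.left) (mem_univ b) hl
    (hf.tendsto.mono_left nhdsWithin_le_nhds)
  simp only [univ_inter, dist_self, sub_zero, add_zero] at h1 h2
  refine continuousAt_iff_continuous_left'_right'.2 ⟨h1, h2⟩

theorem variation_left : γ.variation γ.left = 0 := variationOnFromTo.self _ _ _

theorem variation_right : γ.variation γ.right = γ.length.toReal := by
  have : Icc γ.left γ.right = univ := by
    ext x
    simp only [mem_Icc, mem_univ, iff_true]
    exact ⟨x.2.1, x.2.2⟩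
  rw [variation, variationOnFromTo.eq_of_le _ _ (show γ.left ≤ γ.right from γ.le), this,
    univ_inter, length]

theorem IsRectifiable.range_variation (h : γ.IsRectifiable) :
    range γ.variation = Icc 0 γ.length.toReal := by
  have hm : MonotoneOn γ.variation univ :=
    variationOnFromTo.monotoneOn h.boundedVariationOn.locallyBoundedVariationOn (mem_univ γ.left)
  refine Subset.antisymm ?_ ?_
  · rintro _ ⟨t, rfl⟩
    rw [← variation_left (γ := γ), ← variation_right (γ := γ)]
    exact ⟨hm trivial trivial t.2.1, hm trivial trivial t.2.2⟩
  · have : PreconnectedSpace (Icc γ.a γ.b) := Subtype.preconnectedSpace isPreconnected_Icc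
    rw [← variation_left (γ := γ), ← variation_right (γ := γ)]
    exact intermediate_value_univ _ _ h.continuous_variation

theorem IsRectifiable.arclengthParam_variation (h : γ.IsRectifiable) (t : Icc γ.a γ.b) :
    γ.arclengthParam (γ.variation t) = γ.toFun t :=
  edist_eq_zero.1 <| edist_naturalParameterization_eq_zero
    h.boundedVariationOn.locallyBoundedVariationOn (mem_univ _) (mem_univ t)

theorem IsRectifiable.image_arclengthParam (h : γ.IsRectifiable) :
    γ.arclengthParam '' Icc 0 γ.length.toReal = γ.trace := by
  rw [← h.range_variation, ← range_comp]
  exact congrArg range (funext h.arclengthParam_variation)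

theorem IsRectifiable.lipschitzOnWith (h : γ.IsRectifiable) :
    LipschitzOnWith 1 γ.arclengthParam (Icc 0 γ.length.toReal) := by
  have hu := has_unit_speed_naturalParameterization γ.toFun
    h.boundedVariationOn.locallyBoundedVariationOn (mem_univ γ.left)
  have hr := h.range_variation
  rw [← image_univ] at hr
  change HasUnitSpeedOn γ.arclengthParam (γ.variation '' univ) at hu
  rw [hr] at hu
  have key : ∀ x ∈ Icc 0 γ.length.toReal, ∀ y ∈ Icc 0 γ.length.toReal, x ≤ y →
      edist (γ.arclengthParam x) (γ.arclengthParam y) ≤ edist x y := by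
    intro x hx y hy hxy
    have := hu hx hy
    rw [NNReal.coe_one, one_mul] at this
    rw [edist_dist x y, Real.dist_eq, abs_sub_comm, abs_of_nonneg (sub_nonneg.2 hxy), ← this]
    exact eVariationOn.edist_le _ ⟨hx, le_rfl, hxy⟩ ⟨hy, hxy, le_rfl⟩
  intro x hx y hy
  rw [ENNReal.coe_one, one_mul]
  rcases le_total x y with hxy | hxy
  · exact key x hx y hy hxy
  · rw [edist_comm, edist_comm x]
    exact key y hy x hx hxy

end Curve

/-- `ℋ¹(f(S) ∩ A) ≤ L |S ∩ f⁻¹(A)|` for an `L`-Lipschitz parametrization. -/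
theorem hausdorff_restrict_le_map {f : ℝ → Eu n} {S : Set ℝ} {L : ℝ≥0} (hS : MeasurableSet S)
    (hf : LipschitzOnWith L f S) :
    (μH[1] : Measure (Eu n)).restrict (f '' S) ≤ L • (volume.restrict S).map f := by
  have hm : AEMeasurable f (volume.restrict S) := hf.continuousOn.aemeasurable hS
  refine Measure.le_iff.2 fun A hA => ?_
  rw [Measure.restrict_apply hA, Measure.smul_apply, Measure.map_apply_of_aemeasurable hm hA]
  have h1 : A ∩ f '' S ⊆ f '' (f ⁻¹' A ∩ S) := by
    rintro _ ⟨h, x, hx, rfl⟩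
    exact ⟨x, ⟨h, hx⟩, rfl⟩
  refine (measure_mono h1).trans ?_
  have h2 := (hf.mono (inter_subset_right (s := f ⁻¹' A))).hausdorffMeasure_image_le
    (d := 1) zero_le_one
  rw [hausdorffMeasure_real, ENNReal.rpow_one] at h2
  exact h2.trans (mul_le_mul_right (Measure.le_restrict_apply _ _) _)

theorem lintegral_image_le {f : ℝ → Eu n} {S : Set ℝ} {L : ℝ≥0} (hS : MeasurableSet S)
    (hf : LipschitzOnWith L f S) {ρ : Eu n → ℝ≥0∞} (hρ : Measurable ρ) :
    ∫⁻ x in f '' S, ρ x ∂μH[1] ≤ L * ∫⁻ t in S, ρ (f t) := by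
  refine (lintegral_mono' (hausdorff_restrict_le_map hS hf) le_rfl).trans ?_
  rw [lintegral_smul_measure, lintegral_map' hρ.aemeasurable (hf.continuousOn.aemeasurable hS)]
  rfl

namespace Curve

variable {γ : Curve n}

theorem IsRectifiable.lintegral_trace_le (h : γ.IsRectifiable) {ρ : Eu n → ℝ≥0∞}
    (hρ : Measurable ρ) : ∫⁻ x in γ.trace, ρ x ∂μH[1] ≤ γ.lineIntegral ρ := by
  rw [← h.image_arclengthParam]
  exact (lintegral_image_le measurableSet_Icc h.lipschitzOnWith hρ).trans_eq (one_mul _)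

theorem hausdorff_trace_le : μH[1] γ.trace ≤ γ.length := by
  by_cases h : γ.IsRectifiable
  · have := h.lintegral_trace_le (ρ := fun _ => 1) measurable_const
    simpa [lineIntegral, ENNReal.ofReal_toReal h.ne] using this
  · rw [IsRectifiable, not_lt_top_iff] at h
    rw [h]; exact le_top

end Curve

theorem lipschitz_dist_left (c : Eu n) : LipschitzWith 1 fun x : Eu n => dist x c :=
  LipschitzWith.dist_left c

/-- A connected set that contains a point at distance at most `a` from `c` and a point at distance
at least `b` from `c` has `ℋ¹`-measure at least `b - a` in the spherical shell between them. -/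
theorem le_hausdorff_shell {K : Set (Eu n)} (hK : IsPreconnected K) {c x y : Eu n} {a b : ℝ}
    (hx : x ∈ K) (hy : y ∈ K) (hxa : dist x c ≤ a) (hyb : b ≤ dist y c) :
    ENNReal.ofReal (b - a) ≤ μH[1] (K ∩ {z | a ≤ dist z c ∧ dist z c < b}) := by
  have h1 : Ico a b ⊆ (fun z => dist z c) '' (K ∩ {z | a ≤ dist z c ∧ dist z c < b}) := by
    intro r hr
    obtain ⟨z, hz, hzr⟩ := hK.intermediate_value hx hy
      (lipschitz_dist_left c).continuous.continuousOn ⟨hxa.trans hr.1, hr.2.le.trans hyb⟩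
    have hzr' : dist z c = r := hzr
    exact ⟨z, ⟨hz, by rw [mem_ofPred_eq, hzr']; exact hr⟩, hzr⟩
  have h2 := (lipschitz_dist_left c).hausdorffMeasure_image_le (d := 1) zero_le_one
    (K ∩ {z | a ≤ dist z c ∧ dist z c < b})
  simp only [ENNReal.coe_one, one_mul, ENNReal.rpow_one, hausdorffMeasure_real] at h2
  calc ENNReal.ofReal (b - a) = volume (Ico a b) := Real.volume_Ico.symm
    _ ≤ _ := (measure_mono h1).trans h2

theorem edist_le_hausdorff {K : Set (Eu n)} (hK : IsPreconnected K) {x y : Eu n}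
    (hx : x ∈ K) (hy : y ∈ K) : edist x y ≤ μH[1] K := by
  have := le_hausdorff_shell hK (c := x) (a := 0) (b := dist y x) hx hy (by simp) le_rfl
  rw [sub_zero, dist_comm, ← edist_dist] at this
  exact this.trans (measure_mono inter_subset_left)

instance : NullSingletonClass (μH[1] : Measure (Eu n)) :=
  Measure.nullSingletonClass_hausdorff (Eu n) one_pos

theorem Curve.IsSimple.length_le {γ : Curve n} (h : γ.IsSimple) : γ.length ≤ μH[1] γ.trace := by
  have : CompactSpace (Icc γ.a γ.b) := isCompact_iff_compactSpace.1 isCompact_Icc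
  have hme : MeasurableEmbedding γ.toFun :=
    (γ.toFun.continuous.isClosedEmbedding h).measurableEmbedding
  refine iSup_le ?_
  rintro ⟨N, u, hu, -⟩
  have hstep : ∀ i, edist (γ.toFun (u (i + 1))) (γ.toFun (u i)) ≤
      μH[1] (γ.toFun '' Ioc (u i) (u (i + 1))) := by
    intro i
    have hpre : IsPreconnected (γ.toFun '' Icc (u i) (u (i + 1))) := by
      refine IsPreconnected.image ?_ _ γ.toFun.continuous.continuousOn
      rw [← Topology.IsInducing.subtypeVal.isPreconnected_image]
      have : Subtype.val '' Icc (u i) (u (i + 1)) = Icc (u i : ℝ) (u (i + 1)) := by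
        ext x
        simp only [mem_image, Subtype.exists, mem_Icc]
        constructor
        · rintro ⟨y, hy, hxy, rfl⟩
          exact hxy
        · intro hx
          exact ⟨x, ⟨(u i).2.1.trans hx.1, hx.2.trans (u (i + 1)).2.2⟩, hx, rfl⟩
      rw [this]
      exact isPreconnected_Icc
    have hsub : γ.toFun '' Icc (u i) (u (i + 1)) ⊆
        γ.toFun '' Ioc (u i) (u (i + 1)) ∪ {γ.toFun (u i)} := by
      rintro _ ⟨x, hx, rfl⟩
      rcases hx.1.eq_or_lt with rfl | hlt
      · exact Or.inr rfl
      · exact Or.inl ⟨x, ⟨hlt, hx.2⟩, rfl⟩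
    calc _ ≤ μH[1] (γ.toFun '' Icc (u i) (u (i + 1))) :=
          edist_le_hausdorff hpre ⟨_, ⟨hu (Nat.le_succ i), le_rfl⟩, rfl⟩
            ⟨_, ⟨le_rfl, hu (Nat.le_succ i)⟩, rfl⟩
      _ ≤ μH[1] (γ.toFun '' Ioc (u i) (u (i + 1))) + μH[1] {γ.toFun (u i)} :=
          (measure_mono hsub).trans (measure_union_le _ _)
      _ = _ := by rw [measure_singleton, add_zero]
  calc _ ≤ ∑ i ∈ Finset.range N, μH[1] (γ.toFun '' Ioc (u i) (u (i + 1))) :=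
        Finset.sum_le_sum fun i _ => hstep i
    _ = μH[1] (⋃ i ∈ Finset.range N, γ.toFun '' Ioc (u i) (u (i + 1))) := by
        refine (measure_biUnion_finset (fun i _ j _ hij => ?_) fun i _ => ?_).symm
        · exact (disjoint_image_iff h).2 (hu.pairwise_disjoint_on_Ioc_succ hij)
        · exact hme.measurableSet_image.2 measurableSet_Ioc
    _ ≤ _ := measure_mono (iUnion₂_subset fun i _ => image_subset_range _ _)

theorem Curve.IsSimple.length_eq {γ : Curve n} (h : γ.IsSimple) : γ.length = μH[1] γ.trace :=
  h.length_le.antisymm Curve.hausdorff_trace_le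

/-- For a simple path the arclength measure is `ℋ¹` restricted to the trace: the pushforward of
Lebesgue measure dominates it and both have the same finite total mass. -/
theorem Curve.IsSimple.lineIntegral_eq {γ : Curve n} (h : γ.IsSimple) (hr : γ.IsRectifiable)
    {ρ : Eu n → ℝ≥0∞} (hρ : Measurable ρ) : γ.lineIntegral ρ = ∫⁻ x in γ.trace, ρ x ∂μH[1] := by
  have hm := hr.lipschitzOnWith.continuousOn.aemeasurable (μ := volume) measurableSet_Icc
  rw [Curve.lineIntegral, ← lintegral_map' hρ.aemeasurable hm,
    ← hr.image_arclengthParam]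
  have hle := hausdorff_restrict_le_map measurableSet_Icc hr.lipschitzOnWith
  rw [one_smul] at hle
  have huniv : ((volume.restrict (Icc 0 γ.length.toReal)).map γ.arclengthParam) univ =
      γ.length := by
    rw [Measure.map_apply_of_aemeasurable hm MeasurableSet.univ]
    simp [ENNReal.ofReal_toReal hr.ne]
  have : IsFiniteMeasure ((volume.restrict (Icc 0 γ.length.toReal)).map γ.arclengthParam) :=
    ⟨by rw [huniv]; exact hr⟩
  have := isFiniteMeasure_of_le _ hle
  refine congrArg (fun μ => ∫⁻ x, ρ x ∂μ) (Measure.eq_of_le_of_measure_univ_eq hle ?_).symm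
  rw [huniv, hr.image_arclengthParam, Measure.restrict_apply_univ, h.length_eq]

end

/-! ### Lipschitz paths in compact sets -/

section

variable {n : ℕ}

/-- The points `x` and `y` are joined in `K` by an `L`-Lipschitz path with parameter interval
`[0, 1]`. The path is extended to `ℝ` so that it still takes values in `K`. -/
def LipJoinedWith (L : ℝ≥0) (K : Set (Eu n)) (x y : Eu n) : Prop :=
  ∃ f : ℝ → Eu n, LipschitzWith L f ∧ (∀ t, f t ∈ K) ∧ f 0 = x ∧ f 1 = y

/-- The points `x` and `y` are joined in `K` by a Lipschitz path. -/
def LipJoined (K : Set (Eu n)) (x y : Eu n) : Prop := ∃ L, LipJoinedWith L K x y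

theorem LipJoinedWith.mono {L L' : ℝ≥0} {K K' : Set (Eu n)} {x y : Eu n}
    (h : LipJoinedWith L K x y) (hL : L ≤ L') (hK : K ⊆ K') : LipJoinedWith L' K' x y := by
  obtain ⟨f, hf, hfK, h0, h1⟩ := h
  exact ⟨f, hf.weaken hL, fun t => hK (hfK t), h0, h1⟩

theorem LipJoined.mono {K K' : Set (Eu n)} {x y : Eu n} (h : LipJoined K x y) (hK : K ⊆ K') :
    LipJoined K' x y :=
  h.imp fun _ hL => hL.mono le_rfl hK

theorem LipJoined.left_mem {K : Set (Eu n)} {x y : Eu n} (h : LipJoined K x y) : x ∈ K := by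
  obtain ⟨L, f, -, hf, rfl, -⟩ := h
  exact hf 0

theorem LipJoined.refl {K : Set (Eu n)} {x : Eu n} (h : x ∈ K) : LipJoined K x x :=
  ⟨0, fun _ => x, LipschitzWith.const x, fun _ => h, rfl, rfl⟩

/-- Clamping `t ↦ a + t (b - a)` to `[a, b]`. -/
theorem lipschitz_clamp {a b : ℝ} (hab : a ≤ b) :
    LipschitzWith (b - a).toNNReal fun t : ℝ => max a (min b (a + t * (b - a))) := by
  have h1 : LipschitzWith (b - a).toNNReal fun t : ℝ => a + t * (b - a) := by
    refine LipschitzWith.of_dist_le_mul fun s t => ?_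
    rw [dist_add_left, Real.dist_eq, ← sub_mul, abs_mul, abs_of_nonneg (sub_nonneg.2 hab),
      Real.coe_toNNReal _ (sub_nonneg.2 hab), mul_comm, Real.dist_eq]
  exact (h1.const_min b).const_max a

theorem LipschitzOnWith.lipJoinedWith {f : ℝ → Eu n} {L : ℝ≥0} {a b : ℝ} (hab : a ≤ b)
    (hf : LipschitzOnWith L f (Icc a b)) :
    LipJoinedWith (L * (b - a).toNNReal) (f '' Icc a b) (f a) (f b) := by
  have hm : ∀ t : ℝ, max a (min b (a + t * (b - a))) ∈ Icc a b := fun t =>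
    ⟨le_max_left _ _, max_le hab (min_le_left _ _)⟩
  refine ⟨fun t => f (max a (min b (a + t * (b - a)))), ?_, fun t => ⟨_, hm t, rfl⟩, ?_, ?_⟩
  · rw [← lipschitzOnWith_univ]
    exact hf.comp (lipschitz_clamp hab).lipschitzOnWith fun t _ => hm t
  · simp [hab]
  · simp [hab]

theorem LipschitzWith.lipJoined {f : ℝ → Eu n} {L : ℝ≥0} {a b : ℝ} (hab : a ≤ b)
    (hf : LipschitzWith L f) : LipJoined (f '' Icc a b) (f a) (f b) :=
  ⟨_, LipschitzOnWith.lipJoinedWith hab hf.lipschitzOnWith⟩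

theorem LipJoined.symm {K : Set (Eu n)} {x y : Eu n} (h : LipJoined K x y) : LipJoined K y x := by
  obtain ⟨L, f, hf, hfK, rfl, rfl⟩ := h
  have h1 : LipschitzWith 1 fun t : ℝ => 1 - t :=
    LipschitzWith.of_dist_le_mul fun s t => by
      rw [NNReal.coe_one, one_mul, dist_sub_left]
  exact ⟨L * 1, fun t => f (1 - t), hf.comp h1, fun t => hfK _, by simp, by simp⟩

theorem LipJoined.trans {K : Set (Eu n)} {x y z : Eu n} (h : LipJoined K x y)
    (h' : LipJoined K y z) : LipJoined K x z := by
  obtain ⟨L, f, hf, hfK, rfl, rfl⟩ := h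
  obtain ⟨M, g, hg, hgK, hg0, rfl⟩ := h'
  have h2 : LipschitzWith 2 fun t : ℝ => 2 * t := by
    refine LipschitzWith.of_dist_le_mul fun s t => ?_
    rw [Real.dist_eq, ← mul_sub, abs_mul, Real.dist_eq]
    simp
  have h3 : LipschitzWith 2 fun t : ℝ => 2 * t - 1 := by
    refine LipschitzWith.of_dist_le_mul fun s t => ?_
    rw [dist_sub_right]
    exact h2.dist_le_mul s t
  -- the first summand is constant for `t ≥ 1 / 2`, the second one for `t ≤ 1 / 2`
  have hF := (hf.comp (h2.const_min 1)).add (hg.comp (h3.const_max 0))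
  have hF' := hF.sub (LipschitzWith.const (f 1))
  refine ⟨_, _, hF', fun t => ?_, ?_, ?_⟩
  · simp only [Function.comp_apply]
    rcases le_total (2 * t) 1 with ht | ht
    · rw [min_eq_right ht, max_eq_left (by linarith), hg0, add_sub_cancel_right]
      exact hfK _
    · rw [min_eq_left ht, add_sub_cancel_left]
      exact hgK _
  · simp [hg0]
  · norm_num

theorem Curve.IsRectifiable.lipJoinedWith {γ : Curve n} (h : γ.IsRectifiable) :
    LipJoinedWith γ.length.toNNReal γ.trace γ.start γ.finish := by
  have := LipschitzOnWith.lipJoinedWith ENNReal.toReal_nonneg h.lipschitzOnWith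
  rw [h.image_arclengthParam, ← Curve.variation_right, h.arclengthParam_variation,
    ← Curve.variation_left, h.arclengthParam_variation, Curve.variation_left,
    Curve.variation_right, sub_zero, one_mul] at this
  rw [show γ.length.toReal.toNNReal = γ.length.toNNReal from Real.toNNReal_coe] at this
  exact this

theorem Curve.IsRectifiable.lipJoined {γ : Curve n} (h : γ.IsRectifiable) :
    LipJoined γ.trace γ.start γ.finish := ⟨_, h.lipJoinedWith⟩

/-- Cutting a loop `f s = f t` out of an `L`-Lipschitz path decreases the Lipschitz constant. -/
theorem LipJoinedWith.cut_loop {f : ℝ → Eu n} {L : ℝ≥0} (hf : LipschitzWith L f) {s t : ℝ}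
    (hs : 0 ≤ s) (ht : t ≤ 1) (h : f s = f t) :
    LipJoinedWith (L * (1 - (t - s)).toNNReal) (range f) (f 0) (f 1) := by
  set l := 1 - (t - s) with hl
  have hl0 : 0 ≤ l := by linarith
  refine ⟨fun u => if l * u ≤ s then f (l * u) else f (l * u + (t - s)), ?_, fun u => ?_, ?_, ?_⟩
  · have key : ∀ u v, u ≤ v →
        dist (if l * u ≤ s then f (l * u) else f (l * u + (t - s)))
          (if l * v ≤ s then f (l * v) else f (l * v + (t - s))) ≤ L * (l * (v - u)) := by
      intro u v huv
      have huv' : l * u ≤ l * v := mul_le_mul_of_nonneg_left huv hl0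
      have hd : ∀ {p q : ℝ}, p ≤ q → dist (f p) (f q) ≤ L * (q - p) := fun {p q} hpq => by
        have := hf.dist_le_mul p q
        rwa [Real.dist_eq, abs_sub_comm, abs_of_nonneg (sub_nonneg.2 hpq)] at this
      by_cases hv : l * v ≤ s
      · rw [if_pos hv, if_pos (huv'.trans hv)]
        exact (hd huv').trans (by rw [← mul_sub])
      · rw [if_neg hv]
        by_cases hu : l * u ≤ s
        · rw [if_pos hu]
          have h1 := hd hu
          have h2 := hd (show t ≤ l * v + (t - s) by linarith)
          have h3 := dist_triangle (f (l * u)) (f s) (f (l * v + (t - s)))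
          rw [h] at h1 h3
          calc _ ≤ _ := h3
            _ ≤ L * (s - l * u) + L * (l * v + (t - s) - t) := add_le_add h1 h2
            _ = _ := by ring
        · rw [if_neg hu]
          refine (hd (by linarith)).trans (le_of_eq (by ring))
    refine LipschitzWith.of_dist_le_mul fun u v => ?_
    rw [NNReal.coe_mul, Real.coe_toNNReal _ hl0, mul_assoc, Real.dist_eq]
    rcases le_total u v with huv | huv
    · rw [abs_sub_comm, abs_of_nonneg (sub_nonneg.2 huv)]
      exact key u v huv
    · rw [abs_of_nonneg (sub_nonneg.2 huv), dist_comm]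
      exact key v u huv
  · dsimp only
    split_ifs <;> exact mem_range_self _
  · simp [hs]
  · dsimp only
    rw [mul_one]
    split_ifs with h1
    · have : t = 1 := by linarith
      rw [hl, this, show 1 - (1 - s) = s by ring, h, this]
    · rw [show l + (t - s) = 1 by rw [hl]; ring]

/-- The graph of the pairs consisting of a Lipschitz path in `K` and a bound of its Lipschitz
constant is compact for pointwise convergence. -/
theorem isCompact_lipschitz_paths {K : Set (Eu n)} (hK : IsCompact K) (L : ℝ) :
    IsCompact {p : ℝ × (ℝ → Eu n) | p.1 ∈ Icc 0 L ∧ (∀ t, p.2 t ∈ K) ∧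
      ∀ s t, dist (p.2 s) (p.2 t) ≤ p.1 * dist s t} := by
  have hc : IsCompact (Icc 0 L ×ˢ Set.pi univ fun _ : ℝ => K) :=
    isCompact_Icc.prod (isCompact_univ_pi fun _ => hK)
  have hcl : IsClosed {p : ℝ × (ℝ → Eu n) | ∀ s t, dist (p.2 s) (p.2 t) ≤ p.1 * dist s t} := by
    simp only [ofPred_forall]
    refine isClosed_iInter fun s => isClosed_iInter fun t => isClosed_le ?_ ?_
    · exact ((continuous_apply s).comp continuous_snd).dist
        ((continuous_apply t).comp continuous_snd)
    · exact continuous_fst.mul continuous_const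
  convert hc.inter_right hcl using 1
  ext p
  simp only [mem_ofPred_eq, mem_inter_iff, mem_prod, Set.mem_pi, mem_univ, true_imp_iff, and_assoc]

theorem isClosed_setOf_lipJoinedWith {K : Set (Eu n)} (hK : IsCompact K) (L : ℝ≥0) :
    IsClosed {p : Eu n × Eu n | LipJoinedWith L K p.1 p.2} := by
  have hcont : Continuous fun p : ℝ × (ℝ → Eu n) => (p.2 0, p.2 1) :=
    ((continuous_apply 0).comp continuous_snd).prodMk ((continuous_apply 1).comp continuous_snd)
  convert ((isCompact_lipschitz_paths hK L).image hcont).isClosed using 1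
  ext ⟨x, y⟩
  constructor
  · rintro ⟨f, hf, hfK, rfl, rfl⟩
    exact ⟨(L, f), ⟨⟨L.2, le_rfl⟩, hfK, hf.dist_le_mul⟩, rfl⟩
  · rintro ⟨⟨l, f⟩, ⟨hl, hfK, hf⟩, h⟩
    obtain ⟨rfl, rfl⟩ := Prod.mk.inj h
    exact ⟨f, LipschitzWith.of_dist_le_mul fun s t => (hf s t).trans
      (mul_le_mul_of_nonneg_right hl.2 dist_nonneg), hfK, rfl, rfl⟩

/-- A path with the least Lipschitz constant among those joining two points in a compact set is
injective. -/
theorem LipJoined.exists_injOn {K : Set (Eu n)} (hK : IsCompact K) {x y : Eu n} (hxy : x ≠ y)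
    (h : LipJoined K x y) : ∃ (L : ℝ≥0) (f : ℝ → Eu n), LipschitzWith L f ∧ (∀ t, f t ∈ K) ∧
      f 0 = x ∧ f 1 = y ∧ InjOn f (Icc 0 1) := by
  obtain ⟨L₀, f₀, hf₀, hf₀K, h₀, h₁⟩ := h
  have hc : IsCompact ({p : ℝ × (ℝ → Eu n) | p.1 ∈ Icc 0 (L₀ : ℝ) ∧ (∀ t, p.2 t ∈ K) ∧
      ∀ s t, dist (p.2 s) (p.2 t) ≤ p.1 * dist s t} ∩ {p | p.2 0 = x ∧ p.2 1 = y}) := by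
    refine (isCompact_lipschitz_paths hK L₀).inter_right ?_
    exact (isClosed_eq ((continuous_apply 0).comp continuous_snd) continuous_const).inter
      (isClosed_eq ((continuous_apply 1).comp continuous_snd) continuous_const)
  obtain ⟨⟨l, f⟩, ⟨⟨hl, hfK, hf⟩, hf0, hf1⟩, hmin⟩ := hc.exists_isMinOn
    ⟨(L₀, f₀), ⟨⟨L₀.2, le_rfl⟩, hf₀K, hf₀.dist_le_mul⟩, h₀, h₁⟩ continuous_fst.continuousOn
  dsimp only at hl hfK hf hf0 hf1
  have hlip : LipschitzWith l.toNNReal f :=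
    LipschitzWith.of_dist_le_mul fun s t => by rw [Real.coe_toNNReal _ hl.1]; exact hf s t
  have hlpos : 0 < l := by
    rcases hl.1.eq_or_lt with h0 | h0
    · have := hf 0 1
      rw [← h0, zero_mul, hf0, hf1] at this
      exact absurd (dist_le_zero.1 this) hxy
    · exact h0
  refine ⟨_, f, hlip, hfK, hf0, hf1, ?_⟩
  -- a loop between the times `s` and `t` could be cut out, against the minimality of `l`
  have key : ∀ s ∈ Icc (0 : ℝ) 1, ∀ t ∈ Icc (0 : ℝ) 1, s < t → f s ≠ f t := by
    intro s hs t ht hst heq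
    obtain ⟨g, hg, hgK, hg0, hg1⟩ := LipJoinedWith.cut_loop hlip hs.1 ht.2 heq
    have h1 : (0 : ℝ) ≤ 1 - (t - s) := by linarith [hs.1, ht.2]
    have h2 : l * (1 - (t - s)) < l := by nlinarith
    have := hmin (a := (l * (1 - (t - s)), g)) ⟨⟨⟨mul_nonneg hl.1 h1, h2.le.trans hl.2⟩,
      fun u => show g u ∈ K by obtain ⟨v, hv⟩ := hgK u; rw [← hv]; exact hfK v, fun u v => by
        have := hg.dist_le_mul u v
        rwa [NNReal.coe_mul, Real.coe_toNNReal _ hl.1, Real.coe_toNNReal _ h1] at this⟩,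
      hg0.trans hf0, hg1.trans hf1⟩
    exact absurd h2 (not_lt.2 this)
  intro s hs t ht heq
  rcases lt_trichotomy s t with hst | hst | hst
  · exact absurd heq (key s hs t ht hst)
  · exact hst
  · exact absurd heq.symm (key t ht s hs hst)

/-- The path on `[a, b]` obtained by restricting a function. -/
def Curve.ofFun (f : ℝ → Eu n) (hf : Continuous f) {a b : ℝ} (hab : a ≤ b) : Curve n :=
  ⟨a, b, hab, ⟨fun t => f t, hf.comp continuous_subtype_val⟩⟩

section ofFun

variable {f : ℝ → Eu n} (hf : Continuous f) {a b : ℝ} (hab : a ≤ b)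

theorem Curve.trace_ofFun : (Curve.ofFun f hf hab).trace = f '' Icc a b := by
  rw [image_eq_range]; rfl

theorem Curve.start_ofFun : (Curve.ofFun f hf hab).start = f a := rfl

theorem Curve.finish_ofFun : (Curve.ofFun f hf hab).finish = f b := rfl

theorem Curve.isSimple_ofFun (h : InjOn f (Icc a b)) : (Curve.ofFun f hf hab).IsSimple :=
  fun s t hst => Subtype.ext (h s.2 t.2 hst)

end ofFun

theorem hausdorff_image_Icc_lt_top {f : ℝ → Eu n} {L : ℝ≥0} (hf : LipschitzWith L f) (a b : ℝ) :
    μH[1] (f '' Icc a b) < ∞ := by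
  have h := hf.hausdorffMeasure_image_le (d := 1) zero_le_one (Icc a b)
  rw [hausdorffMeasure_real, Real.volume_Icc, ENNReal.rpow_one] at h
  exact h.trans_lt (ENNReal.mul_lt_top ENNReal.coe_lt_top ENNReal.ofReal_lt_top)

theorem Curve.isRectifiable_ofFun {f : ℝ → Eu n} {L : ℝ≥0} (hf : LipschitzWith L f) {a b : ℝ}
    (hab : a ≤ b) (h : InjOn f (Icc a b)) : (Curve.ofFun f hf.continuous hab).IsRectifiable := by
  rw [Curve.IsRectifiable, (Curve.isSimple_ofFun hf.continuous hab h).length_eq, Curve.trace_ofFun]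
  exact hausdorff_image_Icc_lt_top hf a b

theorem LipJoined.exists_curve {K : Set (Eu n)} (hK : IsCompact K) {x y : Eu n} (hxy : x ≠ y)
    (h : LipJoined K x y) : ∃ γ : Curve n, γ.IsSimple ∧ γ.IsRectifiable ∧ γ.trace ⊆ K ∧
      γ.start = x ∧ γ.finish = y := by
  obtain ⟨L, f, hf, hfK, h0, h1, hinj⟩ := h.exists_injOn hK hxy
  refine ⟨Curve.ofFun f hf.continuous zero_le_one, Curve.isSimple_ofFun _ _ hinj,
    Curve.isRectifiable_ofFun hf _ hinj, ?_, h0, h1⟩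
  rw [Curve.trace_ofFun]
  rintro _ ⟨t, -, rfl⟩
  exact hfK t

/-- In a compact set of finite `ℋ¹`-measure the Lipschitz constant can be chosen uniformly. -/
theorem LipJoined.joinedWith {K : Set (Eu n)} (hK : IsCompact K) {x y : Eu n}
    (hfin : μH[1] K < ∞) (h : LipJoined K x y) : LipJoinedWith (μH[1] K).toNNReal K x y := by
  rcases eq_or_ne x y with rfl | hxy
  · exact ⟨fun _ => x, (LipschitzWith.const x).weaken zero_le, fun _ => h.left_mem, rfl, rfl⟩
  · obtain ⟨γ, hs, hr, hK', rfl, rfl⟩ := h.exists_curve hK hxy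
    refine hr.lipJoinedWith.mono ?_ hK'
    rw [hs.length_eq]
    exact ENNReal.toNNReal_mono hfin.ne (measure_mono hK')

theorem LipJoined.of_tendsto {K : Set (Eu n)} (hK : IsCompact K) (hfin : μH[1] K < ∞)
    {u v : ℕ → Eu n} {x y : Eu n} (hu : Tendsto u atTop (𝓝 x)) (hv : Tendsto v atTop (𝓝 y))
    (h : ∀ j, LipJoined K (u j) (v j)) : LipJoined K x y :=
  ⟨_, (isClosed_setOf_lipJoinedWith hK (μH[1] K).toNNReal).mem_of_tendsto (hu.prodMk_nhds hv)
    (Eventually.of_forall fun j => (h j).joinedWith hK hfin)⟩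

end

/-! ### Modulus of path families -/

section

variable {n : ℕ}

/-- A set is good if it is disjoint from `E` (for `NED`), respectively if it meets `E` in a
countable set (for `CNED`). A path is in `𝓕_*(E)` exactly if its trace without the endpoints is
good, see `mem_family_iff`. -/
def Kind.Good (k : Kind) (E S : Set (Eu n)) : Prop :=
  match k with
  | .ned => Disjoint S E
  | .cned => (E ∩ S).Countable

section Good

variable {k : Kind} {E S T : Set (Eu n)}

theorem Kind.Good.mono (h : k.Good E S) (hT : T ⊆ S) : k.Good E T := by
  cases k
  · exact Disjoint.mono_left hT h
  · exact Countable.mono (inter_subset_inter_right _ hT) h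

theorem Kind.Good.iUnion {ι : Type*} [Countable ι] {S : ι → Set (Eu n)}
    (h : ∀ i, k.Good E (S i)) : k.Good E (⋃ i, S i) := by
  cases k
  · exact disjoint_iUnion_left.2 h
  · change (E ∩ ⋃ i, S i).Countable
    rw [inter_iUnion]
    exact countable_iUnion h

theorem Kind.Good.union (h : k.Good E S) (h' : k.Good E T) : k.Good E (S ∪ T) := by
  rw [union_eq_iUnion]
  refine Kind.Good.iUnion fun b => ?_
  cases b
  exacts [h', h]

theorem Kind.good_of_disjoint (h : Disjoint S E) : k.Good E S := by
  cases k
  · exact h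
  · change (E ∩ S).Countable
    rw [inter_comm, h.inter_eq]
    exact countable_empty

theorem Kind.good_singleton {x : Eu n} (h : x ∉ E) : k.Good E {x} :=
  Kind.good_of_disjoint (disjoint_singleton_left.2 h)

theorem Curve.finite_bdry (γ : Curve n) : γ.bdry.Finite := (Set.toFinite {γ.start, γ.finish})

theorem mem_family_iff {γ : Curve n} : γ ∈ k.family E ↔ k.Good E (γ.trace \ γ.bdry) := by
  cases k
  · exact Iff.rfl
  · change (E ∩ γ.trace).Countable ↔ (E ∩ (γ.trace \ γ.bdry)).Countable
    refine ⟨fun h => h.mono (inter_subset_inter_right _ sdiff_subset), fun h => ?_⟩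
    refine (h.union γ.finite_bdry.countable).mono fun x hx => ?_
    by_cases hb : x ∈ γ.bdry
    exacts [Or.inr hb, Or.inl ⟨hx.1, hx.2, hb⟩]

theorem Kind.Good.inter_countable (h : k.Good E S) : (S ∩ E).Countable := by
  cases k
  · rw [Disjoint.inter_eq h]
    exact countable_empty
  · rw [inter_comm]
    exact h

theorem countable_inter_of_mem_family {γ : Curve n} (h : γ ∈ k.family E) :
    (γ.trace ∩ E).Countable := by
  refine ((mem_family_iff.1 h).inter_countable.union γ.finite_bdry.countable).mono fun x hx => ?_
  by_cases hb : x ∈ γ.bdry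
  exacts [Or.inr hb, Or.inl ⟨⟨hx.1, hb⟩, hx.2⟩]

end Good

section modulus

variable {Γ Γ' : Set (Curve n)}

theorem modulus_mono (h : Γ ⊆ Γ') : modulus Γ ≤ modulus Γ' :=
  le_iInf₂ fun ρ hρ => iInf₂_le ρ ⟨hρ.1, fun γ hγ => hρ.2 γ (h hγ)⟩

theorem modulus_le {ρ : Eu n → ℝ≥0∞} (hρ : Measurable ρ)
    (h : ∀ γ ∈ Γ, γ.IsRectifiable → 1 ≤ γ.lineIntegral ρ) : modulus Γ ≤ ∫⁻ x, ρ x ^ n :=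
  iInf₂_le ρ ⟨hρ, h⟩

theorem exists_admissible_lt {c : ℝ≥0∞} (h : modulus Γ < c) :
    ∃ ρ, IsAdmissible Γ ρ ∧ ∫⁻ x, ρ x ^ n < c := by
  simpa [modulus, iInf_lt_iff] using h

/-- A lower bound for the modulus yields a path that is short for a given function. -/
theorem exists_lineIntegral_lt {ρ : Eu n → ℝ≥0∞} (hρ : Measurable ρ)
    (h : ∫⁻ x, ρ x ^ n < modulus Γ) : ∃ γ ∈ Γ, γ.IsRectifiable ∧ γ.lineIntegral ρ < 1 := by
  by_contra! hcon
  exact absurd (modulus_le hρ hcon) (not_le.2 h)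

theorem Curve.lineIntegral_mono {γ : Curve n} {ρ ρ' : Eu n → ℝ≥0∞} (h : ∀ x, ρ x ≤ ρ' x) :
    γ.lineIntegral ρ ≤ γ.lineIntegral ρ' :=
  lintegral_mono fun _ => h _

theorem Curve.lineIntegral_const_mul {γ : Curve n} {ρ : Eu n → ℝ≥0∞} {c : ℝ≥0∞} (hc : c ≠ ∞) :
    γ.lineIntegral (fun x => c * ρ x) = c * γ.lineIntegral ρ :=
  lintegral_const_mul' _ _ hc

theorem modulus_union_le : modulus (Γ ∪ Γ') ≤ modulus Γ + modulus Γ' := by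
  refine ENNReal.le_of_forall_pos_le_add fun ε hε hfin => ?_
  have hε' : ((ε / 2 : ℝ≥0) : ℝ≥0∞) ≠ 0 := by simpa using hε.ne'
  obtain ⟨ρ, hρ, hρl⟩ := exists_admissible_lt
    (ENNReal.lt_add_right (ne_top_of_le_ne_top hfin.ne le_self_add) hε')
  obtain ⟨ρ', hρ', hρl'⟩ := exists_admissible_lt
    (ENNReal.lt_add_right (ne_top_of_le_ne_top hfin.ne le_add_self) hε')
  have h1 : modulus (Γ ∪ Γ') ≤ ∫⁻ x, (max (ρ x) (ρ' x)) ^ n := by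
    refine modulus_le (hρ.1.max hρ'.1) ?_
    rintro γ (hγ | hγ) hr
    · exact (hρ.2 γ hγ hr).trans (Curve.lineIntegral_mono fun x => le_max_left _ _)
    · exact (hρ'.2 γ hγ hr).trans (Curve.lineIntegral_mono fun x => le_max_right _ _)
  calc _ ≤ _ := h1
    _ ≤ ∫⁻ x, (ρ x ^ n + ρ' x ^ n) := by
        refine lintegral_mono fun x => ?_
        rcases le_total (ρ x) (ρ' x) with h | h
        · rw [max_eq_right h]; exact le_add_self
        · rw [max_eq_left h]; exact le_self_add
    _ = (∫⁻ x, ρ x ^ n) + ∫⁻ x, ρ' x ^ n := lintegral_add_left (hρ.1.pow_const n) _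
    _ ≤ (modulus Γ + (ε / 2 : ℝ≥0)) + (modulus Γ' + (ε / 2 : ℝ≥0)) := add_le_add hρl.le hρl'.le
    _ = _ := by
        rw [add_add_add_comm, ← ENNReal.coe_add, add_halves]

theorem modulus_union_eq_zero (h : modulus Γ = 0) (h' : modulus Γ' = 0) :
    modulus (Γ ∪ Γ') = 0 := by
  have := modulus_union_le (Γ := Γ) (Γ' := Γ')
  rw [h, h', add_zero] at this
  exact nonpos_iff_eq_zero.1 this

theorem modulus_empty (hn : n ≠ 0) : modulus (∅ : Set (Curve n)) = 0 := by
  have := modulus_le (Γ := (∅ : Set (Curve n))) (ρ := fun _ => 0) measurable_const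
    fun γ hγ => absurd hγ (notMem_empty γ)
  simpa [hn] using this

/-- A family of paths along which a fixed function in `Lⁿ` has infinite integral is
exceptional. -/
theorem modulus_eq_zero (hn : n ≠ 0) {G : Eu n → ℝ≥0∞} (hG : Measurable G)
    (hfin : ∫⁻ x, G x ^ n ≠ ∞) (h : ∀ γ ∈ Γ, γ.IsRectifiable → γ.lineIntegral G = ∞) :
    modulus Γ = 0 := by
  have key : ∀ m : ℕ, modulus Γ ≤ ((m : ℝ≥0∞) + 1)⁻¹ * ∫⁻ x, G x ^ n := by
    intro m
    have hc0 : ((m : ℝ≥0∞) + 1)⁻¹ ≠ 0 := by simp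
    have hc1 : ((m : ℝ≥0∞) + 1)⁻¹ ≠ ∞ := by simp
    have hle : ((m : ℝ≥0∞) + 1)⁻¹ ≤ 1 := by simp
    have := modulus_le (Γ := Γ) (hG.const_mul ((m : ℝ≥0∞) + 1)⁻¹) fun γ hγ hr => by
      rw [Curve.lineIntegral_const_mul hc1, h γ hγ hr, ENNReal.mul_top hc0]
      exact le_top
    refine this.trans ?_
    simp_rw [mul_pow]
    rw [lintegral_const_mul _ (hG.pow_const n)]
    gcongr
    exact pow_le_of_le_one zero_le hle hn
  have hlim : Tendsto (fun m : ℕ => ((m : ℝ≥0∞) + 1)⁻¹ * ∫⁻ x, G x ^ n) atTop (𝓝 0) := by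
    have h1 : Tendsto (fun m : ℕ => ((m : ℝ≥0∞) + 1)⁻¹) atTop (𝓝 0) := by
      have := (tendsto_add_atTop_iff_nat 1).2 ENNReal.tendsto_inv_nat_nhds_zero
      simpa using this
    simpa using ENNReal.Tendsto.mul_const h1 (Or.inr hfin)
  exact nonpos_iff_eq_zero.1 (ge_of_tendsto' hlim key)

/-- Paths that contain a simple path of `Γ` are not more plentiful than the paths of `Γ`. -/
theorem modulus_superpaths_le :
    modulus {γ : Curve n | ∃ η ∈ Γ, η.IsSimple ∧ η.IsRectifiable ∧ η.trace ⊆ γ.trace} ≤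
      modulus Γ := by
  refine le_iInf₂ fun ρ hρ => iInf₂_le ρ ⟨hρ.1, ?_⟩
  rintro γ ⟨η, hη, hs, hr, hsub⟩ hγ
  calc 1 ≤ η.lineIntegral ρ := hρ.2 η hη hr
    _ = ∫⁻ x in η.trace, ρ x ∂μH[1] := hs.lineIntegral_eq hr hρ.1
    _ ≤ ∫⁻ x in γ.trace, ρ x ∂μH[1] := lintegral_mono_set hsub
    _ ≤ _ := hγ.lintegral_trace_le hρ.1

/-- Almost every path meets a Lebesgue null set in an `ℋ¹`-null set. -/
theorem modulus_of_volume_eq_zero (hn : n ≠ 0) {E : Set (Eu n)} (hE : volume E = 0) :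
    modulus {γ : Curve n | μH[1] (γ.trace ∩ E) ≠ 0} = 0 := by
  set E' := toMeasurable volume E
  have hE' : MeasurableSet E' := measurableSet_toMeasurable _ _
  have hG : Measurable (E'.indicator fun _ => (∞ : ℝ≥0∞)) := measurable_const.indicator hE'
  refine modulus_eq_zero hn hG ?_ fun γ hγ hr => ?_
  · have : ∀ x, (E'.indicator (fun _ => (∞ : ℝ≥0∞)) x) ^ n = E'.indicator (fun _ => ∞) x := by
      intro x
      by_cases hx : x ∈ E' <;> simp [hx, hn]
    simp_rw [this]
    rw [lintegral_indicator_const hE', measure_toMeasurable, hE, mul_zero]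
    simp
  · rw [← top_le_iff]
    refine le_trans ?_ (hr.lintegral_trace_le hG)
    rw [lintegral_indicator_const hE', Measure.restrict_apply hE']
    have : μH[1] (E' ∩ γ.trace) ≠ 0 := fun h0 => hγ <| measure_mono_null
      (by rw [inter_comm]; exact inter_subset_inter_left _ (subset_toMeasurable _ _)) h0
    rw [ENNReal.top_mul this]

end modulus

end

/-! ### Modification of paths and negligibility -/

section

variable {n : ℕ} {k : Kind} {E : Set (Eu n)}

/-- The condition `∂γ' = ∂γ` does not fix the orientation of `γ'`, so the path is parametrized
anew. -/
theorem Curve.exists_reorient {γ γ' : Curve n} (hne : γ.start ≠ γ.finish)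
    (hr : γ'.IsRectifiable) (hb : γ'.bdry = γ.bdry) (hfam : γ' ∈ k.family E) :
    ∃ η : Curve n, η.IsSimple ∧ η.IsRectifiable ∧ η.trace ⊆ γ'.trace ∧ η.start = γ.start ∧
      η.finish = γ.finish ∧ η ∈ k.family E := by
  have hj : LipJoined γ'.trace γ.start γ.finish := by
    have h1 : γ.start ∈ γ'.bdry := hb ▸ Or.inl rfl
    have h2 : γ.finish ∈ γ'.bdry := hb ▸ Or.inr rfl
    have h3 := hr.lipJoined
    rcases h1 with h1 | h1 <;> rcases h2 with h2 | h2
    · exact absurd (h1.trans h2.symm) hne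
    · rw [h1, h2]; exact h3
    · rw [h1, h2]; exact h3.symm
    · exact absurd (h1.trans h2.symm) hne
  obtain ⟨η, hs, hηr, hsub, h0, h1⟩ := hj.exists_curve γ'.isCompact_trace hne
  refine ⟨η, hs, hηr, hsub, h0, h1, mem_family_iff.2 ((mem_family_iff.1 hfam).mono ?_)⟩
  have : η.bdry = γ'.bdry := by rw [hb, Curve.bdry, Curve.bdry, h0, h1]
  rw [this]
  exact sdiff_subset_sdiff_left hsub

/-- A simple path inside the union of a path and of countably many short paths is hardly longer
than the given path: lengths of simple paths are `ℋ¹`-measures of their traces. -/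
theorem Curve.IsSimple.le_of_trace_subset {γ γ' : Curve n} (hs : γ'.IsSimple)
    (hγ : γ.IsRectifiable) {ι : Type*} [Countable ι] {δ : ι → Curve n}
    (hsub : γ'.trace ⊆ γ.trace ∪ ⋃ i, (δ i).trace) (hδ : ∑' i, (δ i).length ≠ ∞) :
    γ'.length ≤ γ.length + ∑' i, (δ i).length ∧
      ∀ ρ : Eu n → ℝ≥0∞, Measurable ρ →
        γ'.lineIntegral ρ ≤ γ.lineIntegral ρ + ∑' i, (δ i).lineIntegral ρ := by
  have hl : γ'.length ≤ γ.length + ∑' i, (δ i).length := by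
    rw [hs.length_eq]
    calc _ ≤ μH[1] (γ.trace ∪ ⋃ i, (δ i).trace) := measure_mono hsub
      _ ≤ μH[1] γ.trace + ∑' i, μH[1] (δ i).trace :=
        (measure_union_le _ _).trans (add_le_add le_rfl (measure_iUnion_le _))
      _ ≤ _ := add_le_add Curve.hausdorff_trace_le
        (ENNReal.tsum_le_tsum fun i => Curve.hausdorff_trace_le)
  refine ⟨hl, fun ρ hρ => ?_⟩
  have hr : γ'.IsRectifiable := hl.trans_lt (ENNReal.add_lt_top.2 ⟨hγ, hδ.lt_top⟩)
  have hδr : ∀ i, (δ i).IsRectifiable := fun i =>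
    (ENNReal.le_tsum i).trans_lt hδ.lt_top
  rw [hs.lineIntegral_eq hr hρ]
  calc _ ≤ ∫⁻ x in γ.trace ∪ ⋃ i, (δ i).trace, ρ x ∂μH[1] := lintegral_mono_set hsub
    _ ≤ ∫⁻ x in γ.trace, ρ x ∂μH[1] + ∑' i, ∫⁻ x in (δ i).trace, ρ x ∂μH[1] :=
      (lintegral_union_le _ _ _).trans (add_le_add le_rfl (lintegral_iUnion_le _ _))
    _ ≤ _ := add_le_add (hγ.lintegral_trace_le hρ)
        (ENNReal.tsum_le_tsum fun i => (hδr i).lintegral_trace_le hρ)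

theorem ModificationA.modificationB (hn : n ≠ 0) (h : ModificationA k E) : ModificationB k E := by
  intro ρ hρ
  obtain ⟨Γ₀, hΓ₀, hA, -⟩ := h ρ hρ
  refine ⟨Γ₀, hΓ₀, fun γ hγ hne hγ₀ U hU hγU ε hε => ?_⟩
  obtain ⟨I, δ, γ', hs, hfam, hb, htr, hIU, hlen, hint, -⟩ :=
    hA γ hγ hne hγ₀ U hU (sdiff_subset.trans hγU) ε hε ∅ (modulus_empty hn)
  have hsub : γ'.trace ⊆ γ.trace ∪ ⋃ i ∈ I, (δ i).trace := by
    intro x hx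
    by_cases hxb : x ∈ γ.bdry
    · exact Or.inl (γ.bdry_subset_trace hxb)
    · exact (htr ⟨hx, hxb⟩).imp (fun h => h.1) id
  rw [biUnion_eq_iUnion] at hsub
  obtain ⟨h1, h2⟩ := hs.le_of_trace_subset hγ hsub hlen.ne_top
  refine ⟨γ', hs, hfam, hb, ?_, h1.trans (add_le_add le_rfl hlen.le),
    (h2 ρ hρ.1).trans (add_le_add le_rfl hint.le)⟩
  exact hsub.trans (union_subset hγU (iUnion_subset fun i => (iUnion₂_subset_iff.1 hIU) i i.2))

/-- A function that is admissible for the paths in `𝓕_*(E)` is admissible for almost all paths of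
`Γ(F₁, F₂; Ω)`: the latter lie in `Ω` together with their endpoints, so conclusion `B` for this very
function replaces them inside `Ω` by paths of the smaller family that are hardly longer. -/
theorem ModificationB.isNegligible (h : ModificationB k E) {Ω : Set (Eu n)}
    (hΩ : IsOpen Ω) : IsNegligible k Ω E := by
  intro F₁ F₂ _ _ h₁ h₂ hdisj
  refine le_antisymm (le_iInf₂ fun ρ hρ => ?_) (modulus_mono inter_subset_left)
  by_cases hfin : ∫⁻ x, ρ x ^ n = ∞
  · rw [hfin]; exact le_top
  obtain ⟨Γ₀, hΓ₀, hB⟩ := h ρ ⟨hρ.1, fun K _ =>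
    (setLIntegral_le_lintegral K _).trans_lt (lt_top_iff_ne_top.2 hfin)⟩
  have h3 : modulus (joining F₁ F₂ Ω) ≤ modulus (joining F₁ F₂ Ω \ Γ₀) := by
    calc _ ≤ modulus ((joining F₁ F₂ Ω \ Γ₀) ∪ Γ₀) :=
          modulus_mono (by rw [sdiff_union_self]; exact subset_union_left)
      _ ≤ _ := modulus_union_le
      _ = _ := by rw [hΓ₀, add_zero]
  refine h3.trans (modulus_le hρ.1 ?_)
  rintro γ ⟨⟨hs, hf, hcl, hin⟩, hγ₀⟩ hγ
  have hne : γ.start ≠ γ.finish := fun he => disjoint_left.1 hdisj hs (he ▸ hf)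
  have hγΩ : γ.trace ⊆ Ω := by
    rintro _ ⟨t, rfl⟩
    rcases t.2.1.eq_or_lt with h0 | h0
    · have : t = γ.left := Subtype.ext h0.symm
      rw [this]; exact h₁ hs
    rcases t.2.2.eq_or_lt with h1 | h1
    · have : t = γ.right := Subtype.ext h1
      rw [this]; exact h₂ hf
    exact hin t h0 h1
  refine ENNReal.le_of_forall_pos_le_add fun ε hε _ => ?_
  obtain ⟨γ', hs', hfam, hb, hU, hlen, hint⟩ := hB γ hγ hne hγ₀ Ω hΩ hγΩ ε hε
  have hr' : γ'.IsRectifiable := hlen.trans_lt (ENNReal.add_lt_top.2 ⟨hγ, ENNReal.ofReal_lt_top⟩)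
  obtain ⟨η, hηs, hηr, hsub, h0, h1, hηfam⟩ := Curve.exists_reorient hne hr' hb hfam
  have hη : η ∈ joining F₁ F₂ Ω ∩ k.family E :=
    ⟨⟨h0 ▸ hs, h1 ▸ hf, (hsub.trans hU).trans subset_closure, fun t _ _ => hU (hsub ⟨t, rfl⟩)⟩,
      hηfam⟩
  calc 1 ≤ η.lineIntegral ρ := hρ.2 η hη hηr
    _ = ∫⁻ x in η.trace, ρ x ∂μH[1] := hηs.lineIntegral_eq hηr hρ.1
    _ ≤ ∫⁻ x in γ'.trace, ρ x ∂μH[1] := lintegral_mono_set hsub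
    _ ≤ _ := hr'.lintegral_trace_le hρ.1
    _ ≤ _ := hint
    _ = _ := by rw [ENNReal.ofReal_coe_nnreal]

/-- An elementary substitute for Hölder's inequality, to be integrated with a suitable threshold
`l`. -/
theorem ENNReal.le_add_inv_pow_mul_pow {n : ℕ} (hn : n ≠ 0) {l : ℝ≥0∞} (hl : l ≠ 0) (hl' : l ≠ ∞)
    (a : ℝ≥0∞) : a ≤ l + l⁻¹ ^ (n - 1) * a ^ n := by
  rcases le_total a l with h | h
  · exact h.trans le_self_add
  · have h1 : 1 ≤ l⁻¹ * a := by
      rw [← ENNReal.inv_mul_cancel hl hl']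
      exact mul_le_mul_right h _
    calc a = 1 * a := (one_mul a).symm
      _ ≤ (l⁻¹ * a) ^ (n - 1) * a := mul_le_mul_left (one_le_pow₀ h1) _
      _ = l⁻¹ ^ (n - 1) * a ^ n := by
        rw [mul_pow, mul_assoc, ← pow_succ, Nat.sub_add_cancel (Nat.one_le_iff_ne_zero.2 hn)]
      _ ≤ _ := le_add_self

/-- Fubini's theorem and translation invariance. -/
theorem lintegral_translates {h : Eu n → ℝ≥0∞} (hh : Measurable h) (v : Eu n) :
    ∫⁻ x, ∫⁻ t in Icc (0 : ℝ) 1, h (x + t • v) = ∫⁻ x, h x := by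
  rw [lintegral_lintegral_swap]
  · simp_rw [lintegral_add_right_eq_self h]
    simp
  · exact Measurable.aemeasurable (hh.comp (by fun_prop))

/-- If conclusion `B` holds for almost every path, then `E` is a null set. Almost every segment
can be replaced by paths in `𝓕_*(E)` that are hardly longer with respect to the characteristic
function of the complement of `E`, so that it meets `E` in length zero. -/
theorem ModificationB.volume_eq_zero (hn : n ≠ 0) (h : ModificationB k E)
    (hE : NullMeasurableSet E volume) : volume E = 0 := by
  obtain ⟨F, hFE, hF, hae⟩ := hE.exists_measurable_subset_ae_eq
  rw [← measure_congr hae]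
  set v : Eu n := EuclideanSpace.single ⟨0, Nat.pos_of_ne_zero hn⟩ 1 with hv
  have hv1 : ‖v‖ = 1 := by simp [hv]
  have hρ : Measurable (Fᶜ.indicator fun _ : Eu n => (1 : ℝ≥0∞)) :=
    measurable_const.indicator hF.compl
  obtain ⟨Γ₀, hΓ₀, hB⟩ := h (Fᶜ.indicator fun _ => 1) ⟨hρ, fun K hK => by
    refine lt_of_le_of_lt (lintegral_mono fun x => ?_) (?_ : ∫⁻ x in K, 1 < ∞)
    · by_cases hx : x ∈ F <;> simp [hx, hn]
    · simpa using hK.measure_lt_top⟩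
  have hlip : ∀ x : Eu n, LipschitzWith 1 fun t : ℝ => x + t • v := fun x =>
    LipschitzWith.of_dist_le_mul fun s t => by
      rw [dist_add_left, dist_eq_norm, ← sub_smul, norm_smul, hv1, Real.dist_eq]; simp
  have hv0 : v ≠ 0 := by rw [← norm_ne_zero_iff, hv1]; exact one_ne_zero
  have hinj : ∀ x : Eu n, InjOn (fun t : ℝ => x + t • v) (Icc 0 1) := fun x s _ t _ hst =>
    smul_left_injective ℝ hv0 (add_left_cancel hst)
  set σ : Eu n → Curve n := fun x => Curve.ofFun (fun t : ℝ => x + t • v)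
    (hlip x).continuous zero_le_one with hσ
  have hσs : ∀ x, (σ x).IsSimple := fun x => Curve.isSimple_ofFun _ _ (hinj x)
  have hσr : ∀ x, (σ x).IsRectifiable := fun x => Curve.isRectifiable_ofFun (hlip x) _ (hinj x)
  have hline : ∀ x (ρ : Eu n → ℝ≥0∞), Measurable ρ →
      (σ x).lineIntegral ρ ≤ ∫⁻ t in Icc (0 : ℝ) 1, ρ (x + t • v) := fun x ρ hρ => by
    rw [(hσs x).lineIntegral_eq (hσr x) hρ, hσ, Curve.trace_ofFun]
    exact (lintegral_image_le measurableSet_Icc (hlip x).lipschitzOnWith hρ).trans_eq (one_mul _)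
  -- an admissible `ρ` has integral at least `1` on the exceptional segments, while the mean over
  -- all translates of a segment is a volume integral
  have hnull : volume {x | σ x ∈ Γ₀} = 0 := by
    have key : ∀ δ ∈ Ioi (0 : ℝ≥0∞), volume {x | σ x ∈ Γ₀} ≤ 2 * 2 ^ (n - 1) * δ := by
      intro δ hδ
      obtain ⟨ρ, hρ, hρδ⟩ := exists_admissible_lt (hΓ₀ ▸ hδ : modulus Γ₀ < δ)
      have hsub : {x | σ x ∈ Γ₀} ⊆
          {x | 1 ≤ 2 * 2 ^ (n - 1) * ∫⁻ t in Icc (0 : ℝ) 1, ρ (x + t • v) ^ n} := by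
        intro x hx
        have h1 := (hρ.2 (σ x) hx (hσr x)).trans (hline x ρ hρ.1)
        have h2 : ∫⁻ t in Icc (0 : ℝ) 1, ρ (x + t • v) ≤
            2⁻¹ + 2 ^ (n - 1) * ∫⁻ t in Icc (0 : ℝ) 1, ρ (x + t • v) ^ n := by
          calc _ ≤ ∫⁻ t in Icc (0 : ℝ) 1, (2⁻¹ + 2 ^ (n - 1) * ρ (x + t • v) ^ n) := by
                refine lintegral_mono fun t => ?_
                have := ENNReal.le_add_inv_pow_mul_pow hn (l := 2⁻¹) (by simp) (by simp)
                  (ρ (x + t • v))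
                rwa [inv_inv] at this
            _ = _ := by
                rw [lintegral_add_left measurable_const, lintegral_const_mul]
                · simp
                · exact (hρ.1.comp (hlip x).continuous.measurable).pow_const n
        have h3 : 2⁻¹ ≤ 2 ^ (n - 1) * ∫⁻ t in Icc (0 : ℝ) 1, ρ (x + t • v) ^ n := by
          have h4 := h1.trans h2
          rw [← ENNReal.inv_two_add_inv_two] at h4
          exact (ENNReal.add_le_add_iff_left (by simp)).1 h4
        have h5 := mul_le_mul_right h3 2
        rw [ENNReal.mul_inv_cancel (by simp) (by simp), ← mul_assoc] at h5
        exact h5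
      have hm : Measurable fun x : Eu n => ∫⁻ t in Icc (0 : ℝ) 1, ρ (x + t • v) ^ n := by
        refine Measurable.lintegral_prod_right' (f := fun p : Eu n × ℝ => ρ (p.1 + p.2 • v) ^ n) ?_
        exact (hρ.1.comp (by fun_prop)).pow_const n
      refine (measure_mono hsub).trans ?_
      have := mul_meas_ge_le_lintegral (μ := volume) (hm.const_mul (2 * 2 ^ (n - 1))) 1
      rw [one_mul, lintegral_const_mul _ hm, lintegral_translates (hρ.1.pow_const n)] at this
      exact this.trans (mul_le_mul_right hρδ.le _)
    have : Tendsto (fun δ : ℝ≥0∞ => 2 * 2 ^ (n - 1) * δ) (𝓝 0) (𝓝 (2 * 2 ^ (n - 1) * 0)) :=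
      ENNReal.Tendsto.const_mul tendsto_id (Or.inr (by finiteness))
    rw [mul_zero] at this
    have hne : (𝓝[>] (0 : ℝ≥0∞)).NeBot := nhdsGT_neBot_of_exists_gt ⟨1, one_pos⟩
    exact nonpos_iff_eq_zero.1 (ge_of_tendsto (this.mono_left nhdsWithin_le_nhds)
      (eventually_nhdsWithin_of_forall key))
  have hzero : ∀ x, σ x ∉ Γ₀ →
      ∫⁻ t in Icc (0 : ℝ) 1, F.indicator (fun _ => (1 : ℝ≥0∞)) (x + t • v) = 0 := by
    intro x hx
    have hst : (σ x).start = x := by simp [hσ, Curve.start_ofFun]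
    have hfi : (σ x).finish = x + v := by simp [hσ, Curve.finish_ofFun]
    have hne : (σ x).start ≠ (σ x).finish := by rw [hst, hfi]; simpa using hv0
    -- the modified path has length at least `1` outside `E`
    have hone : 1 ≤ (σ x).lineIntegral (Fᶜ.indicator fun _ => 1) := by
      refine ENNReal.le_of_forall_pos_le_add fun ε hε _ => ?_
      obtain ⟨γ', hs', hfam, hb, -, hlen, hint⟩ :=
        hB (σ x) (hσr x) hne hx univ isOpen_univ (subset_univ _) ε hε
      have hr' : γ'.IsRectifiable :=
        hlen.trans_lt (ENNReal.add_lt_top.2 ⟨hσr x, ENNReal.ofReal_lt_top⟩)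
      rw [ENNReal.ofReal_coe_nnreal] at hint
      refine le_trans ?_ hint
      rw [hs'.lineIntegral_eq hr' hρ, lintegral_indicator_const hF.compl, one_mul,
        Measure.restrict_apply hF.compl]
      have h1 : edist (σ x).start (σ x).finish ≤ μH[1] γ'.trace :=
        edist_le_hausdorff γ'.isPreconnected_trace
          (γ'.bdry_subset_trace (hb ▸ Or.inl rfl)) (γ'.bdry_subset_trace (hb ▸ Or.inr rfl))
      rw [hst, hfi, edist_dist, dist_self_add_right, hv1, ENNReal.ofReal_one] at h1
      have h2 : γ'.trace ⊆ (Fᶜ ∩ γ'.trace) ∪ (γ'.trace ∩ E) := fun y hy => by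
        by_cases hyF : y ∈ F
        exacts [Or.inr ⟨hy, hFE hyF⟩, Or.inl ⟨hyF, hy⟩]
      calc 1 ≤ _ := h1
        _ ≤ _ := (measure_mono h2).trans (measure_union_le _ _)
        _ = _ := by rw [(countable_inter_of_mem_family hfam).measure_zero, add_zero]
    have htot : (∫⁻ t in Icc (0 : ℝ) 1, Fᶜ.indicator (fun _ => (1 : ℝ≥0∞)) (x + t • v)) +
        ∫⁻ t in Icc (0 : ℝ) 1, F.indicator (fun _ => (1 : ℝ≥0∞)) (x + t • v) = 1 := by
      have hm := hρ.comp (hlip x).continuous.measurable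
      rw [← lintegral_add_left (by exact hm)]
      have : ∀ y : Eu n, Fᶜ.indicator (fun _ => (1 : ℝ≥0∞)) y +
          F.indicator (fun _ => (1 : ℝ≥0∞)) y = 1 := fun y => by
        by_cases hy : y ∈ F <;> simp [hy]
      simp [this]
    have h1 := hone.trans (hline x _ hρ)
    have h2 : (1 : ℝ≥0∞) +
        ∫⁻ t in Icc (0 : ℝ) 1, F.indicator (fun _ => (1 : ℝ≥0∞)) (x + t • v) ≤ 1 + 0 := by
      rw [add_zero]
      exact (add_le_add h1 le_rfl).trans_eq htot
    exact nonpos_iff_eq_zero.1 ((ENNReal.add_le_add_iff_left (by simp)).1 h2)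
  have hFm : Measurable (F.indicator fun _ : Eu n => (1 : ℝ≥0∞)) := measurable_const.indicator hF
  have := lintegral_translates hFm v
  rw [lintegral_indicator_const hF, one_mul] at this
  rw [← this]
  refine (lintegral_congr_ae ?_).trans lintegral_zero
  filter_upwards [measure_eq_zero_iff_ae_notMem.1 hnull] with x hx
  exact hzero x hx

end

/-! ### Paths with endpoints in the set -/

section

variable {n : ℕ} {k : Kind} {E : Set (Eu n)}

/-- A dense set of times in `[0, 1]` contains a bi-infinite increasing sequence that accumulates
exactly at `0` and `1`. -/
theorem exists_times {P : ℝ → Prop}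
    (hP : ∀ a b : ℝ, 0 ≤ a → a < b → b ≤ 1 → ∃ t ∈ Ioo a b, P t) :
    ∃ τ : ℤ → ℝ, StrictMono τ ∧ (∀ j, τ j ∈ Ioo (0 : ℝ) 1 ∧ P (τ j)) ∧
      Tendsto τ atTop (𝓝 1) ∧ Tendsto τ atBot (𝓝 0) := by
  set h : ℤ → ℝ := fun j => 1 / 2 + j / (2 * (|(j : ℝ)| + 1)) with hh
  have h1 : ∀ j : ℤ, 0 ≤ j → h j = 1 - 1 / (2 * ((j : ℝ) + 1)) := by
    intro j hj
    have : (0 : ℝ) ≤ j := by exact_mod_cast hj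
    rw [hh]; dsimp only
    rw [abs_of_nonneg this]
    field_simp; ring
  have h2 : ∀ j : ℤ, j ≤ 0 → h j = 1 / (2 * (1 - (j : ℝ))) := by
    intro j hj
    have : (j : ℝ) ≤ 0 := by exact_mod_cast hj
    have h3 : (0 : ℝ) < 1 - j := by linarith
    rw [hh]; dsimp only
    rw [abs_of_nonpos this, show -(j : ℝ) + 1 = 1 - j by ring]
    field_simp; ring
  have hmono : StrictMono h := by
    refine strictMono_int_of_lt_succ fun j => ?_
    rcases le_or_gt 0 j with hj | hj
    · rw [h1 j hj, h1 (j + 1) (by omega)]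
      have : (0 : ℝ) ≤ j := by exact_mod_cast hj
      push_cast
      have := one_div_lt_one_div_of_lt (show (0 : ℝ) < 2 * ((j : ℝ) + 1) by linarith)
        (show 2 * ((j : ℝ) + 1) < 2 * ((j : ℝ) + 1 + 1) by linarith)
      linarith
    · rw [h2 j hj.le, h2 (j + 1) (by omega)]
      have : (j : ℝ) + 1 ≤ 0 := by exact_mod_cast hj
      push_cast
      exact one_div_lt_one_div_of_lt (by linarith) (by linarith)
  have hpos : ∀ j, 0 ≤ h j ∧ h j ≤ 1 := by
    intro j
    rcases le_total 0 j with hj | hj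
    · have h0 : (0 : ℝ) ≤ j := by exact_mod_cast hj
      rw [h1 j hj]
      have h3 : 1 / (2 * ((j : ℝ) + 1)) ≤ 1 := by
        rw [div_le_one (by linarith)]; linarith
      have h4 : 0 ≤ 1 / (2 * ((j : ℝ) + 1)) := by positivity
      exact ⟨by linarith, by linarith⟩
    · have h0 : (j : ℝ) ≤ 0 := by exact_mod_cast hj
      rw [h2 j hj]
      exact ⟨by apply one_div_nonneg.2; linarith, by rw [div_le_one (by linarith)]; linarith⟩
  have htop : Tendsto h atTop (𝓝 1) := by
    have : Tendsto (fun j : ℤ => 1 - 1 / (2 * ((j : ℝ) + 1))) atTop (𝓝 (1 - 0)) := by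
      refine tendsto_const_nhds.sub ?_
      simp_rw [one_div]
      refine tendsto_inv_atTop_zero.comp (Tendsto.const_mul_atTop two_pos ?_)
      exact tendsto_atTop_add_const_right _ _ tendsto_intCast_atTop_atTop
    rw [sub_zero] at this
    exact this.congr' ((eventually_ge_atTop 0).mono fun j hj => (h1 j hj).symm)
  have hbot : Tendsto h atBot (𝓝 0) := by
    have : Tendsto (fun j : ℤ => 1 / (2 * (1 - (j : ℝ)))) atBot (𝓝 0) := by
      simp_rw [one_div]
      refine tendsto_inv_atTop_zero.comp (Tendsto.const_mul_atTop two_pos ?_)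
      refine tendsto_atTop_add_const_left _ _ ?_
      exact tendsto_neg_atBot_atTop.comp ((tendsto_intCast_atBot_iff.2 tendsto_id))
    exact this.congr' ((eventually_le_atBot 0).mono fun j hj => (h2 j hj).symm)
  choose τ hτ hPτ using fun j : ℤ =>
    hP (h j) (h (j + 1)) (hpos j).1 (hmono (by omega)) (hpos (j + 1)).2
  refine ⟨τ, strictMono_int_of_lt_succ fun j => (hτ j).2.trans (hτ (j + 1)).1, fun j =>
    ⟨⟨(hpos j).1.trans_lt (hτ j).1, (hτ j).2.trans_le (hpos (j + 1)).2⟩, hPτ j⟩, ?_, ?_⟩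
  · exact tendsto_of_tendsto_of_tendsto_of_le_of_le htop
      (htop.comp (tendsto_atTop_add_const_right _ 1 tendsto_id))
      (fun j => (hτ j).1.le) fun j => (hτ j).2.le
  · exact tendsto_of_tendsto_of_tendsto_of_le_of_le hbot
      (hbot.comp (tendsto_atBot_add_const_right _ 1 tendsto_id))
      (fun j => (hτ j).1.le) fun j => (hτ j).2.le

/-- Compact sets `K j` that join consecutive points of a bi-infinite sequence and shrink to its
two limit points form, together with these, a compact set that joins the limit points, as soon as
the total `ℋ¹`-measure is finite. -/
theorem lipJoined_iUnion {K : ℤ → Set (Eu n)} {p : ℤ → Eu n} {x y : Eu n}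
    (hK : ∀ j, IsCompact (K j)) (hj : ∀ j, LipJoined (K j) (p j) (p (j + 1)))
    (hy : ∀ r > 0, ∀ᶠ j in atTop, K j ⊆ Metric.ball y r)
    (hx : ∀ r > 0, ∀ᶠ j in atBot, K j ⊆ Metric.ball x r)
    (hfin : ∑' j, μH[1] (K j) ≠ ∞) :
    IsCompact ((⋃ j, K j) ∪ {x, y}) ∧ LipJoined ((⋃ j, K j) ∪ {x, y}) x y := by
  have hpy : Tendsto p atTop (𝓝 y) :=
    Metric.tendsto_nhds.2 fun r hr => (hy r hr).mono fun j h => h (hj j).left_mem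
  have hpx : Tendsto p atBot (𝓝 x) :=
    Metric.tendsto_nhds.2 fun r hr => (hx r hr).mono fun j h => h (hj j).left_mem
  have hc : IsCompact ((⋃ j, K j) ∪ {x, y}) := by
    rw [isCompact_iff_ultrafilter_le_nhds]
    intro f hf
    by_cases hfx : ↑f ≤ 𝓝 x
    · exact ⟨x, Or.inr (Or.inl rfl), hfx⟩
    by_cases hfy : ↑f ≤ 𝓝 y
    · exact ⟨y, Or.inr (Or.inr rfl), hfy⟩
    obtain ⟨r, hr, hrx⟩ : ∃ r > 0, Metric.ball x r ∉ f := by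
      by_contra! hcon
      exact hfx (Metric.nhds_basis_ball.ge_iff.2 fun r hr => hcon r hr)
    obtain ⟨s, hs, hsy⟩ : ∃ s > 0, Metric.ball y s ∉ f := by
      by_contra! hcon
      exact hfy (Metric.nhds_basis_ball.ge_iff.2 fun r hr => hcon r hr)
    obtain ⟨N, hN⟩ := eventually_atTop.1 (hy s hs)
    obtain ⟨M, hM⟩ := eventually_atBot.1 (hx r hr)
    have hmem : (⋃ j ∈ Icc M N, K j) ∈ f := by
      filter_upwards [le_principal_iff.1 hf, Ultrafilter.compl_mem_iff_notMem.2 hrx,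
        Ultrafilter.compl_mem_iff_notMem.2 hsy] with z hz hzx hzy
      rcases hz with hz | rfl | rfl
      · obtain ⟨j, hzj⟩ := mem_iUnion.1 hz
        refine mem_iUnion₂.2 ⟨j, ⟨?_, ?_⟩, hzj⟩
        · by_contra! hlt
          exact hzx (hM j hlt.le hzj)
        · by_contra! hlt
          exact hzy (hN j hlt.le hzj)
      · exact absurd (Metric.mem_ball_self hr) hzx
      · exact absurd (Metric.mem_ball_self hs) hzy
    have hc' : IsCompact (⋃ j ∈ Icc M N, K j) := (finite_Icc M N).isCompact_biUnion fun j _ => hK j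
    obtain ⟨z, hz, hfz⟩ := isCompact_iff_ultrafilter_le_nhds.1 hc' f (le_principal_iff.2 hmem)
    refine ⟨z, Or.inl ?_, hfz⟩
    obtain ⟨j, -, hzj⟩ := mem_iUnion₂.1 hz
    exact mem_iUnion.2 ⟨j, hzj⟩
  refine ⟨hc, ?_⟩
  have hsub : ∀ j, K j ⊆ (⋃ j, K j) ∪ {x, y} := fun j =>
    (subset_iUnion K j).trans subset_union_left
  have hN : ∀ N : ℕ, LipJoined ((⋃ j, K j) ∪ {x, y}) (p (-N)) (p N) := by
    intro N
    induction N with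
    | zero => simpa using LipJoined.refl (hsub 0 (hj 0).left_mem)
    | succ N ih =>
      have h1 := (hj (-(N + 1 : ℤ))).mono (hsub _)
      have h2 := (hj N).mono (hsub _)
      rw [show -(N + 1 : ℤ) + 1 = -N by ring] at h1
      push_cast
      exact (h1.trans ih).trans h2
  refine LipJoined.of_tendsto hc ?_ (hpx.comp ?_) (hpy.comp ?_) hN
  · calc _ ≤ ∑' j, μH[1] (K j) + μH[1] {x, y} :=
        (measure_union_le _ _).trans (add_le_add (measure_iUnion_le _) le_rfl)
      _ < ∞ := by
        rw [((Set.toFinite {x, y}).countable).measure_zero, add_zero]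
        exact hfin.lt_top
  · exact tendsto_neg_atTop_atBot.comp tendsto_natCast_atTop_atTop
  · exact tendsto_natCast_atTop_atTop

theorem eventually_subset_ball {g : ℝ → Eu n} {c : ℝ} (hg : ContinuousAt g c) {τ : ℤ → ℝ}
    {l : Filter ℤ} (hτ : Tendsto τ l (𝓝 c)) (hτ' : Tendsto (fun j => τ (j + 1)) l (𝓝 c))
    {δ : ℤ → ℝ} (hδ : Tendsto δ l (𝓝 0)) {r : ℝ} (hr : 0 < r) :
    ∀ᶠ j in l, Metric.thickening (δ j) (g '' Icc (τ j) (τ (j + 1))) ⊆ Metric.ball (g c) r := by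
  obtain ⟨e, he, hge⟩ := Metric.continuousAt_iff.1 hg (r / 2) (half_pos hr)
  filter_upwards [Metric.tendsto_nhds.1 hτ e he, Metric.tendsto_nhds.1 hτ' e he,
    hδ.eventually_lt_const (half_pos hr)] with j h1 h2 h3
  intro z hz
  obtain ⟨_, ⟨t, ht, rfl⟩, hzt⟩ := Metric.mem_thickening_iff.1 hz
  have h4 : dist t c < e := by
    rw [Real.dist_eq, abs_lt] at h1 h2 ⊢
    exact ⟨by linarith [ht.1], by linarith [ht.2]⟩
  have h5 := dist_triangle z (g t) (g c)
  have := hge h4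
  rw [Metric.mem_ball]
  linarith

theorem tendsto_one_div_abs_add_one :
    Tendsto (fun j : ℤ => 1 / (|(j : ℝ)| + 1)) atTop (𝓝 0) ∧
      Tendsto (fun j : ℤ => 1 / (|(j : ℝ)| + 1)) atBot (𝓝 0) := by
  simp_rw [one_div]
  constructor
  · exact tendsto_inv_atTop_zero.comp (tendsto_atTop_add_const_right _ _
      (tendsto_abs_atTop_atTop.comp tendsto_intCast_atTop_atTop))
  · exact tendsto_inv_atTop_zero.comp (tendsto_atTop_add_const_right _ _
      (tendsto_abs_atBot_atTop.comp (tendsto_intCast_atBot_iff.2 tendsto_id)))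

/-- The integrals over consecutive subarcs of an arc add up to at most the integral over the
arc. -/
theorem tsum_lintegral_subarcs_le {g : ℝ → Eu n} (hg : Continuous g) (hinj : InjOn g (Icc 0 1))
    {τ : ℤ → ℝ} (hτ : StrictMono τ) (hτ01 : ∀ j, τ j ∈ Ioo (0 : ℝ) 1) (ρ : Eu n → ℝ≥0∞) :
    ∑' j, ∫⁻ x in g '' Icc (τ j) (τ (j + 1)), ρ x ∂μH[1] ≤ ∫⁻ x in g '' Icc 0 1, ρ x ∂μH[1] := by
  have hsub : ∀ j, Icc (τ j) (τ (j + 1)) ⊆ Icc 0 1 := fun j =>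
    Icc_subset_Icc (hτ01 j).1.le (hτ01 (j + 1)).2.le
  have heq : ∀ j, g '' Ioc (τ j) (τ (j + 1)) = g '' Icc (τ j) (τ (j + 1)) \ {g (τ j)} := by
    intro j
    have hle : τ j ≤ τ (j + 1) := hτ.monotone (by omega)
    rw [← Icc_sdiff_left, (hinj.mono (hsub j)).image_sdiff_subset (singleton_subset_iff.2
      (left_mem_Icc.2 hle)), image_singleton]
  have hle : ∀ j, ∫⁻ x in g '' Icc (τ j) (τ (j + 1)), ρ x ∂μH[1] ≤
      ∫⁻ x in g '' Ioc (τ j) (τ (j + 1)), ρ x ∂μH[1] := by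
    intro j
    rw [heq]
    refine lintegral_mono' (le_of_eq (Measure.restrict_congr_set ?_)) le_rfl
    exact (sdiff_null_ae_eq_self (measure_singleton _)).symm
  refine (ENNReal.tsum_le_tsum hle).trans ?_
  rw [← lintegral_iUnion]
  · refine lintegral_mono_set (iUnion_subset fun j => image_mono ?_)
    exact Ioc_subset_Icc_self.trans (hsub j)
  · intro j
    rw [heq]
    exact (isCompact_Icc.image hg).measurableSet.diff (measurableSet_singleton _)
  · intro i j hij
    refine disjoint_image_image ?_
    intro a ha b hb hab
    have h1 := hτ.monotone.pairwise_disjoint_on_Ioc_succ hij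
    have := hinj (hsub i (Ioc_subset_Icc_self ha)) (hsub j (Ioc_subset_Icc_self hb)) hab
    subst this
    exact disjoint_left.1 h1 ha hb

theorem exists_notMem_of_hausdorff_eq_zero {g : ℝ → Eu n} (hg : Continuous g)
    (hinj : InjOn g (Icc 0 1)) (hE : μH[1] (g '' Icc 0 1 ∩ E) = 0) {a b : ℝ} (ha : 0 ≤ a)
    (hab : a < b) (hb : b ≤ 1) : ∃ t ∈ Ioo a b, g t ∉ E := by
  by_contra! hcon
  obtain ⟨c, hac, hcb⟩ := exists_between hab
  obtain ⟨d, hcd, hdb⟩ := exists_between hcb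
  have h1 : edist (g c) (g d) ≤ μH[1] (g '' Icc c d) :=
    edist_le_hausdorff (isPreconnected_Icc.image _ hg.continuousOn)
      ⟨c, left_mem_Icc.2 hcd.le, rfl⟩ ⟨d, right_mem_Icc.2 hcd.le, rfl⟩
  have h2 : g '' Icc c d ⊆ g '' Icc 0 1 ∩ E := by
    rintro _ ⟨t, ht, rfl⟩
    have h3 : t ∈ Ioo a b := ⟨hac.trans_le ht.1, ht.2.trans_lt hdb⟩
    exact ⟨⟨t, ⟨ha.trans h3.1.le, h3.2.le.trans hb⟩, rfl⟩, hcon t h3⟩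
  have h3 : edist (g c) (g d) = 0 :=
    nonpos_iff_eq_zero.1 (h1.trans ((measure_mono h2).trans_eq hE))
  exact hcd.ne (hinj ⟨ha.trans hac.le, (hcd.trans hdb).le.trans hb⟩
    ⟨ha.trans (hac.trans hcd).le, hdb.le.trans hb⟩ (edist_eq_zero.1 h3))

theorem Curve.bdry_eq {γ η : Curve n} (h0 : η.start = γ.start) (h1 : η.finish = γ.finish) :
    η.bdry = γ.bdry := by rw [bdry, bdry, h0, h1]

/-- If `E` is a null set then almost every path leaves `E` at times arbitrarily close to its
endpoints. So it suffices to modify the countably many subpaths between such times. -/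
theorem ModificationBOff.modificationB (hn : n ≠ 0) (hE : volume E = 0)
    (h : ModificationBOff k E) : ModificationB k E := by
  intro ρ hρ
  obtain ⟨Γ₀, hΓ₀, hB⟩ := h ρ hρ
  refine ⟨{γ | ∃ η ∈ Γ₀, η.IsSimple ∧ η.IsRectifiable ∧ η.trace ⊆ γ.trace} ∪
    {γ | μH[1] (γ.trace ∩ E) ≠ 0}, modulus_union_eq_zero
    (nonpos_iff_eq_zero.1 (modulus_superpaths_le.trans_eq hΓ₀))
    (modulus_of_volume_eq_zero hn hE), ?_⟩
  intro γ hγ hne hγ₀ U hU hγU ε hε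
  rw [mem_union, not_or] at hγ₀
  obtain ⟨hγ₁, hγ₂⟩ := hγ₀
  simp only [mem_ofPred_eq, not_not] at hγ₂
  obtain ⟨L, g, hg, hgγ, hg0, hg1, hinj⟩ := hγ.lipJoined.exists_injOn γ.isCompact_trace hne
  have hgsub : ∀ S, g '' S ⊆ γ.trace := fun S => by
    rintro _ ⟨t, -, rfl⟩
    exact hgγ t
  obtain ⟨τ, hτ, hτE, hτ1, hτ0⟩ := exists_times (P := fun t => g t ∉ E) fun a b ha hab hb =>
    exists_notMem_of_hausdorff_eq_zero hg.continuous hinj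
      (measure_mono_null (inter_subset_inter_left _ (hgsub _)) hγ₂) ha hab hb
  have hlt : ∀ j, τ j < τ (j + 1) := fun j => hτ (by omega)
  have hsub01 : ∀ j, Icc (τ j) (τ (j + 1)) ⊆ Icc 0 1 := fun j =>
    Icc_subset_Icc (hτE j).1.1.le (hτE (j + 1)).1.2.le
  set σ : ℤ → Curve n := fun j => Curve.ofFun g hg.continuous (hlt j).le with hσ
  have hσt : ∀ j, (σ j).trace = g '' Icc (τ j) (τ (j + 1)) := fun j => Curve.trace_ofFun _ _
  have hσs : ∀ j, (σ j).IsSimple := fun j => Curve.isSimple_ofFun _ _ (hinj.mono (hsub01 j))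
  have hσr : ∀ j, (σ j).IsRectifiable := fun j =>
    Curve.isRectifiable_ofFun hg _ (hinj.mono (hsub01 j))
  have hσne : ∀ j, (σ j).start ≠ (σ j).finish := fun j heq => (hlt j).ne
    (hinj (hsub01 j (left_mem_Icc.2 (hlt j).le)) (hsub01 j (right_mem_Icc.2 (hlt j).le)) heq)
  have hσ₀ : ∀ j, σ j ∉ Γ₀ := fun j hj =>
    hγ₁ ⟨σ j, hj, hσs j, hσr j, by rw [hσt]; exact hgsub _⟩
  obtain ⟨e, he, hesum⟩ := ENNReal.exists_pos_sum_of_countable'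
    (ENNReal.ofReal_pos.2 hε).ne' ℤ
  have hefin : ∀ j, e j ≠ ∞ := fun j =>
    ((ENNReal.le_tsum j).trans_lt (hesum.trans ENNReal.ofReal_lt_top)).ne
  set δ : ℤ → ℝ := fun j => 1 / (|(j : ℝ)| + 1) with hδ
  have hδpos : ∀ j, 0 < δ j := fun j => by positivity
  have hstep : ∀ j, ∃ η : Curve n, η.IsSimple ∧ η ∈ k.family E ∧ η.bdry = (σ j).bdry ∧
      η.trace ⊆ U ∩ Metric.thickening (δ j) (g '' Icc (τ j) (τ (j + 1))) ∧
      η.length ≤ (σ j).length + e j ∧ η.lineIntegral ρ ≤ (σ j).lineIntegral ρ + e j := by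
    intro j
    have := hB (σ j) (hσr j) (hσne j) (hτE j).2 (hτE (j + 1)).2 (hσ₀ j)
      (U ∩ Metric.thickening (δ j) (g '' Icc (τ j) (τ (j + 1))))
      (hU.inter Metric.isOpen_thickening) (by
        rw [hσt]
        exact subset_inter ((hgsub _).trans hγU) (Metric.self_subset_thickening (hδpos j) _))
      (e j).toReal (ENNReal.toReal_pos (he j).ne' (hefin j))
    rwa [ENNReal.ofReal_toReal (hefin j)] at this
  choose η hηs hηfam hηb hηU hηlen hηint using hstep
  have hηr : ∀ j, (η j).IsRectifiable := fun j =>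
    (hηlen j).trans_lt (ENNReal.add_lt_top.2 ⟨hσr j, (hefin j).lt_top⟩)
  have hjoin : ∀ j, LipJoined (η j).trace (g (τ j)) (g (τ (j + 1))) := by
    intro j
    obtain ⟨ζ, -, hζr, hζ, h0, h1, -⟩ :=
      Curve.exists_reorient (hσne j) (hηr j) (hηb j) (hηfam j)
    have := hζr.lipJoined.mono hζ
    rw [h0, h1] at this
    exact this
  have hsum : ∀ {ρ' : Eu n → ℝ≥0∞}, Measurable ρ' →
      ∑' j, (σ j).lineIntegral ρ' ≤ γ.lineIntegral ρ' := by
    intro ρ' hρ'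
    calc ∑' j, (σ j).lineIntegral ρ' = ∑' j, ∫⁻ x in g '' Icc (τ j) (τ (j + 1)), ρ' x ∂μH[1] :=
          tsum_congr fun j => by rw [(hσs j).lineIntegral_eq (hσr j) hρ', hσt]
      _ ≤ _ := tsum_lintegral_subarcs_le hg.continuous hinj hτ (fun j => (hτE j).1) ρ'
      _ ≤ ∫⁻ x in γ.trace, ρ' x ∂μH[1] := lintegral_mono_set (hgsub _)
      _ ≤ _ := hγ.lintegral_trace_le hρ'
  have hsumlen : ∑' j, (σ j).length ≤ γ.length := by
    have := hsum (measurable_const (a := (1 : ℝ≥0∞)))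
    simpa [Curve.lineIntegral, ENNReal.ofReal_toReal hγ.ne, ENNReal.ofReal_toReal (hσr _).ne]
      using this
  have hHlen : ∑' j, μH[1] (η j).trace ≤ γ.length + ENNReal.ofReal ε :=
    calc _ ≤ ∑' j, ((σ j).length + e j) :=
          ENNReal.tsum_le_tsum fun j => Curve.hausdorff_trace_le.trans (hηlen j)
      _ = ∑' j, (σ j).length + ∑' j, e j := ENNReal.tsum_add
      _ ≤ _ := add_le_add hsumlen hesum.le
  obtain ⟨hC, hCj⟩ := lipJoined_iUnion (p := fun j => g (τ j)) (x := g 0) (y := g 1)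
    (fun j => (η j).isCompact_trace) hjoin
    (fun r hr => (eventually_subset_ball hg.continuous.continuousAt hτ1
      (hτ1.comp (tendsto_atTop_add_const_right _ 1 tendsto_id)) tendsto_one_div_abs_add_one.1
      hr).mono fun j hj => ((hηU j).trans inter_subset_right).trans hj)
    (fun r hr => (eventually_subset_ball hg.continuous.continuousAt hτ0
      (hτ0.comp (tendsto_atBot_add_const_right _ 1 tendsto_id)) tendsto_one_div_abs_add_one.2
      hr).mono fun j hj => ((hηU j).trans inter_subset_right).trans hj)
    (hHlen.trans_lt (ENNReal.add_lt_top.2 ⟨hγ, ENNReal.ofReal_lt_top⟩)).ne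
  rw [hg0, hg1] at hC hCj
  obtain ⟨γ', hs', hr', hsub, h0, h1⟩ := hCj.exists_curve hC hne
  have hb : γ'.bdry = γ.bdry := Curve.bdry_eq h0 h1
  have hnull : μH[1] ({γ.start, γ.finish} : Set (Eu n)) = 0 :=
    (Set.toFinite {γ.start, γ.finish}).countable.measure_zero _
  refine ⟨γ', hs', mem_family_iff.2 ?_, hb, ?_, ?_, ?_⟩
  · have hgood : k.Good E (⋃ j, (η j).trace) := by
      refine Kind.Good.iUnion fun j => ?_
      refine (((mem_family_iff.1 (hηfam j)).union (Kind.good_singleton (hτE j).2)).union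
        (Kind.good_singleton (hτE (j + 1)).2)).mono fun z hz => ?_
      by_cases hzb : z ∈ (η j).bdry
      · rw [hηb j] at hzb
        rcases hzb with hzb | hzb
        exacts [Or.inl (Or.inr hzb), Or.inr hzb]
      · exact Or.inl (Or.inl ⟨hz, hzb⟩)
    refine hgood.mono fun z hz => ?_
    rcases hsub hz.1 with h | h
    · exact h
    · exact absurd (hb ▸ h : z ∈ γ'.bdry) hz.2
  · refine hsub.trans (union_subset (iUnion_subset fun j => (hηU j).trans inter_subset_left) ?_)
    exact γ.bdry_subset_trace.trans hγU
  · rw [hs'.length_eq]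
    calc _ ≤ _ := (measure_mono hsub).trans (measure_union_le _ _)
      _ ≤ ∑' j, μH[1] (η j).trace := by
        rw [hnull, add_zero]; exact measure_iUnion_le _
      _ ≤ _ := hHlen
  · rw [hs'.lineIntegral_eq hr' hρ.1]
    calc _ ≤ _ := (lintegral_mono_set hsub).trans (lintegral_union_le _ _ _)
      _ ≤ ∑' j, ∫⁻ x in (η j).trace, ρ x ∂μH[1] := by
        rw [setLIntegral_measure_zero _ _ hnull, add_zero]
        exact lintegral_iUnion_le _ _
      _ ≤ ∑' j, ((σ j).lineIntegral ρ + e j) :=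
        ENNReal.tsum_le_tsum fun j => ((hηr j).lintegral_trace_le hρ.1).trans (hηint j)
      _ = ∑' j, (σ j).lineIntegral ρ + ∑' j, e j := ENNReal.tsum_add
      _ ≤ _ := add_le_add (hsum hρ.1) hesum.le

end

/-! ### The Loewner property of Euclidean space -/

section

open Metric

variable {n : ℕ}

/-- The volume of the unit ball. -/
noncomputable def unitBallVolume (n : ℕ) : ℝ≥0∞ := volume (ball (0 : Eu n) 1)

theorem unitBallVolume_pos : 0 < unitBallVolume n := measure_ball_pos _ _ one_pos

theorem unitBallVolume_lt_top : unitBallVolume n < ∞ := measure_ball_lt_top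

theorem volume_ball_eq (x : Eu n) {r : ℝ} (hr : 0 < r) :
    volume (ball x r) = ENNReal.ofReal (r ^ n) * unitBallVolume n := by
  rw [Measure.addHaar_ball_of_pos _ _ hr, finrank_euclideanSpace_fin, unitBallVolume]

/-- Change of variables under a homothety with centre `x`. -/
theorem lintegral_contraction {ρ : Eu n → ℝ≥0∞} (hρ : Measurable ρ) (x : Eu n) {D t : ℝ}
    (ht : 0 < t) : ∫⁻ z in ball x D, ρ (x + t • (z - x)) =
      ENNReal.ofReal ((t ^ n)⁻¹) * ∫⁻ z in ball x (t * D), ρ z := by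
  have h1 : ∫⁻ z in ball x D, ρ (x + t • (z - x)) =
      ∫⁻ w, (ball (0 : Eu n) (t * D)).indicator (fun w => ρ (x + w)) (t • w) := by
    rw [← lintegral_indicator measurableSet_ball]
    rw [← lintegral_sub_right_eq_self (fun w =>
      (ball (0 : Eu n) (t * D)).indicator (fun w => ρ (x + w)) (t • w)) x]
    refine lintegral_congr fun z => ?_
    have : z ∈ ball x D ↔ t • (z - x) ∈ ball (0 : Eu n) (t * D) := by
      rw [mem_ball, mem_ball, dist_zero_right, norm_smul, Real.norm_of_nonneg ht.le, dist_eq_norm,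
        mul_lt_mul_iff_right₀ ht]
    by_cases hz : z ∈ ball x D
    · rw [indicator_of_mem hz, indicator_of_mem (this.1 hz)]
    · rw [indicator_of_notMem hz, indicator_of_notMem (mt this.2 hz)]
  have hm : Measurable ((ball (0 : Eu n) (t * D)).indicator fun w => ρ (x + w)) :=
    (hρ.comp (measurable_const_add x)).indicator measurableSet_ball
  have h2 := lintegral_map (μ := volume) hm (measurable_const_smul t)
  rw [h1, ← h2, Measure.map_addHaar_smul _ ht.ne', lintegral_smul_measure,
    finrank_euclideanSpace_fin, abs_of_pos (by positivity), smul_eq_mul]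
  congr 1
  rw [← lintegral_indicator measurableSet_ball, ← lintegral_add_left_eq_self ((ball x (t * D)).indicator ρ) x]
  refine lintegral_congr fun w => ?_
  by_cases hw : w ∈ ball (0 : Eu n) (t * D)
  · rw [indicator_of_mem hw, indicator_of_mem]
    simpa [mem_ball, dist_eq_norm] using hw
  · rw [indicator_of_notMem hw, indicator_of_notMem]
    simpa [mem_ball, dist_eq_norm] using hw

theorem lintegral_rpow_Icc {n : ℕ} (hn : n ≠ 0) :
    ∫⁻ t in Icc (0 : ℝ) 1, ENNReal.ofReal (t ^ (-((n - 1 : ℝ) / n))) = n := by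
  have hn0 : (0 : ℝ) < n := by exact_mod_cast Nat.pos_of_ne_zero hn
  have ha : -1 < -((n - 1 : ℝ) / n) := by
    rw [neg_lt_neg_iff, div_lt_one hn0]; linarith
  rw [setLIntegral_congr Ioc_ae_eq_Icc.symm, ← ofReal_integral_eq_lintegral_ofReal]
  · rw [← intervalIntegral.integral_of_le zero_le_one, integral_rpow (Or.inl ha)]
    have h1 : -((n - 1 : ℝ) / n) + 1 = 1 / n := by field_simp; ring
    rw [h1, Real.one_rpow, Real.zero_rpow (by positivity)]
    simp
  · exact (intervalIntegrable_iff_integrableOn_Ioc_of_le zero_le_one).1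
      (intervalIntegral.intervalIntegrable_rpow' ha)
  · refine (ae_restrict_mem measurableSet_Ioc).mono fun t ht => ?_
    exact Real.rpow_nonneg ht.1.le _

/-- The mean of `∫₀¹ ρ(x + t (z - x)) dt` over `z ∈ B(x, D)`, a Riesz potential of `ρ` at `x`, is
small if the `Lⁿ`-mass of `ρ` in `B(x, r)` is controlled by `r` at all scales `r ≤ D`. -/
theorem lintegral_radial_le (hn : n ≠ 0) {ρ : Eu n → ℝ≥0∞} (hρ : Measurable ρ) {x : Eu n}
    {D ε : ℝ} (hD : 0 < D) (hε : 0 < ε)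
    (h : ∀ t ∈ Ioc (0 : ℝ) 1, ∫⁻ z in ball x (t * D), ρ z ^ n ≤
      ENNReal.ofReal (t * ε ^ n) * unitBallVolume n) :
    ∫⁻ z in ball x D, ∫⁻ t in Icc (0 : ℝ) 1, ENNReal.ofReal D * ρ (x + t • (z - x)) ≤
      ENNReal.ofReal (2 * n * ε * D ^ n) * unitBallVolume n := by
  have hn0 : (0 : ℝ) < n := by exact_mod_cast Nat.pos_of_ne_zero hn
  set a : ℝ := (n - 1 : ℝ) / n with ha
  have hmeas : Measurable fun p : Eu n × ℝ => ρ (x + p.2 • (p.1 - x)) := hρ.comp (by fun_prop)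
  rw [lintegral_lintegral_swap (by exact (hmeas.const_mul _).aemeasurable)]
  have key : ∀ t ∈ Ioc (0 : ℝ) 1,
      ∫⁻ z in ball x D, ENNReal.ofReal D * ρ (x + t • (z - x)) ≤
        ENNReal.ofReal (2 * ε * D ^ n) * unitBallVolume n * ENNReal.ofReal (t ^ (-a)) := by
    intro t ht
    have ht0 := ht.1
    rw [lintegral_const_mul' _ _ ENNReal.ofReal_ne_top, lintegral_contraction hρ x ht0]
    -- the threshold `l` is the one that balances the two terms of the elementary inequality
    set l : ℝ := ε * t ^ (-a) / D with hl
    have hlpos : 0 < l := by positivity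
    have h1 : ∫⁻ z in ball x (t * D), ρ z ≤ ENNReal.ofReal l * volume (ball x (t * D)) +
        (ENNReal.ofReal l)⁻¹ ^ (n - 1) * ∫⁻ z in ball x (t * D), ρ z ^ n := by
      calc _ ≤ ∫⁻ z in ball x (t * D), (ENNReal.ofReal l +
            (ENNReal.ofReal l)⁻¹ ^ (n - 1) * ρ z ^ n) :=
            lintegral_mono fun z => ENNReal.le_add_inv_pow_mul_pow hn
              (ENNReal.ofReal_pos.2 hlpos).ne' ENNReal.ofReal_ne_top _
        _ = _ := by
          rw [lintegral_add_left measurable_const, lintegral_const_mul _ (hρ.pow_const n),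
            setLIntegral_const]
    rw [← ENNReal.ofReal_inv_of_pos hlpos, ← ENNReal.ofReal_pow (by positivity),
      volume_ball_eq x (by positivity)] at h1
    have h2 : ∫⁻ z in ball x (t * D), ρ z ≤
        ENNReal.ofReal (l * (t * D) ^ n + l⁻¹ ^ (n - 1) * (t * ε ^ n)) * unitBallVolume n := by
      refine (h1.trans (add_le_add le_rfl (mul_le_mul_right (h t ht) _))).trans_eq ?_
      rw [← mul_assoc, ← mul_assoc, ← add_mul, ← ENNReal.ofReal_mul hlpos.le,
        ← ENNReal.ofReal_mul (by positivity), ← ENNReal.ofReal_add (by positivity) (by positivity)]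
    refine (mul_le_mul_right (mul_le_mul_right h2 _) _).trans_eq ?_
    rw [mul_right_comm, ← mul_assoc, ← mul_assoc, ← ENNReal.ofReal_mul hD.le,
      ← ENNReal.ofReal_mul (by positivity), ← ENNReal.ofReal_mul (by positivity)]
    congr 2
    obtain ⟨m, rfl⟩ : ∃ m, n = m + 1 := ⟨n - 1, by omega⟩
    have hpow : (t ^ (-a)) ^ (m + 1) * t ^ m = 1 := by
      rw [← Real.rpow_natCast, ← Real.rpow_natCast, ← Real.rpow_mul ht0.le, ← Real.rpow_add ht0]
      have : -a * ((m + 1 : ℕ) : ℝ) + (m : ℝ) = 0 := by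
        rw [ha]; push_cast; field_simp; ring
      rw [this, Real.rpow_zero]
    have hT : 0 < t ^ (-a) := by positivity
    set T := t ^ (-a) with hTdef
    have hTt : T ^ m * t ^ m * T = 1 := by rw [← hpow]; ring
    rw [Nat.add_sub_cancel, hl]
    have e1 : (ε * T / D)⁻¹ ^ m * (t * ε ^ (m + 1)) = ε * D ^ m * t * (T ^ m)⁻¹ := by
      rw [inv_div, div_pow, mul_pow]
      field_simp
      ring
    have e2 : (T ^ m)⁻¹ = t ^ m * T := by
      rw [inv_eq_iff_eq_inv, eq_comm, inv_eq_iff_eq_inv, eq_comm]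
      refine inv_eq_of_mul_eq_one_right ?_
      rw [← hTt]; ring
    rw [e1, e2]
    field_simp
    ring
  calc _ ≤ ∫⁻ t in Icc (0 : ℝ) 1,
        ENNReal.ofReal (2 * ε * D ^ n) * unitBallVolume n * ENNReal.ofReal (t ^ (-a)) := by
        rw [setLIntegral_congr Ioc_ae_eq_Icc.symm, setLIntegral_congr Ioc_ae_eq_Icc.symm]
        exact setLIntegral_mono' measurableSet_Ioc key
    _ = _ := by
        rw [lintegral_const_mul _ (by fun_prop), lintegral_rpow_Icc hn, mul_right_comm]
        congr 1
        rw [← ENNReal.ofReal_natCast, ← ENNReal.ofReal_mul (by positivity)]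
        congr 1
        ring

/-- A connected set that joins `p` to a point at distance `b` contains points at which the
`Lⁿ`-mass of `ρ` is small at all scales: otherwise it would be covered by disjoint balls, up to
enlargement, whose radii have a sum less than `b`. -/
theorem exists_mem_small_mass {F : Set (Eu n)} (hF : IsPreconnected F) {p y : Eu n} (hp : p ∈ F)
    (hy : y ∈ F) {b D ε : ℝ} (hD : 0 < D) (hb : 0 < b) (hyb : b ≤ dist y p)
    {ρ : Eu n → ℝ≥0∞}
    (hsmall : ENNReal.ofReal (10 * D) * ∫⁻ z, ρ z ^ n <
      ENNReal.ofReal (b * ε ^ n) * unitBallVolume n) :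
    ∃ x ∈ F, dist x p ≤ b ∧ ∀ t ∈ Ioc (0 : ℝ) 1, ∫⁻ z in ball x (t * D), ρ z ^ n ≤
      ENNReal.ofReal (t * ε ^ n) * unitBallVolume n := by
  by_contra! hcon
  choose! t ht hlt using hcon
  set S : Set (Eu n) := {x | x ∈ F ∧ dist x p ≤ b} with hS
  obtain ⟨u, huS, hdisj, hcov⟩ := Vitali.exists_disjoint_subfamily_covering_enlargement_closedBall
    S id (fun x => t x * D) D (fun x hx => by
      have := (ht x hx.1 hx.2).2
      nlinarith) 5 (by norm_num)
  have hpos : ∀ x ∈ u, 0 < t x * D := fun x hx => mul_pos (ht x (huS hx).1 (huS hx).2).1 hD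
  have hcount : u.Countable := hdisj.countable_of_nonempty_interior fun x hx =>
    ⟨x, ball_subset_interior_closedBall (mem_ball_self (hpos x hx))⟩
  have : Countable u := hcount.to_subtype
  have hsum : ∑' x : u, ENNReal.ofReal (t x * ε ^ n) * unitBallVolume n ≤ ∫⁻ z, ρ z ^ n := by
    calc _ ≤ ∑' x : u, ∫⁻ z in closedBall (x : Eu n) (t x * D), ρ z ^ n :=
          ENNReal.tsum_le_tsum fun x => (hlt x (huS x.2).1 (huS x.2).2).le.trans
            (lintegral_mono_set ball_subset_closedBall)
      _ = ∫⁻ z in ⋃ x : u, closedBall (x : Eu n) (t x * D), ρ z ^ n :=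
          (lintegral_iUnion (fun x => measurableSet_closedBall)
            (fun (x y : u) hxy => hdisj x.2 y.2 (Subtype.coe_injective.ne hxy)) _).symm
      _ ≤ _ := setLIntegral_le_lintegral _ _
  have hIcc : Icc 0 b ⊆ ⋃ x : u, Icc (dist (x : Eu n) p - 5 * (t x * D))
      (dist (x : Eu n) p + 5 * (t x * D)) := by
    intro r hr
    obtain ⟨z, hzF, hzr⟩ := hF.intermediate_value hp hy
      (lipschitz_dist_left p).continuous.continuousOn (by
        rw [dist_self]
        exact ⟨hr.1, hr.2.trans hyb⟩)
    have hzS : z ∈ S := ⟨hzF, hzr.trans_le hr.2⟩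
    obtain ⟨x, hxu, hx⟩ := hcov z hzS
    have hzx : dist z x ≤ 5 * (t x * D) :=
      hx (mem_closedBall_self (mul_pos (ht z hzS.1 hzS.2).1 hD).le)
    refine mem_iUnion.2 ⟨⟨x, hxu⟩, ?_⟩
    have h1 := dist_triangle z x p
    have h2 := dist_triangle_left x p z
    rw [← hzr]
    exact ⟨by linarith, by linarith⟩
  have hlen : ENNReal.ofReal b ≤ ∑' x : u, ENNReal.ofReal (10 * (t x * D)) := by
    calc ENNReal.ofReal b = volume (Icc 0 b) := by rw [Real.volume_Icc, sub_zero]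
      _ ≤ _ := (measure_mono hIcc).trans (measure_iUnion_le _)
      _ = _ := tsum_congr fun x => by rw [Real.volume_Icc]; congr 1; ring
  refine absurd hsmall (not_lt.2 ?_)
  calc _ = ENNReal.ofReal b * (ENNReal.ofReal (ε ^ n) * unitBallVolume n) := by
        rw [ENNReal.ofReal_mul hb.le, mul_assoc]
    _ ≤ (∑' x : u, ENNReal.ofReal (10 * (t x * D))) *
        (ENNReal.ofReal (ε ^ n) * unitBallVolume n) := mul_le_mul_left hlen _
    _ = ENNReal.ofReal (10 * D) * ∑' x : u, ENNReal.ofReal (t x * ε ^ n) * unitBallVolume n := by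
        rw [← ENNReal.tsum_mul_right, ← ENNReal.tsum_mul_left]
        refine tsum_congr fun x => ?_
        have := hpos x x.2
        have h0 := (ht x (huS x.2).1 (huS x.2).2).1
        rw [← mul_assoc, ← ENNReal.ofReal_mul (by positivity)]
        conv_rhs => rw [← mul_assoc, ← ENNReal.ofReal_mul (by positivity)]
        congr 2
        ring
    _ ≤ _ := mul_le_mul_right hsum _

theorem lintegral_segment_le {ρ : Eu n → ℝ≥0∞} (hρ : Measurable ρ) {x z : Eu n} {D : ℝ}
    (h : dist z x ≤ D) : ∫⁻ w in (fun t : ℝ => x + t • (z - x)) '' Icc 0 1, ρ w ∂μH[1] ≤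
      ∫⁻ t in Icc (0 : ℝ) 1, ENNReal.ofReal D * ρ (x + t • (z - x)) := by
  have hlip : LipschitzWith D.toNNReal fun t : ℝ => x + t • (z - x) :=
    LipschitzWith.of_dist_le_mul fun s t => by
      rw [dist_add_left, dist_eq_norm, ← sub_smul, norm_smul, Real.dist_eq, mul_comm,
        Real.norm_eq_abs, Real.coe_toNNReal _ (dist_nonneg.trans h), ← dist_eq_norm]
      exact mul_le_mul_of_nonneg_right h (abs_nonneg _)
  refine (lintegral_image_le measurableSet_Icc hlip.lipschitzOnWith hρ).trans_eq ?_
  rw [lintegral_const_mul' _ _ ENNReal.ofReal_ne_top]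
  rfl

theorem lipJoined_segment (x z : Eu n) :
    LipJoined ((fun t : ℝ => x + t • (z - x)) '' Icc 0 1) x z := by
  have hlip : LipschitzWith ‖z - x‖₊ fun t : ℝ => x + t • (z - x) :=
    LipschitzWith.of_dist_le_mul fun s t => by
      rw [dist_add_left, dist_eq_norm, ← sub_smul, norm_smul, Real.dist_eq, mul_comm]
      rfl
  have := LipschitzWith.lipJoined zero_le_one hlip
  simpa using this

theorem exists_dist_eq_setDist {F₁ F₂ : Set (Eu n)} (h₁ : IsContinuum F₁) (h₂ : IsContinuum F₂) :
    ∃ p ∈ F₁, ∃ q ∈ F₂, dist p q = setDist F₁ F₂ := by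
  have hc : IsCompact (image2 dist F₁ F₂) := by
    rw [← image_prod]
    exact (h₁.1.prod h₂.1).image continuous_dist
  have := hc.sInf_mem (h₁.2.nonempty.image2 h₂.2.nonempty)
  obtain ⟨p, hp, q, hq, h⟩ := this
  exact ⟨p, hp, q, hq, h⟩

theorem IsContinuum.diam_pos {F : Set (Eu n)} (h : IsContinuum F) (h' : F.Nontrivial) :
    0 < diam F := Metric.diam_pos h' h.1.isBounded

theorem exists_dist_ge_of_le_diam {F : Set (Eu n)} {p : Eu n} {d : ℝ}
    (hd : 0 < d) (hdF : d ≤ diam F) : ∃ y ∈ F, d / 4 ≤ dist y p := by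
  by_contra! hcon
  have : diam F ≤ d / 4 + d / 4 := diam_le_of_forall_dist_le (by positivity) fun x hx y hy =>
    (dist_triangle_right x y p).trans (add_le_add (hcon x hx).le (hcon y hy).le)
  linarith

/-- The Loewner property of Euclidean space, in a local form. If `∫ ρⁿ` is small, there are points
`x` and `y` of the two continua at which Riesz potentials of `ρ` are small. Averaging over `z`, two
segments `[x, z]` and `[z, y]` are short for `ρ`. -/
theorem exists_modulus_joining_ge (hn : n ≠ 0) : ∃ φ : ℝ≥0∞, 0 < φ ∧ φ < ∞ ∧
    ∀ (x₀ : Eu n) (r : ℝ) (F₁ F₂ : Set (Eu n)), IsContinuum F₁ → IsContinuum F₂ →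
      F₁.Nontrivial → F₂.Nontrivial → Disjoint F₁ F₂ → F₁ ⊆ ball x₀ r → F₂ ⊆ ball x₀ r →
      relDist F₁ F₂ ≤ 1 → φ ≤ modulus (joining F₁ F₂ (ball x₀ (10 * r))) := by
  have hn0 : (0 : ℝ) < n := by exact_mod_cast Nat.pos_of_ne_zero hn
  -- chosen such that `2 * (2 * n * ε * (4 * d) ^ n)` is half of `d ^ n`
  set ε : ℝ := 1 / (8 * n * 4 ^ n) with hε
  have hε0 : 0 < ε := by positivity
  refine ⟨ENNReal.ofReal (ε ^ n / 160) * unitBallVolume n,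
    ENNReal.mul_pos (ENNReal.ofReal_pos.2 (by positivity)).ne' unitBallVolume_pos.ne',
    ENNReal.mul_lt_top ENNReal.ofReal_lt_top unitBallVolume_lt_top, ?_⟩
  intro x₀ r F₁ F₂ h₁ h₂ hnt₁ hnt₂ hdisj hb₁ hb₂ hrel
  refine le_iInf₂ fun ρ hρ => ?_
  by_contra! hlt
  set d := min (diam F₁) (diam F₂) with hd
  have hd0 : 0 < d := lt_min (h₁.diam_pos hnt₁) (h₂.diam_pos hnt₂)
  obtain ⟨p, hp, q, hq, hpq⟩ := exists_dist_eq_setDist h₁ h₂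
  have hpq' : dist p q ≤ d := by
    rw [hpq]
    have := (div_le_one hd0).1 hrel
    exact this
  have hr0 : 0 < r := dist_nonneg.trans_lt (hb₁ hp)
  have hdr : d ≤ 2 * r := (min_le_left _ _).trans
    ((diam_mono hb₁ isBounded_ball).trans (diam_ball hr0.le))
  have hsmall : ENNReal.ofReal (10 * (4 * d)) * ∫⁻ z, ρ z ^ n <
      ENNReal.ofReal (d / 4 * ε ^ n) * unitBallVolume n := by
    have h0 : ENNReal.ofReal (10 * (4 * d)) ≠ 0 := (ENNReal.ofReal_pos.2 (by positivity)).ne'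
    have := (ENNReal.mul_lt_mul_iff_right h0 ENNReal.ofReal_ne_top).2 hlt
    refine this.trans_eq ?_
    rw [← mul_assoc, ← ENNReal.ofReal_mul (by positivity)]
    congr 2
    ring
  obtain ⟨y₁, hy₁, hy₁d⟩ := exists_dist_ge_of_le_diam (p := p) hd0 (min_le_left _ _)
  obtain ⟨y₂, hy₂, hy₂d⟩ := exists_dist_ge_of_le_diam (p := q) hd0 (min_le_right _ _)
  obtain ⟨x, hx, hxp, hxm⟩ := exists_mem_small_mass h₁.2.isPreconnected hp hy₁
    (D := 4 * d) (by positivity) (by positivity) hy₁d hsmall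
  obtain ⟨y, hy, hyq, hym⟩ := exists_mem_small_mass h₂.2.isPreconnected hq hy₂
    (D := 4 * d) (by positivity) (by positivity) hy₂d hsmall
  have hxI := lintegral_radial_le hn hρ.1 (by positivity) hε0 hxm
  have hyI := lintegral_radial_le hn hρ.1 (by positivity) hε0 hym
  have hzx : ∀ z ∈ ball p d, dist z x < 4 * d := fun z hz => by
    have h1 := dist_triangle_right z x p
    have h2 : dist z p < d := hz
    linarith
  have hzy : ∀ z ∈ ball p d, dist z y < 4 * d := fun z hz => by
    have h1 := dist_triangle_right z y p
    have h2 : dist z p < d := hz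
    have h3 := dist_triangle_right y p q
    linarith
  set f : Eu n → Eu n → ℝ≥0∞ := fun x z =>
    ∫⁻ t in Icc (0 : ℝ) 1, ENNReal.ofReal (4 * d) * ρ (x + t • (z - x)) with hf
  have hfm : ∀ x, Measurable (f x) := fun x => by
    refine Measurable.lintegral_prod_right'
      (f := fun p : Eu n × ℝ => ENNReal.ofReal (4 * d) * ρ (x + p.2 • (p.1 - x))) ?_
    exact (hρ.1.comp (by fun_prop)).const_mul _
  -- the means over `z` of the integrals along the segments are less than `1 / 2`
  obtain ⟨z, hz, hzlt⟩ : ∃ z ∈ ball p d, f x z + f y z < 1 := by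
    by_contra! hcon
    have h1 : volume (ball p d) ≤ ∫⁻ z in ball p d, (f x z + f y z) := by
      have := setLIntegral_mono' (μ := volume) (measurableSet_ball (x := p) (ε := d)) hcon
      simpa using this
    rw [lintegral_add_left (hfm x)] at h1
    have h2 := h1.trans (add_le_add ((lintegral_mono_set fun z hz => hzx z hz).trans hxI)
      ((lintegral_mono_set fun z hz => hzy z hz).trans hyI))
    rw [volume_ball_eq p hd0, ← add_mul, ← ENNReal.ofReal_add (by positivity) (by positivity),
      ENNReal.mul_le_mul_iff_left unitBallVolume_pos.ne' unitBallVolume_lt_top.ne,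
      ENNReal.ofReal_le_ofReal_iff (by positivity)] at h2
    have h3 : 2 * n * ε * (4 * d) ^ n = d ^ n / 4 := by
      rw [hε, mul_pow]; field_simp; norm_num
    rw [h3] at h2
    have : 0 < d ^ n := by positivity
    linarith
  set S₁ := (fun t : ℝ => x + t • (z - x)) '' Icc 0 1 with hS₁
  set S₂ := (fun t : ℝ => y + t • (z - y)) '' Icc 0 1 with hS₂
  have hcont : ∀ x z : Eu n, Continuous fun t : ℝ => x + t • (z - x) := fun x z => by fun_prop
  have hK : IsCompact (S₁ ∪ S₂) :=
    (isCompact_Icc.image (hcont x z)).union (isCompact_Icc.image (hcont y z))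
  have hxy : x ≠ y := fun h => disjoint_left.1 hdisj hx (h ▸ hy)
  have hjoin : LipJoined (S₁ ∪ S₂) x y :=
    ((lipJoined_segment x z).mono subset_union_left).trans
      ((lipJoined_segment y z).mono subset_union_right).symm
  obtain ⟨γ, hγs, hγr, hγK, h0, h1⟩ := hjoin.exists_curve hK hxy
  have hseg : ∀ x z : Eu n, x ∈ ball x₀ (10 * r) → z ∈ ball x₀ (10 * r) →
      (fun t : ℝ => x + t • (z - x)) '' Icc 0 1 ⊆ ball x₀ (10 * r) := by
    intro x z hx hz
    rw [← segment_eq_image']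
    exact (convex_ball _ _).segment_subset hx hz
  have hin : ∀ w, dist w x₀ < r → w ∈ ball x₀ (10 * r) := fun w hw => by
    rw [mem_ball]; linarith
  have hzb : z ∈ ball x₀ (10 * r) := by
    have h2 := dist_triangle z p x₀
    have h3 : dist z p < d := hz
    have h4 : dist p x₀ < r := hb₁ hp
    rw [mem_ball]; linarith
  have hKb : S₁ ∪ S₂ ⊆ ball x₀ (10 * r) :=
    union_subset (hseg x z (hin x (hb₁ hx)) hzb) (hseg y z (hin y (hb₂ hy)) hzb)
  have hone : 1 ≤ γ.lineIntegral ρ := hρ.2 γ ⟨h0 ▸ hx, h1 ▸ hy,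
    (hγK.trans hKb).trans subset_closure, fun t _ _ => hKb (hγK ⟨t, rfl⟩)⟩ hγr
  refine absurd hone (not_le.2 ?_)
  calc γ.lineIntegral ρ = ∫⁻ w in γ.trace, ρ w ∂μH[1] := hγs.lineIntegral_eq hγr hρ.1
    _ ≤ _ := (lintegral_mono_set hγK).trans (lintegral_union_le _ _ _)
    _ ≤ f x z + f y z := add_le_add (lintegral_segment_le hρ.1 (hzx z hz).le)
        (lintegral_segment_le hρ.1 (hzy z hz).le)
    _ < 1 := hzlt

theorem joining_mono {F₁ F₂ U V : Set (Eu n)} (h : U ⊆ V) : joining F₁ F₂ U ⊆ joining F₁ F₂ V :=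
  fun _ hγ => ⟨hγ.1, hγ.2.1, hγ.2.2.1.trans (closure_mono h), fun t h1 h2 => h (hγ.2.2.2 t h1 h2)⟩

/-- In small balls around points of `Ω` the bound follows from the Loewner property. Other points
have neighbourhoods that do not meet `E`, in which all paths are in `𝓕_*(E)` up to endpoints. -/
theorem IsWeaklyNegligible.localLoewnerBound (hn : n ≠ 0) {k : Kind} {E Ω : Set (Eu n)}
    (hE : IsClosed E) (hΩ : IsOpen Ω) (hEΩ : E ⊆ Ω) (h : IsWeaklyNegligible k Ω E) :
    LocalLoewnerBound k E := by
  obtain ⟨M, hM1, hM⟩ := h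
  obtain ⟨φ, hφ0, hφt, hφ⟩ := exists_modulus_joining_ge (n := n) hn
  have hM0 : (M : ℝ≥0∞) ≠ 0 := by
    have : M ≠ 0 := (one_pos.trans_le hM1).ne'
    exact_mod_cast this
  have hdiv : φ / M ≠ ∞ := ENNReal.div_ne_top hφt.ne hM0
  have hdiv' : φ / M ≤ φ := ENNReal.div_le_of_le_mul (le_mul_of_one_le_right zero_le
    (by exact_mod_cast hM1))
  refine ⟨1, (φ / M).toReal, one_pos, ENNReal.toReal_pos
    (ENNReal.div_pos hφ0.ne' ENNReal.coe_ne_top).ne' hdiv, fun x₀ => ?_⟩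
  rw [ENNReal.ofReal_toReal hdiv]
  by_cases hx : x₀ ∈ Ω
  · obtain ⟨R, hR, hRΩ⟩ := isOpen_iff.1 hΩ x₀ hx
    refine ⟨R / 10, by positivity, fun F₁ F₂ h₁ h₂ hn₁ hn₂ hd hb₁ hb₂ hrel => ?_⟩
    have hlow := hφ x₀ (R / 10) F₁ F₂ h₁ h₂ hn₁ hn₂ hd hb₁ hb₂ hrel
    rw [mul_div_cancel₀ _ (by norm_num)] at hlow
    have hsub : ball x₀ (R / 10) ⊆ Ω := (ball_subset_ball (by linarith)).trans hRΩ
    refine ENNReal.div_le_of_le_mul' ?_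
    calc φ ≤ _ := hlow
      _ ≤ modulus (joining F₁ F₂ Ω) := modulus_mono (joining_mono hRΩ)
      _ ≤ _ := hM F₁ F₂ h₁ h₂ (hb₁.trans hsub) (hb₂.trans hsub) hd
      _ ≤ _ := mul_le_mul_right
        (modulus_mono (inter_subset_inter_left _ (joining_mono (subset_univ _)))) _
  · obtain ⟨R, hR, hRE⟩ := isOpen_iff.1 hE.isOpen_compl x₀ (fun h => hx (hEΩ h))
    refine ⟨R / 10, by positivity, fun F₁ F₂ h₁ h₂ hn₁ hn₂ hd hb₁ hb₂ hrel => ?_⟩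
    have hlow := hφ x₀ (R / 10) F₁ F₂ h₁ h₂ hn₁ hn₂ hd hb₁ hb₂ hrel
    rw [mul_div_cancel₀ _ (by norm_num)] at hlow
    refine hdiv'.trans (hlow.trans (modulus_mono fun γ hγ => ⟨joining_mono (subset_univ _) hγ, ?_⟩))
    refine mem_family_iff.2 (Kind.good_of_disjoint (disjoint_left.2 ?_))
    rintro _ ⟨⟨t, rfl⟩, hb⟩ hE'
    have h0 : γ.a < t := t.2.1.lt_of_ne fun h => hb (Or.inl (by
      rw [show t = γ.left from Subtype.ext h.symm]; rfl))
    have h1 : (t : ℝ) < γ.b := t.2.2.lt_of_ne fun h => hb (Or.inr (by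
      rw [show t = γ.right from Subtype.ext h]; rfl))
    exact hRE (hγ.2.2.2 t h0 h1) hE'

end

/-! ### Detours of controlled length -/

section

open Metric

variable {n : ℕ} {k : Kind} {E : Set (Eu n)}

theorem relDist_le {F₁ F₂ : Set (Eu n)} {p q : Eu n} (hp : p ∈ F₁) (hq : q ∈ F₂) {a m : ℝ}
    (hm : 0 < m) (h₁ : m ≤ diam F₁) (h₂ : m ≤ diam F₂) (h : dist p q ≤ a) :
    relDist F₁ F₂ ≤ a / m := by
  have hbdd : BddBelow (image2 dist F₁ F₂) := ⟨0, by
    rintro _ ⟨x, -, y, -, rfl⟩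
    exact dist_nonneg⟩
  have h1 : setDist F₁ F₂ ≤ a := (csInf_le hbdd ⟨p, hp, q, hq, rfl⟩).trans h
  exact div_le_div₀ (dist_nonneg.trans h) h1 hm (le_min h₁ h₂)

theorem isContinuum_image_Icc {f : ℝ → Eu n} (hf : Continuous f) {a b : ℝ} (hab : a ≤ b) :
    IsContinuum (f '' Icc a b) :=
  ⟨isCompact_Icc.image hf, (isConnected_Icc hab).image _ hf.continuousOn⟩

/-- The local Loewner bound fails near density points of `E`: paths between two segments of
length `r` have to spend a length comparable to `r` in the complement of `E`, which has small
density. -/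
theorem LocalLoewnerBound.volume_eq_zero (hn : n ≠ 0) (hE : IsClosed E)
    (h : LocalLoewnerBound k E) : volume E = 0 := by
  obtain ⟨t, φ, ht, hφ, hL⟩ := h
  by_contra hpos
  obtain ⟨x₀, hx₀E, hlim⟩ : ∃ x ∈ E, Tendsto
      (fun r => volume (Eᶜ ∩ closedBall x r) / volume (closedBall x r)) (𝓝[>] 0) (𝓝 0) := by
    have hae := Besicovitch.ae_tendsto_measure_inter_div_of_measurableSet
      (volume : Measure (Eu n)) hE.measurableSet.compl
    by_contra! hcon
    refine hpos (measure_mono_null (fun x hx => ?_) hae)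
    intro hx'
    refine hcon x hx ?_
    have hx'' : Tendsto (fun r => volume (Eᶜ ∩ closedBall x r) / volume (closedBall x r)) (𝓝[>] 0)
        (𝓝 (Eᶜ.indicator 1 x)) := hx'
    rwa [indicator_of_notMem (by simpa using hx)] at hx''
  obtain ⟨r₀, hr₀, hF⟩ := hL x₀
  set κ : ℝ := min t 1 with hκ
  have hκ0 : 0 < κ := lt_min ht one_pos
  have hκ1 : κ ≤ 1 := min_le_right _ _
  -- a density of the complement below which the test function for the modulus has a mass less
  -- than `φ`
  set e : ℝ≥0∞ := ENNReal.ofReal ((κ / 2) ^ n) * (unitBallVolume n)⁻¹ * ENNReal.ofReal φ with he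
  have he0 : 0 < e := by
    refine ENNReal.mul_pos (ENNReal.mul_pos ?_ ?_).ne' (ENNReal.ofReal_pos.2 hφ).ne'
    · exact (ENNReal.ofReal_pos.2 (by positivity)).ne'
    · exact ENNReal.inv_ne_zero.2 unitBallVolume_lt_top.ne
  have hev := hlim.eventually_lt_const he0
  have hev2 : ∀ᶠ r in 𝓝[>] (0 : ℝ), r ∈ Ioo 0 r₀ := Ioo_mem_nhdsGT hr₀
  obtain ⟨r', hr', hr'0, hr'₀⟩ := (hev.and hev2).exists
  set r := r' / 2 with hr
  have hr2 : r' = 2 * r := by rw [hr]; ring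
  rw [hr2] at hr' hr'0 hr'₀
  have hr0 : 0 < r := by linarith
  set v : Eu n := EuclideanSpace.single ⟨0, Nat.pos_of_ne_zero hn⟩ 1 with hv
  have hv1 : ‖v‖ = 1 := by simp [hv]
  set f : ℝ → Eu n := fun s => x₀ + s • v with hf
  have hfd : ∀ s s', dist (f s) (f s') = |s - s'| := fun s s' => by
    rw [hf, dist_add_left, dist_eq_norm, ← sub_smul, norm_smul, hv1, mul_one, Real.norm_eq_abs]
  have hf0 : f 0 = x₀ := by simp [hf]
  have hfx : ∀ s, dist (f s) x₀ = |s| := fun s => by rw [← hf0, hfd, sub_zero]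
  have hfc : Continuous f := by fun_prop
  set F₁ := f '' Icc 0 r with hF₁
  set F₂ := f '' Icc (-(1 + κ) * r) (-κ * r) with hF₂
  have hord : -(1 + κ) * r ≤ -κ * r := by nlinarith
  have h₁ : IsContinuum F₁ := isContinuum_image_Icc hfc hr0.le
  have h₂ : IsContinuum F₂ := isContinuum_image_Icc hfc hord
  have hd₁ : r ≤ diam F₁ := by
    have := dist_le_diam_of_mem h₁.1.isBounded ⟨0, left_mem_Icc.2 hr0.le, rfl⟩
      ⟨r, right_mem_Icc.2 hr0.le, rfl⟩
    rwa [hfd, zero_sub, abs_neg, abs_of_pos hr0] at this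
  have hd₂ : r ≤ diam F₂ := by
    have := dist_le_diam_of_mem h₂.1.isBounded ⟨_, left_mem_Icc.2 hord, rfl⟩
      ⟨_, right_mem_Icc.2 hord, rfl⟩
    rw [hfd, show -(1 + κ) * r - -κ * r = -r by ring, abs_neg, abs_of_pos hr0] at this
    exact this
  have hfar : ∀ p ∈ F₁, ∀ q ∈ F₂, κ * r ≤ dist q p := by
    rintro _ ⟨s, hs, rfl⟩ _ ⟨s', hs', rfl⟩
    rw [hfd, abs_sub_comm]
    exact le_trans (by linarith [hs.1, hs'.2]) (le_abs_self _)
  have hκr : 0 < κ * r := by positivity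
  have hdisj : Disjoint F₁ F₂ := disjoint_left.2 fun p hp hp' => by
    have := hfar p hp p hp'
    rw [dist_self] at this
    linarith
  have hnt : ∀ F : Set (Eu n), r ≤ diam F → F.Nontrivial := fun F hd => by
    by_contra hns
    rw [Set.not_nontrivial_iff] at hns
    rw [Metric.diam_subsingleton hns] at hd
    linarith
  have hb₁ : F₁ ⊆ ball x₀ r₀ := by
    rintro _ ⟨s, hs, rfl⟩
    rw [mem_ball, hfx, abs_of_nonneg hs.1]
    linarith [hs.2]
  have hb₂ : F₂ ⊆ ball x₀ r₀ := by
    rintro _ ⟨s, hs, rfl⟩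
    rw [mem_ball, hfx, abs_of_nonpos (by nlinarith [hs.2])]
    nlinarith [hs.1]
  have hrel : relDist F₁ F₂ ≤ t := by
    have := relDist_le (a := κ * r) (show f 0 ∈ F₁ from ⟨0, left_mem_Icc.2 hr0.le, rfl⟩)
      (show f (-κ * r) ∈ F₂ from ⟨_, right_mem_Icc.2 hord, rfl⟩) hr0 hd₁ hd₂ (by
        rw [hfd, show 0 - -κ * r = κ * r by ring, abs_of_pos hκr])
    rw [mul_div_cancel_right₀ _ hr0.ne'] at this
    exact this.trans (min_le_left _ _)
  have hmod := hF F₁ F₂ h₁ h₂ (hnt _ hd₁) (hnt _ hd₂) hdisj hb₁ hb₂ hrel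
  set S := Eᶜ ∩ closedBall x₀ (2 * r) with hS
  have hSm : MeasurableSet S := hE.measurableSet.compl.inter measurableSet_closedBall
  have hle := modulus_le (Γ := joining F₁ F₂ univ ∩ k.family E)
    (ρ := S.indicator fun _ => (ENNReal.ofReal (κ * r))⁻¹) (measurable_const.indicator hSm) (by
    rintro γ ⟨⟨hs, hfi, -⟩, hfam⟩ hγ
    refine le_trans ?_ (hγ.lintegral_trace_le (measurable_const.indicator hSm))
    rw [lintegral_indicator_const hSm, Measure.restrict_apply hSm]
    have h1 := le_hausdorff_shell (a := 0) γ.isPreconnected_trace γ.start_mem_trace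
      γ.finish_mem_trace (by simp) (hfar _ hs _ hfi)
    rw [sub_zero] at h1
    have h2 : γ.trace ∩ {z | 0 ≤ dist z γ.start ∧ dist z γ.start < κ * r} ⊆
        (S ∩ γ.trace) ∪ (γ.trace ∩ E) := by
      rintro z ⟨hz, -, hzd⟩
      by_cases hzE : z ∈ E
      · exact Or.inr ⟨hz, hzE⟩
      · refine Or.inl ⟨⟨hzE, ?_⟩, hz⟩
        obtain ⟨s, hs, hs'⟩ := hs
        have h3 := dist_triangle z γ.start x₀
        rw [← hs', hfx, abs_of_nonneg hs.1] at h3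
        rw [← hs'] at hzd
        rw [mem_closedBall]
        nlinarith [hs.2]
    have h3 : ENNReal.ofReal (κ * r) ≤ μH[1] (S ∩ γ.trace) := by
      refine h1.trans ((measure_mono h2).trans ((measure_union_le _ _).trans_eq ?_))
      rw [(countable_inter_of_mem_family hfam).measure_zero, add_zero]
    rw [← ENNReal.inv_mul_cancel (ENNReal.ofReal_pos.2 hκr).ne' ENNReal.ofReal_ne_top]
    exact mul_le_mul_right h3 _)
  have hpow : ∀ x, (S.indicator (fun _ => (ENNReal.ofReal (κ * r))⁻¹) x) ^ n =
      S.indicator (fun _ => (ENNReal.ofReal (κ * r))⁻¹ ^ n) x := fun x => by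
    by_cases hx : x ∈ S <;> simp [hx, hn]
  simp_rw [hpow] at hle
  rw [lintegral_indicator_const hSm] at hle
  have hB : volume (closedBall x₀ (2 * r)) = ENNReal.ofReal ((2 * r) ^ n) * unitBallVolume n := by
    rw [Measure.addHaar_closedBall _ _ (by positivity), finrank_euclideanSpace_fin, unitBallVolume]
  have hS1 : volume S < e * volume (closedBall x₀ (2 * r)) := by
    rw [hB]
    rw [hB] at hr'
    refine (ENNReal.div_lt_iff (Or.inl ?_) (Or.inl ?_)).1 hr'
    · exact mul_ne_zero (ENNReal.ofReal_pos.2 (by positivity)).ne' unitBallVolume_pos.ne'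
    · exact ENNReal.mul_ne_top ENNReal.ofReal_ne_top unitBallVolume_lt_top.ne
  have h0 : (ENNReal.ofReal (κ * r))⁻¹ ^ n ≠ 0 :=
    pow_ne_zero _ (ENNReal.inv_ne_zero.2 ENNReal.ofReal_ne_top)
  have h0' : (ENNReal.ofReal (κ * r))⁻¹ ^ n ≠ ∞ :=
    ENNReal.pow_ne_top (ENNReal.inv_ne_top.2 (ENNReal.ofReal_pos.2 hκr).ne')
  have hfinal := (hmod.trans hle).trans_lt ((ENNReal.mul_lt_mul_iff_right h0 h0').2 hS1)
  refine absurd hfinal (not_lt.2 (le_of_eq ?_))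
  rw [hB, he, ← ENNReal.ofReal_inv_of_pos hκr, ← ENNReal.ofReal_pow (by positivity)]
  have hω : (unitBallVolume n)⁻¹ * unitBallVolume n = 1 :=
    ENNReal.inv_mul_cancel unitBallVolume_pos.ne' unitBallVolume_lt_top.ne
  calc _ = ENNReal.ofReal ((κ * r)⁻¹ ^ n) * ENNReal.ofReal ((κ / 2) ^ n) *
        ENNReal.ofReal ((2 * r) ^ n) * ((unitBallVolume n)⁻¹ * unitBallVolume n) *
        ENNReal.ofReal φ := by ring
    _ = _ := by
      rw [hω, mul_one, ← ENNReal.ofReal_mul (by positivity), ← ENNReal.ofReal_mul (by positivity),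
        ← ENNReal.ofReal_mul (by positivity), ← mul_pow, ← mul_pow]
      congr 1
      rw [show (κ * r)⁻¹ * (κ / 2) * (2 * r) = 1 by field_simp, one_pow, one_mul]

theorem Curve.IsRectifiable.lineIntegral_congr {γ : Curve n} (hγ : γ.IsRectifiable)
    {ρ ρ' : Eu n → ℝ≥0∞} (h : ∀ x ∈ γ.trace, ρ x = ρ' x) :
    γ.lineIntegral ρ = γ.lineIntegral ρ' :=
  setLIntegral_congr_fun measurableSet_Icc fun _ ht =>
    h _ (hγ.image_arclengthParam ▸ mem_image_of_mem _ ht)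

theorem Curve.IsRectifiable.lineIntegral_const {γ : Curve n} (hγ : γ.IsRectifiable) (c : ℝ≥0∞) :
    γ.lineIntegral (fun _ => c) = c * γ.length := by
  simp [Curve.lineIntegral, ENNReal.ofReal_toReal hγ.ne]

/-- A function of small `Lⁿ`-norm along which all paths from `B(c, r)` to the complement of
`B(c, 2 ^ N r)` are long. -/
theorem exists_annular_function (hn : 2 ≤ n) {N : ℕ} (hN : N ≠ 0) (c : Eu n) {r : ℝ}
    (hr : 0 < r) : ∃ h : Eu n → ℝ≥0∞, Measurable h ∧
      ∫⁻ x, h x ^ n ≤ (N : ℝ≥0∞)⁻¹ * (2 ^ n * unitBallVolume n) ∧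
      ∀ K : Set (Eu n), IsPreconnected K → MeasurableSet K → (∃ x ∈ K, dist x c ≤ r) →
        (∃ y ∈ K, 2 ^ N * r ≤ dist y c) → 1 ≤ ∫⁻ x in K, h x ∂μH[1] := by
  have hn0 : n ≠ 0 := by omega
  have hN0 : (0 : ℝ) < N := by exact_mod_cast Nat.pos_of_ne_zero hN
  set A : ℕ → Set (Eu n) := fun j => {z | 2 ^ j * r ≤ dist z c ∧ dist z c < 2 ^ (j + 1) * r}
    with hA
  have hAm : ∀ j, MeasurableSet (A j) := fun j => by
    refine MeasurableSet.inter ?_ ?_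
    · exact (isClosed_le continuous_const (continuous_id.dist continuous_const)).measurableSet
    · exact (isOpen_lt (continuous_id.dist continuous_const) continuous_const).measurableSet
  -- each of the `N` dyadic shells `A j` has width `2 ^ j * r` and contributes `1 / N`
  set w : ℕ → ℝ≥0∞ := fun j => (ENNReal.ofReal (N * (2 ^ j * r)))⁻¹ with hw
  have hm : ∀ j, Measurable ((A j).indicator fun _ => w j) := fun j =>
    measurable_const.indicator (hAm j)
  refine ⟨fun x => ∑ j ∈ Finset.range N, (A j).indicator (fun _ => w j) x,
    Finset.measurable_sum _ fun j _ => hm j, ?_, ?_⟩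
  · have hpow : ∀ x, (∑ j ∈ Finset.range N, (A j).indicator (fun _ => w j) x) ^ n ≤
        ∑ j ∈ Finset.range N, (A j).indicator (fun _ => w j ^ n) x := by
      intro x
      by_cases hx : ∃ j ∈ Finset.range N, x ∈ A j
      · obtain ⟨j, hj, hxj⟩ := hx
        have hne : ∀ i ∈ Finset.range N, i ≠ j → (A i).indicator (fun _ => w i) x = 0 := by
          intro i _ hij
          refine indicator_of_notMem (fun hxi => ?_) _
          rcases lt_or_gt_of_ne hij with h | h
          · have : (2 : ℝ) ^ (i + 1) * r ≤ 2 ^ j * r :=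
              mul_le_mul_of_nonneg_right (pow_le_pow_right₀ one_le_two h) hr.le
            linarith [hxi.2, hxj.1]
          · have : (2 : ℝ) ^ (j + 1) * r ≤ 2 ^ i * r :=
              mul_le_mul_of_nonneg_right (pow_le_pow_right₀ one_le_two h) hr.le
            linarith [hxj.2, hxi.1]
        rw [Finset.sum_eq_single_of_mem j hj hne, indicator_of_mem hxj]
        refine le_trans (le_of_eq ?_) (Finset.single_le_sum (f := fun j =>
          (A j).indicator (fun _ => w j ^ n) x) (fun _ _ => zero_le) hj)
        rw [indicator_of_mem hxj]
      · push Not at hx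
        rw [Finset.sum_eq_zero fun j hj => indicator_of_notMem (hx j hj) _, zero_pow hn0]
        exact zero_le
    calc _ ≤ _ := lintegral_mono hpow
      _ = ∑ j ∈ Finset.range N, w j ^ n * volume (A j) := by
        rw [lintegral_finsetSum _ fun j _ => measurable_const.indicator (hAm j)]
        exact Finset.sum_congr rfl fun j _ => lintegral_indicator_const (hAm j) _
      _ ≤ ∑ j ∈ Finset.range N, ENNReal.ofReal ((2 / N) ^ n) * unitBallVolume n := by
        refine Finset.sum_le_sum fun j _ => ?_
        have h1 : volume (A j) ≤ ENNReal.ofReal ((2 ^ (j + 1) * r) ^ n) * unitBallVolume n := by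
          rw [← volume_ball_eq c (by positivity)]
          exact measure_mono fun z hz => hz.2
        refine (mul_le_mul_right h1 _).trans_eq ?_
        rw [hw]
        dsimp only
        rw [← ENNReal.ofReal_inv_of_pos (by positivity), ← ENNReal.ofReal_pow (by positivity),
          ← mul_assoc, ← ENNReal.ofReal_mul (by positivity), ← mul_pow]
        congr 3
        field_simp
        ring
      _ = N * (ENNReal.ofReal ((2 / N) ^ n) * unitBallVolume n) := by
        rw [Finset.sum_const, Finset.card_range, nsmul_eq_mul]
      _ ≤ _ := by
        rw [← mul_assoc, ← mul_assoc, ← ENNReal.ofReal_natCast, ← ENNReal.ofReal_mul (by positivity),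
          ← ENNReal.ofReal_inv_of_pos hN0]
        have h2 : (2 : ℝ≥0∞) ^ n = ENNReal.ofReal (2 ^ n) := by
          rw [ENNReal.ofReal_pow (by norm_num)]; norm_num
        rw [h2, ← ENNReal.ofReal_mul (by positivity)]
        refine mul_le_mul_left (ENNReal.ofReal_le_ofReal ?_) _
        obtain ⟨m, rfl⟩ : ∃ m, n = m + 2 := ⟨n - 2, by omega⟩
        have h3 : (1 : ℝ) ≤ N ^ m := one_le_pow₀ (by exact_mod_cast Nat.one_le_iff_ne_zero.2 hN)
        rw [div_pow, ← div_eq_inv_mul, mul_div_assoc', div_le_div_iff₀ (by positivity) hN0]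
        calc (N : ℝ) * 2 ^ (m + 2) * N = 2 ^ (m + 2) * N ^ 2 * 1 := by ring
          _ ≤ 2 ^ (m + 2) * N ^ 2 * N ^ m := mul_le_mul_of_nonneg_left h3 (by positivity)
          _ = _ := by ring
  · rintro K hK hKm ⟨x, hx, hxr⟩ ⟨y, hy, hyr⟩
    rw [lintegral_finsetSum _ fun j _ => hm j]
    have hone : ∀ j ∈ Finset.range N,
        (N : ℝ≥0∞)⁻¹ ≤ ∫⁻ x in K, (A j).indicator (fun _ => w j) x ∂μH[1] := by
      intro j hj
      rw [lintegral_indicator_const (hAm j), Measure.restrict_apply (hAm j), inter_comm]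
      have hj' : j + 1 ≤ N := Finset.mem_range.1 hj
      have h1 : r ≤ 2 ^ j * r := le_mul_of_one_le_left hr.le (one_le_pow₀ one_le_two)
      have h2 : (2 : ℝ) ^ (j + 1) * r ≤ 2 ^ N * r :=
        mul_le_mul_of_nonneg_right (pow_le_pow_right₀ one_le_two hj') hr.le
      have h3 := le_hausdorff_shell hK hx hy (hxr.trans h1) (h2.trans hyr)
      rw [show (2 : ℝ) ^ (j + 1) * r - 2 ^ j * r = 2 ^ j * r by ring] at h3
      refine le_trans (le_of_eq ?_) (mul_le_mul_right h3 _)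
      rw [hw]
      dsimp only
      have h4 : ENNReal.ofReal (2 ^ j * r) ≠ 0 := (ENNReal.ofReal_pos.2 (by positivity)).ne'
      rw [ENNReal.ofReal_mul hN0.le, ENNReal.ofReal_natCast,
        ENNReal.mul_inv (Or.inr ENNReal.ofReal_ne_top) (Or.inr h4), mul_assoc,
        ENNReal.inv_mul_cancel h4 ENNReal.ofReal_ne_top, mul_one]
    refine le_trans (le_of_eq ?_) (Finset.sum_le_sum hone)
    rw [Finset.sum_const, Finset.card_range, nsmul_eq_mul,
      ENNReal.mul_inv_cancel (by exact_mod_cast hN) (ENNReal.natCast_ne_top N)]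

/-- The cost of a detour at scale `s` around `c`: the length and the `ρ`-length of a suitable detour
are at most a constant times `s + ‖ρ‖`, where the `Lⁿ`-norm is taken over `B(c, C s)`. -/
noncomputable def detourCost (ρ : Eu n → ℝ≥0∞) (C : ℝ) (c : Eu n) (s : ℝ) : ℝ≥0∞ :=
  ENNReal.ofReal s + (∫⁻ x in ball c (C * s), ρ x ^ n) ^ (1 / n : ℝ)

/-- A family of paths that meet `B(c, R s)` and whose modulus is bounded below contains paths that
stay at scale `s` and whose length and `ρ`-length are controlled by the cost at that scale. Paths
that leave a large ball, are long, or have large `ρ`-length, form families of small modulus. -/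
theorem exists_detour_constants (hn : 2 ≤ n) (φ : ℝ≥0∞) (hφ : 0 < φ) {R : ℝ} (hR : 0 < R) :
    ∃ (C : ℝ) (A : ℝ≥0∞), R ≤ C ∧ A ≠ ∞ ∧ ∀ (Γ : Set (Curve n)) (c : Eu n) (s : ℝ), 0 < s →
      (∀ γ ∈ Γ, dist γ.start c ≤ R * s) → φ ≤ modulus Γ → ∀ ρ : Eu n → ℝ≥0∞, Measurable ρ →
      ∀ Γ' : Set (Curve n), modulus Γ' = 0 → ∃ γ ∈ Γ, γ ∉ Γ' ∧ γ.IsRectifiable ∧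
        γ.trace ⊆ ball c (C * s) ∧ γ.length + γ.lineIntegral ρ ≤ A * detourCost ρ C c s := by
  have hn0 : n ≠ 0 := by omega
  set X : ℝ≥0∞ := 1 + unitBallVolume n + 2 ^ n * unitBallVolume n with hX
  have hXt : X ≠ ∞ := by
    have := unitBallVolume_lt_top (n := n)
    finiteness
  obtain ⟨N, hN⟩ : ∃ N : ℕ, X / φ < N := ENNReal.exists_nat_gt (ENNReal.div_ne_top hXt hφ.ne')
  have hX0 : X ≠ 0 := by
    rw [hX, add_assoc]
    exact (one_pos.trans_le le_self_add).ne'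
  have hNX : (N : ℝ≥0∞)⁻¹ * X < φ := by
    have hN0 : (N : ℝ≥0∞) ≠ 0 := (zero_le.trans_lt hN).ne'
    rw [mul_comm, ← div_eq_mul_inv, ENNReal.div_lt_iff (Or.inl hN0)
      (Or.inl (ENNReal.natCast_ne_top N))]
    rcases eq_or_ne φ ∞ with rfl | hφt
    · rw [ENNReal.top_mul hN0]
      exact hXt.lt_top
    · rw [mul_comm]
      exact (ENNReal.div_lt_iff (Or.inl hφ.ne') (Or.inl hφt)).1 hN
  have hN0 : N ≠ 0 := by
    rintro rfl
    simp at hN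
  have hN1 : (1 : ℝ≥0∞) ≤ N := by exact_mod_cast Nat.one_le_iff_ne_zero.2 hN0
  have hNinv : (N : ℝ≥0∞)⁻¹ ^ n ≤ (N : ℝ≥0∞)⁻¹ :=
    pow_le_of_le_one zero_le (ENNReal.inv_le_one.2 hN1) hn0
  have hNR : (0 : ℝ) < N := by exact_mod_cast Nat.pos_of_ne_zero hN0
  set C : ℝ := 2 ^ N * R with hC
  have hC0 : 0 < C := by positivity
  refine ⟨C, N + ENNReal.ofReal (N * C), le_mul_of_one_le_left hR.le (one_le_pow₀ one_le_two),
    by finiteness, ?_⟩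
  intro Γ c s hs hstart hmod ρ hρ Γ' hΓ'
  set a := detourCost ρ C c s with ha
  have hs0 : ENNReal.ofReal s ≠ 0 := (ENNReal.ofReal_pos.2 hs).ne'
  set B := ball c (C * s) with hB
  have hBm : MeasurableSet B := measurableSet_ball
  -- `h₁`, `h₂` and `h₃` exclude paths of large `ρ`-length, long paths and paths that leave `B`;
  -- if `a = ∞`, then `h₁ = 0` and the bound of the `ρ`-length is trivial
  set h₁ : Eu n → ℝ≥0∞ := fun x => (N * a)⁻¹ * B.indicator ρ x with hh₁
  set h₂ : Eu n → ℝ≥0∞ := B.indicator fun _ => (ENNReal.ofReal (N * C * s))⁻¹ with hh₂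
  obtain ⟨h₃, hm₃, hi₃, hlow₃⟩ := exists_annular_function hn hN0 c (mul_pos hR hs)
  have hm₁ : Measurable h₁ := (hρ.indicator hBm).const_mul _
  have hm₂ : Measurable h₂ := measurable_const.indicator hBm
  have hi₁ : ∫⁻ x, h₁ x ^ n ≤ (N : ℝ≥0∞)⁻¹ := by
    have h1 : ∀ x, h₁ x ^ n = (N * a)⁻¹ ^ n * B.indicator (fun x => ρ x ^ n) x := fun x => by
      rw [hh₁]
      dsimp only
      rw [mul_pow]
      by_cases hx : x ∈ B <;> simp [hx, hn0]
    simp_rw [h1]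
    rw [lintegral_const_mul _ ((hρ.pow_const n).indicator hBm), lintegral_indicator hBm]
    have h2 : ∫⁻ x in B, ρ x ^ n ≤ a ^ n := by
      calc ∫⁻ x in B, ρ x ^ n = ((∫⁻ x in B, ρ x ^ n) ^ (1 / n : ℝ)) ^ n := by
            rw [← ENNReal.rpow_natCast, ← ENNReal.rpow_mul, one_div_mul_cancel
              (by exact_mod_cast hn0), ENNReal.rpow_one]
        _ ≤ _ := pow_le_pow_left₀ zero_le le_add_self n
    calc _ ≤ (N * a)⁻¹ ^ n * a ^ n := mul_le_mul_right h2 _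
      _ ≤ (N : ℝ≥0∞)⁻¹ ^ n := by
        rw [← mul_pow]
        refine pow_le_pow_left₀ zero_le ?_ n
        rw [ENNReal.mul_inv (Or.inl (by exact_mod_cast hN0)) (Or.inl (ENNReal.natCast_ne_top N)),
          mul_assoc]
        exact (mul_le_mul_right (ENNReal.inv_mul_le_one a) _).trans_eq (mul_one _)
      _ ≤ _ := hNinv
  have hi₂ : ∫⁻ x, h₂ x ^ n ≤ (N : ℝ≥0∞)⁻¹ * unitBallVolume n := by
    have h1 : ∀ x, h₂ x ^ n = B.indicator (fun _ => (ENNReal.ofReal (N * C * s))⁻¹ ^ n) x :=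
      fun x => by
        rw [hh₂]
        by_cases hx : x ∈ B <;> simp [hx, hn0]
    simp_rw [h1]
    rw [lintegral_indicator_const hBm, hB, volume_ball_eq c (by positivity), ← mul_assoc,
      ENNReal.ofReal_pow (by positivity), ← mul_pow, mul_assoc (N : ℝ) C s,
      ENNReal.ofReal_mul hNR.le, ENNReal.ofReal_natCast]
    have h4 : ENNReal.ofReal (C * s) ≠ 0 := (ENNReal.ofReal_pos.2 (by positivity)).ne'
    rw [ENNReal.mul_inv (Or.inr ENNReal.ofReal_ne_top) (Or.inr h4), mul_assoc,
      ENNReal.inv_mul_cancel h4 ENNReal.ofReal_ne_top, mul_one]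
    exact mul_le_mul_left hNinv _
  have hint : ∫⁻ x, (max (h₁ x) (max (h₂ x) (h₃ x))) ^ n < modulus (Γ \ Γ') := by
    have h1 : φ ≤ modulus (Γ \ Γ') := by
      refine hmod.trans ((modulus_mono (by
        rw [sdiff_union_self]
        exact subset_union_left : Γ ⊆ (Γ \ Γ') ∪ Γ')).trans
        (modulus_union_le.trans_eq (?_ : modulus (Γ \ Γ') + modulus Γ' = _)))
      rw [hΓ', add_zero]
    refine lt_of_le_of_lt ?_ (hNX.trans_le h1)
    calc _ ≤ ∫⁻ x, (h₁ x ^ n + h₂ x ^ n + h₃ x ^ n) := by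
          refine lintegral_mono fun x => ?_
          dsimp only
          rcases le_total (h₁ x) (max (h₂ x) (h₃ x)) with h | h
          · rw [max_eq_right h]
            rcases le_total (h₂ x) (h₃ x) with h' | h'
            · rw [max_eq_right h']; exact le_add_self
            · rw [max_eq_left h']; exact le_add_self.trans le_self_add
          · rw [max_eq_left h, add_assoc]; exact le_self_add
      _ = (∫⁻ x, h₁ x ^ n) + (∫⁻ x, h₂ x ^ n) + ∫⁻ x, h₃ x ^ n := by
          rw [lintegral_add_left (by exact (hm₁.pow_const n).add (hm₂.pow_const n)),
            lintegral_add_left (hm₁.pow_const n)]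
      _ ≤ (N : ℝ≥0∞)⁻¹ + (N : ℝ≥0∞)⁻¹ * unitBallVolume n +
          (N : ℝ≥0∞)⁻¹ * (2 ^ n * unitBallVolume n) := add_le_add (add_le_add hi₁ hi₂) hi₃
      _ = _ := by rw [hX]; ring
  obtain ⟨γ, ⟨hγ, hγ'⟩, hr, hlt⟩ := exists_lineIntegral_lt (hm₁.max (hm₂.max hm₃)) hint
  have hlt₁ : γ.lineIntegral h₁ < 1 :=
    (Curve.lineIntegral_mono fun x => le_max_left _ _).trans_lt hlt
  have hlt₂ : γ.lineIntegral h₂ < 1 :=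
    (Curve.lineIntegral_mono fun x => (le_max_left _ _).trans (le_max_right _ _)).trans_lt hlt
  have hlt₃ : γ.lineIntegral h₃ < 1 :=
    (Curve.lineIntegral_mono fun x => (le_max_right _ _).trans (le_max_right _ _)).trans_lt hlt
  have htr : γ.trace ⊆ B := by
    intro y hy
    by_contra hyB
    rw [hB, mem_ball, not_lt, hC, mul_assoc] at hyB
    have := hlow₃ γ.trace γ.isPreconnected_trace γ.isCompact_trace.measurableSet
      ⟨_, γ.start_mem_trace, hstart γ hγ⟩ ⟨y, hy, hyB⟩
    exact absurd (this.trans (hr.lintegral_trace_le hm₃)) (not_le.2 hlt₃)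
  refine ⟨γ, hγ, hγ', hr, htr, ?_⟩
  have hlen : γ.length ≤ ENNReal.ofReal (N * C * s) := by
    rw [hr.lineIntegral_congr fun x hx => indicator_of_mem (htr hx) _,
      hr.lineIntegral_const, mul_comm, ← div_eq_mul_inv] at hlt₂
    have h4 : ENNReal.ofReal (N * C * s) ≠ 0 := (ENNReal.ofReal_pos.2 (by positivity)).ne'
    have := (ENNReal.div_lt_iff (Or.inl h4) (Or.inl ENNReal.ofReal_ne_top)).1 hlt₂
    rw [one_mul] at this
    exact this.le
  have hρl : γ.lineIntegral ρ ≤ N * a := by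
    rcases eq_or_ne (N * a) ∞ with h | h
    · rw [h]; exact le_top
    have h0 : (N * a : ℝ≥0∞) ≠ 0 := mul_ne_zero (by exact_mod_cast hN0)
      ((ENNReal.ofReal_pos.2 hs).trans_le le_self_add).ne'
    have h1 : γ.lineIntegral (B.indicator ρ) = γ.lineIntegral ρ :=
      hr.lineIntegral_congr fun x hx => indicator_of_mem (htr hx) _
    rw [hh₁, Curve.lineIntegral_const_mul (ENNReal.inv_ne_top.2 h0), h1, mul_comm,
      ← div_eq_mul_inv] at hlt₁
    have := (ENNReal.div_lt_iff (Or.inl h0) (Or.inl h)).1 hlt₁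
    rw [one_mul] at this
    exact this.le
  calc _ ≤ ENNReal.ofReal (N * C) * a + N * a := by
        refine add_le_add (hlen.trans ?_) hρl
        rw [ENNReal.ofReal_mul (by positivity)]
        exact mul_le_mul_right le_self_add _
    _ = _ := by ring

end

/-! ### Modification of an arc in finitely many balls -/

section

open Metric

variable {n : ℕ} {k : Kind} {E : Set (Eu n)}

theorem exists_first_eq {h : ℝ → ℝ} (hc : Continuous h) {a b c : ℝ} (hab : a ≤ b) (ha : h a ≤ c)
    (hb : c ≤ h b) : ∃ m ∈ Icc a b, h m = c ∧ ∀ t ∈ Icc a m, h t ≤ c := by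
  have hne : (Icc a b ∩ h ⁻¹' {c}).Nonempty := by
    obtain ⟨t, ht, htc⟩ := intermediate_value_Icc hab hc.continuousOn ⟨ha, hb⟩
    exact ⟨t, ht, htc⟩
  obtain ⟨m, ⟨hm, hmc⟩, hmin⟩ :=
    (isCompact_Icc.inter_right (isClosed_singleton.preimage hc)).exists_isLeast hne
  refine ⟨m, hm, hmc, fun t ht => ?_⟩
  by_contra! hlt
  obtain ⟨t', ht', htc⟩ := intermediate_value_Icc ht.1 hc.continuousOn ⟨ha, hlt.le⟩
  have := hmin ⟨⟨ht'.1, ht'.2.trans (ht.2.trans hm.2)⟩, htc⟩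
  have h1 : t = t' := le_antisymm (ht.2.trans this) ht'.2
  rw [h1, htc] at hlt
  exact lt_irrefl _ hlt

theorem exists_last_eq {h : ℝ → ℝ} (hc : Continuous h) {a b c : ℝ} (hab : a ≤ b) (ha : c ≤ h a)
    (hb : h b ≤ c) : ∃ m ∈ Icc a b, h m = c ∧ ∀ t ∈ Icc m b, h t ≤ c := by
  obtain ⟨m, hm, hmc, hmt⟩ := exists_first_eq (h := fun t => h (-t)) (hc.comp continuous_neg)
    (neg_le_neg hab) (by simpa using hb) (by simpa using ha)
  refine ⟨-m, ⟨by linarith [hm.2], by linarith [hm.1]⟩, hmc, fun t ht => ?_⟩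
  simpa using hmt (-t) ⟨by linarith [ht.2], by linarith [ht.1]⟩

/-- A set of paths `𝒜` supplies detours at scale `s` around `z`: it contains a path in `𝓕_*(E)`
between any two disjoint continua in `B(z, R s)` that pass close to the centre and reach the
boundary. -/
def SuppliesDetours (k : Kind) (E : Set (Eu n)) (R s : ℝ) (z : Eu n) (𝒜 : Set (Curve n)) : Prop :=
  ∀ F₁ F₂ : Set (Eu n), IsContinuum F₁ → IsContinuum F₂ → Disjoint F₁ F₂ →
    F₁ ⊆ closedBall z (R * s) → F₂ ⊆ closedBall z (R * s) →
    (∃ p ∈ F₁, dist p z ≤ 2 * s) → (∃ p ∈ F₂, dist p z ≤ 2 * s) →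
    (∃ p ∈ F₁, R * s ≤ dist p z) → (∃ p ∈ F₂, R * s ≤ dist p z) →
    ∃ α ∈ 𝒜, α.start ∈ F₁ ∧ α.finish ∈ F₂ ∧ α ∈ k.family E ∧ α.IsRectifiable

/-- A path that has arrived in `B(z, s)` at the time `τ` is led past this ball for good, by a
detour from its past to its future or by a short cut where these meet. -/
theorem exists_bypass {R s : ℝ} (hR : 2 < R) (hs : 0 < s) {z : Eu n} {𝒜 : Set (Curve n)}
    (h𝒜 : SuppliesDetours k E R s z 𝒜) {L : ℝ≥0} {g : ℝ → Eu n} (hg : LipschitzWith L g)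
    {τ b : ℝ} (hτb : τ ≤ b) (hτ : g τ ∈ ball z s) (hb : R * s ≤ dist (g b) z) {x : Eu n}
    (hx : R * s ≤ dist x z) {K : Set (Eu n)} (hK : IsCompact K) (hj : LipJoined K x (g τ)) :
    ∃ τ' ∈ Icc τ b, (∀ t ∈ Icc τ' b, g t ∉ ball z s) ∧ ∃ K', IsCompact K' ∧
      LipJoined K' x (g τ') ∧ (K' ⊆ K \ {g τ} ∨ ∃ α ∈ 𝒜, α ∈ k.family E ∧
        α.start ∈ K \ {g τ} ∧ α.finish = g τ' ∧ K' ⊆ (K \ {g τ}) ∪ α.trace) := by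
  have hsR : 2 * s < R * s := mul_lt_mul_of_pos_right hR hs
  have hτ' : dist (g τ) z < s := hτ
  have hne : x ≠ g τ := by
    rintro rfl
    linarith
  obtain ⟨M, f, hf, hfK, hf0, hf1, hinj⟩ := hj.exists_injOn hK hne
  have hgc : Continuous fun t => dist (g t) z := hg.continuous.dist continuous_const
  have hfc : Continuous fun t => dist (f t) z := hf.continuous.dist continuous_const
  -- the future continuum
  obtain ⟨σ, ⟨hσ, hσs⟩, hσmax⟩ := (isCompact_Icc.inter_right
    (isClosed_Iic.preimage hgc)).exists_isGreatest
    (⟨τ, left_mem_Icc.2 hτb, hτ'.le⟩ : (Icc τ b ∩ (fun t => dist (g t) z) ⁻¹' Iic s).Nonempty)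
  have hσs' : dist (g σ) z ≤ s := hσs
  have hσb : σ < b := by
    refine lt_of_le_of_ne hσ.2 ?_
    rintro rfl
    linarith
  obtain ⟨σ₁, hσ₁, hσσ₁⟩ : ∃ t, dist (g t) z < 2 * s ∧ t ∈ Ioo σ b :=
    ((hgc.continuousAt.eventually_lt_const
      (show dist (g σ) z < 2 * s by linarith)).filter_mono nhdsWithin_le_nhds).and
      (Ioo_mem_nhdsGT hσb) |>.exists
  obtain ⟨σ₂, hσ₂, hσ₂R, hσ₂le⟩ := exists_first_eq hgc hσσ₁.2.le
    (show dist (g σ₁) z ≤ R * s by linarith) hb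
  -- the past continuum
  obtain ⟨u₁, hu₁s, hu₁⟩ : ∃ t, dist (f t) z < 2 * s ∧ t ∈ Ioo (0 : ℝ) 1 :=
    ((hfc.continuousAt.eventually_lt_const
      (show dist (f 1) z < 2 * s by rw [hf1]; linarith)).filter_mono nhdsWithin_le_nhds).and
      (Ioo_mem_nhdsLT zero_lt_one) |>.exists
  obtain ⟨u₀, hu₀, hu₀R, hu₀le⟩ := exists_last_eq hfc hu₁.1.le
    (show R * s ≤ dist (f 0) z by rwa [hf0]) (show dist (f u₁) z ≤ R * s by linarith)
  have hpast : ∀ u ∈ Icc u₀ u₁, f '' Icc 0 u ⊆ K \ {g τ} := by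
    rintro u hu _ ⟨t, ht, rfl⟩
    refine ⟨hfK t, fun heq => ?_⟩
    rw [mem_singleton_iff, ← hf1] at heq
    have ht1 : t < 1 := (ht.2.trans hu.2).trans_lt hu₁.2
    exact ht1.ne (hinj ⟨ht.1, ht1.le⟩ (right_mem_Icc.2 zero_le_one) heq)
  have hfuture : ∀ v ∈ Icc σ₁ σ₂, v ∈ Icc τ b ∧ ∀ t ∈ Icc v b, g t ∉ ball z s := by
    intro v hv
    have h1 : σ < v := hσσ₁.1.trans_le hv.1
    refine ⟨⟨hσ.1.trans h1.le, hv.2.trans hσ₂.2⟩, fun t ht hts => ?_⟩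
    have h2 : dist (g t) z < s := hts
    have h3 := hσmax ⟨⟨hσ.1.trans (h1.le.trans ht.1), ht.2⟩, h2.le⟩
    exact absurd (h1.trans_le ht.1) (not_lt.2 h3)
  have hjoin : ∀ u ∈ Icc u₀ u₁, LipJoined (f '' Icc 0 u) x (f u) := fun u hu => by
    have := LipschitzWith.lipJoined (hu₀.1.trans hu.1) hf
    rwa [hf0] at this
  by_cases hdisj : Disjoint (f '' Icc u₀ u₁) (g '' Icc σ₁ σ₂)
  · obtain ⟨α, hα, ⟨u, hu, hus⟩, ⟨v, hv, hvf⟩, hαE, hαr⟩ := h𝒜 _ _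
      (isContinuum_image_Icc hf.continuous hu₀.2) (isContinuum_image_Icc hg.continuous hσ₂.1) hdisj
      (by rintro _ ⟨t, ht, rfl⟩; exact hu₀le t ht) (by rintro _ ⟨t, ht, rfl⟩; exact hσ₂le t ht)
      ⟨_, ⟨u₁, right_mem_Icc.2 hu₀.2, rfl⟩, hu₁s.le⟩ ⟨_, ⟨σ₁, left_mem_Icc.2 hσ₂.1, rfl⟩, hσ₁.le⟩
      ⟨_, ⟨u₀, left_mem_Icc.2 hu₀.2, rfl⟩, hu₀R.ge⟩
      ⟨_, ⟨σ₂, right_mem_Icc.2 hσ₂.1, rfl⟩, hσ₂R.ge⟩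
    refine ⟨v, (hfuture v hv).1, (hfuture v hv).2, f '' Icc 0 u ∪ α.trace,
      (isCompact_Icc.image hf.continuous).union α.isCompact_trace, ?_, Or.inr ⟨α, hα, hαE, ?_,
      hvf.symm, union_subset_union_left _ (hpast u hu)⟩⟩
    · refine ((hjoin u hu).mono subset_union_left).trans ?_
      rw [hus, hvf]
      exact hαr.lipJoined.mono subset_union_right
    · rw [← hus]
      exact hpast u hu ⟨u, right_mem_Icc.2 (hu₀.1.trans hu.1), rfl⟩
  · obtain ⟨_, ⟨u, hu, rfl⟩, ⟨v, hv, hvu⟩⟩ := not_disjoint_iff.1 hdisj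
    refine ⟨v, (hfuture v hv).1, (hfuture v hv).2, f '' Icc 0 u, isCompact_Icc.image hf.continuous,
      ?_, Or.inl (hpast u hu)⟩
    rw [hvu]
    exact hjoin u hu

/-- Replacing, one ball after the other, the passages of an arc through a finite cover of its
intersection with `E` by detours. In the induction `V` and `W` are the centres of the balls that
have been dealt with and of the remaining ones, and the arc has been modified up to time `τ`;
the point `g τ` itself may lie in `E`. -/
theorem exists_finite_detours {R s : ℝ} (hR : 2 < R) (hs : 0 < s) (hE : IsClosed E)
    {𝒜 : Eu n → Set (Curve n)} {Z : Finset (Eu n)}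
    (h𝒜 : ∀ z ∈ Z, SuppliesDetours k E R s z (𝒜 z)) {L : ℝ≥0} {g : ℝ → Eu n}
    (hg : LipschitzWith L g) {a b : ℝ} (hab : a ≤ b) (ha : ∀ z ∈ Z, R * s ≤ dist (g a) z)
    (hb : ∀ z ∈ Z, R * s ≤ dist (g b) z)
    (hZ : g '' Icc a b ∩ E ⊆ ⋃ z ∈ Z, ball z s) :
    ∃ (V : Finset (Eu n)) (α : Eu n → Curve n) (K : Set (Eu n)), V ⊆ Z ∧ (∀ z ∈ V, α z ∈ 𝒜 z) ∧
      IsCompact K ∧ LipJoined K (g a) (g b) ∧ k.Good E K ∧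
      K ⊆ (g '' Icc a b \ E) ∪ ⋃ z ∈ V, (α z).trace := by
  classical
  have hne : Nonempty (Curve n) := ⟨Curve.ofFun g hg.continuous hab⟩
  suffices H : ∀ (W V : Finset (Eu n)) (α : Eu n → Curve n) (K : Set (Eu n)) (τ : ℝ),
      τ ∈ Icc a b → W ⊆ Z → V ⊆ Z → Disjoint V W → g '' Icc τ b ∩ E ⊆ (⋃ z ∈ W, ball z s) →
      (∀ z ∈ V, α z ∈ 𝒜 z) → IsCompact K → LipJoined K (g a) (g τ) → k.Good E (K \ {g τ}) →
      K \ {g τ} ⊆ (g '' Icc a b \ E) ∪ (⋃ z ∈ V, (α z).trace) →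
      ∃ (V : Finset (Eu n)) (α : Eu n → Curve n) (K : Set (Eu n)), V ⊆ Z ∧
        (∀ z ∈ V, α z ∈ 𝒜 z) ∧ IsCompact K ∧ LipJoined K (g a) (g b) ∧ k.Good E K ∧
        K ⊆ (g '' Icc a b \ E) ∪ ⋃ z ∈ V, (α z).trace by
    exact H Z ∅ (fun _ => Classical.arbitrary _) {g a} a (left_mem_Icc.2 hab) Subset.rfl
      (Finset.empty_subset _) (Finset.disjoint_empty_left _) hZ (by simp) isCompact_singleton
      (LipJoined.refl rfl) (by simpa using Kind.good_of_disjoint (disjoint_empty E).symm) (by simp)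
  intro W
  induction W using Finset.strongInduction with
  | H W ih =>
  intro V α K τ hτ hWZ hVZ hVW hcov hα hK hj hgood hsub
  by_cases hEne : (Icc τ b ∩ g ⁻¹' E).Nonempty
  · obtain ⟨τ', ⟨hτ', hτ'E⟩, hmin⟩ :=
      (isCompact_Icc.inter_right (hE.preimage hg.continuous)).exists_isLeast hEne
    have hbefore : g '' Ico τ τ' ⊆ g '' Icc a b \ E := by
      rintro _ ⟨t, ht, rfl⟩
      exact ⟨⟨t, ⟨hτ.1.trans ht.1, ht.2.le.trans hτ'.2⟩, rfl⟩, fun htE =>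
        not_le.2 ht.2 (hmin ⟨⟨ht.1, ht.2.le.trans hτ'.2⟩, htE⟩)⟩
    have hK'sub : (K ∪ g '' Icc τ τ') \ {g τ'} ⊆ (K \ {g τ}) ∪ g '' Ico τ τ' := by
      rintro y ⟨hy | ⟨t, ht, rfl⟩, hyτ'⟩
      · by_cases hyτ : y = g τ
        · refine Or.inr ⟨τ, ⟨le_rfl, lt_of_le_of_ne hτ'.1 ?_⟩, hyτ.symm⟩
          rintro rfl
          exact hyτ' hyτ
        · exact Or.inl ⟨hy, hyτ⟩
      · refine Or.inr ⟨t, ⟨ht.1, lt_of_le_of_ne ht.2 ?_⟩, rfl⟩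
        rintro rfl
        exact hyτ' rfl
    obtain ⟨z, hzW, hz⟩ := mem_iUnion₂.1 (hcov ⟨⟨τ', hτ', rfl⟩, hτ'E⟩)
    obtain ⟨τ'', hτ'', hpast, K', hK', hj', hor⟩ := exists_bypass hR hs (h𝒜 z (hWZ hzW)) hg
      hτ'.2 hz (hb z (hWZ hzW)) (ha z (hWZ hzW))
      (hK.union (isCompact_Icc.image hg.continuous))
      ((hj.mono subset_union_left).trans ((LipschitzWith.lipJoined hτ'.1 hg).mono subset_union_right))
    have hgood' : k.Good E ((K ∪ g '' Icc τ τ') \ {g τ'}) :=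
      (hgood.union (Kind.good_of_disjoint (disjoint_sdiff_left.mono_left hbefore))).mono hK'sub
    have hsub' : (K ∪ g '' Icc τ τ') \ {g τ'} ⊆
        (g '' Icc a b \ E) ∪ (⋃ z ∈ V, (α z).trace) :=
      hK'sub.trans (union_subset hsub (hbefore.trans subset_union_left))
    have hτab : τ'' ∈ Icc a b := ⟨hτ.1.trans (hτ'.1.trans hτ''.1), hτ''.2⟩
    have hcov' : g '' Icc τ'' b ∩ E ⊆ ⋃ y ∈ W.erase z, ball y s := by
      rintro _ ⟨⟨t, ht, rfl⟩, htE⟩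
      obtain ⟨w, hwW, hw⟩ := mem_iUnion₂.1
        (hcov ⟨⟨t, ⟨hτ'.1.trans (hτ''.1.trans ht.1), ht.2⟩, rfl⟩, htE⟩)
      refine mem_iUnion₂.2 ⟨w, Finset.mem_erase.2 ⟨?_, hwW⟩, hw⟩
      intro h
      exact hpast t ht (h ▸ hw)
    have hWZ' : W.erase z ⊆ Z := (Finset.erase_subset _ _).trans hWZ
    have hzV : z ∉ V := fun h => Finset.disjoint_left.1 hVW h hzW
    rcases hor with hor | ⟨β, hβ, hβE, hβs, hβf, hor⟩
    · exact ih _ (Finset.erase_ssubset hzW) V α K' τ'' hτab hWZ' hVZ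
        (hVW.mono_right (Finset.erase_subset _ _)) hcov' hα hK' hj'
        (hgood'.mono (sdiff_subset.trans hor)) ((sdiff_subset.trans hor).trans hsub')
    · have hupd : ∀ w ∈ V, Function.update α z β w = α w := fun w hw =>
        Function.update_of_ne (fun h : w = z => hzV (h ▸ hw)) _ _
      refine ih _ (Finset.erase_ssubset hzW) (insert z V) (Function.update α z β) K' τ'' hτab hWZ'
        (Finset.insert_subset (hWZ hzW) hVZ) ?_ hcov' ?_ hK' hj' ?_ ?_
      · exact Finset.disjoint_insert_left.2 ⟨Finset.notMem_erase _ _,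
          hVW.mono_right (Finset.erase_subset _ _)⟩
      · intro w hw
        rcases Finset.mem_insert.1 hw with rfl | hw
        · rwa [Function.update_self]
        · rw [hupd w hw]
          exact hα w hw
      · refine (hgood'.union (mem_family_iff.1 hβE)).mono ?_
        rintro y ⟨hy, hyτ⟩
        rcases hor hy with hy | hy
        · exact Or.inl hy
        · by_cases hyb : y ∈ β.bdry
          · rcases hyb with rfl | hyb
            · exact Or.inl hβs
            · exact absurd (hyb.trans hβf) hyτ
          · exact Or.inr ⟨hy, hyb⟩
      · refine (sdiff_subset.trans hor).trans (union_subset (hsub'.trans ?_) ?_)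
        · refine union_subset_union_right _ (iUnion₂_subset fun w hw => ?_)
          rw [← hupd w hw]
          exact subset_biUnion_of_mem (u := fun w => (Function.update α z β w).trace)
            (Finset.mem_insert_of_mem hw)
        · refine Subset.trans ?_ subset_union_right
          have := subset_biUnion_of_mem (u := fun w => (Function.update α z β w).trace)
            (Finset.mem_insert_self z V)
          rwa [Function.update_self] at this
  · have hafter : g '' Icc τ b ⊆ g '' Icc a b \ E := by
      rintro _ ⟨t, ht, rfl⟩
      exact ⟨⟨t, ⟨hτ.1.trans ht.1, ht.2⟩, rfl⟩, fun htE => hEne ⟨t, ht, htE⟩⟩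
    have hKsub : K ∪ g '' Icc τ b ⊆ (K \ {g τ}) ∪ g '' Icc τ b := by
      rintro y (hy | hy)
      · by_cases hyτ : y = g τ
        · exact Or.inr ⟨τ, left_mem_Icc.2 hτ.2, hyτ.symm⟩
        · exact Or.inl ⟨hy, hyτ⟩
      · exact Or.inr hy
    exact ⟨V, α, K ∪ g '' Icc τ b, hVZ, hα, hK.union (isCompact_Icc.image hg.continuous),
      (hj.mono subset_union_left).trans ((LipschitzWith.lipJoined hτ.2 hg).mono subset_union_right),
      (hgood.union (Kind.good_of_disjoint (disjoint_sdiff_left.mono_left hafter))).mono hKsub,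
      hKsub.trans (union_subset hsub (hafter.trans subset_union_left))⟩

end

/-! ### Covers by small balls -/

section

open Metric

variable {n : ℕ} {k : Kind} {E : Set (Eu n)}

theorem exists_separated_net {K : Set (Eu n)} (hK : IsCompact K) {s : ℝ} (hs : 0 < s) :
    ∃ Z : Finset (Eu n), ↑Z ⊆ K ∧ K ⊆ (⋃ z ∈ Z, ball z s) ∧
      ∀ z ∈ Z, ∀ w ∈ Z, z ≠ w → s / 2 ≤ dist z w := by
  set e : ℝ≥0 := (s / 4).toNNReal with he
  have he0 : (e : ℝ) = s / 4 := Real.coe_toNNReal _ (by positivity)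
  have hne : e ≠ 0 := by
    rw [← NNReal.coe_ne_zero, he0]
    positivity
  have h2e : ((2 * e : ℝ≥0) : ℝ) = s / 2 := by
    push_cast
    rw [he0]
    ring
  obtain ⟨N, -, hN, hcov⟩ := exists_finite_isCover_of_isCompact hne hK
  have htop : packingNumber (2 * e) K ≠ ⊤ :=
    (((packingNumber_two_mul_le_externalCoveringNumber e K).trans
      hcov.externalCoveringNumber_le_encard).trans_lt hN.encard_lt_top).ne
  have hfin : (maximalSeparatedSet (2 * e) K).Finite := by
    rw [← encard_ne_top_iff, encard_maximalSeparatedSet htop]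
    exact htop
  refine ⟨hfin.toFinset, by simpa using maximalSeparatedSet_subset, ?_, ?_⟩
  · refine (isCover_iff_subset_iUnion_closedBall.1 (isCover_maximalSeparatedSet htop)).trans ?_
    refine iUnion₂_subset fun z hz => Subset.trans ?_
      (subset_biUnion_of_mem (u := fun z => ball z s) (hfin.mem_toFinset.2 hz))
    rw [h2e]
    exact closedBall_subset_ball (by linarith)
  · intro z hz w hw hzw
    have : ((2 * e : ℝ≥0) : ℝ≥0∞) < edist z w :=
      isSeparated_maximalSeparatedSet (hfin.mem_toFinset.1 hz) (hfin.mem_toFinset.1 hw) hzw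
    rw [← h2e]
    rw [edist_dist, ← ENNReal.ofReal_coe_nnreal] at this
    exact ((ENNReal.ofReal_lt_ofReal_iff_of_nonneg NNReal.zero_le_coe).1 this).le

/-- The balls of radius `s / 4` around the points are disjoint and contained in
`B(x, (C + 1) s)`. -/
theorem card_le_of_separated {s C : ℝ} (hs : 0 < s) (hC : 0 ≤ C) {x : Eu n} {Z : Finset (Eu n)}
    (hZ : ∀ z ∈ Z, dist x z < C * s) (hsep : ∀ z ∈ Z, ∀ w ∈ Z, z ≠ w → s / 2 ≤ dist z w) :
    (Z.card : ℝ≥0∞) ≤ ENNReal.ofReal ((4 * (C + 1)) ^ n) := by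
  have hdisj : (Z : Set (Eu n)).PairwiseDisjoint fun z => ball z (s / 4) :=
    fun z hz w hw hzw => ball_disjoint_ball (by linarith [hsep z hz w hw hzw])
  have h1 : (Z.card : ℝ≥0∞) * (ENNReal.ofReal ((s / 4) ^ n) * unitBallVolume n) ≤
      ENNReal.ofReal (((C + 1) * s) ^ n) * unitBallVolume n := by
    calc _ = ∑ z ∈ Z, volume (ball z (s / 4)) := by
          rw [Finset.sum_congr rfl fun z _ => volume_ball_eq z (by positivity), Finset.sum_const,
            nsmul_eq_mul]
      _ = volume (⋃ z ∈ Z, ball z (s / 4)) :=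
          (measure_biUnion_finset hdisj fun _ _ => measurableSet_ball).symm
      _ ≤ volume (ball x ((C + 1) * s)) := by
          refine measure_mono (iUnion₂_subset fun z hz => ball_subset_ball' ?_)
          rw [dist_comm]
          linarith [hZ z hz]
      _ = _ := volume_ball_eq _ (by positivity)
  rw [← mul_assoc] at h1
  have h2 := (ENNReal.mul_le_mul_iff_left unitBallVolume_pos.ne' unitBallVolume_lt_top.ne).1 h1
  have h3 : ((C + 1) * s) ^ n = (4 * (C + 1)) ^ n * (s / 4) ^ n := by
    rw [← mul_pow]
    congr 1
    ring
  rw [h3, ENNReal.ofReal_mul (by positivity)] at h2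
  exact (ENNReal.mul_le_mul_iff_left (ENNReal.ofReal_pos.2 (by positivity)).ne'
    ENNReal.ofReal_ne_top).1 h2

theorem sum_pow_le_card_pow_mul {ι : Type*} (T : Finset ι) (b : ι → ℝ≥0∞) (hn : n ≠ 0) :
    (∑ i ∈ T, b i) ^ n ≤ (T.card : ℝ≥0∞) ^ n * ∑ i ∈ T, b i ^ n := by
  rcases T.eq_empty_or_nonempty with rfl | hT
  · simp [hn]
  obtain ⟨m, hm, hmax⟩ := T.exists_max_image b hT
  calc (∑ i ∈ T, b i) ^ n ≤ (T.card * b m) ^ n := by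
        refine pow_le_pow_left₀ zero_le ?_ n
        rw [← nsmul_eq_mul]
        exact Finset.sum_le_card_nsmul T b _ hmax
    _ = (T.card : ℝ≥0∞) ^ n * b m ^ n := mul_pow _ _ _
    _ ≤ _ := mul_le_mul_right (Finset.single_le_sum (f := fun i => b i ^ n)
        (fun _ _ => zero_le) hm) _

/-- The function whose integral along a path bounds the costs of all detours, at the scale `s`
around the points of `Z`, that the path may need. -/
noncomputable def detourDensity (ρ : Eu n → ℝ≥0∞) (C : ℝ) (Z : Finset (Eu n)) (s : ℝ) (x : Eu n) :
    ℝ≥0∞ :=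
  ∑ z ∈ Z, (ball z (2 * s)).indicator (fun _ => detourCost ρ C z s / ENNReal.ofReal s) x

theorem measurable_detourDensity (ρ : Eu n → ℝ≥0∞) (C : ℝ) (Z : Finset (Eu n)) (s : ℝ) :
    Measurable (detourDensity ρ C Z s) :=
  Finset.measurable_sum _ fun _ _ => measurable_const.indicator measurableSet_ball

theorem lintegral_detourDensity (ρ : Eu n → ℝ≥0∞) (C : ℝ) (Z : Finset (Eu n)) (s : ℝ)
    (μ : Measure (Eu n)) : ∫⁻ x, detourDensity ρ C Z s x ∂μ =
      ∑ z ∈ Z, detourCost ρ C z s / ENNReal.ofReal s * μ (ball z (2 * s)) := by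
  unfold detourDensity
  rw [lintegral_finsetSum _ fun _ _ => measurable_const.indicator measurableSet_ball]
  exact Finset.sum_congr rfl fun z _ => lintegral_indicator_const measurableSet_ball _

/-- The `Lⁿ`-norm of one summand of the density is controlled by a mass that does not depend on the
scale except for its domain `B(z, C s)`. -/
theorem detourCost_pow_mul_le (hn : n ≠ 0) (ρ : Eu n → ℝ≥0∞) {C : ℝ} (hC : 1 ≤ C) (z : Eu n)
    {s : ℝ} (hs : 0 < s) :
    (detourCost ρ C z s / ENNReal.ofReal s) ^ n * volume (ball z (2 * s)) ≤
      4 ^ n * (1 + unitBallVolume n) * ∫⁻ x in ball z (C * s), (1 + ρ x ^ n) := by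
  set I := ∫⁻ x in ball z (C * s), ρ x ^ n with hI
  set S := ENNReal.ofReal s with hS
  have hS0 : S ≠ 0 := (ENNReal.ofReal_pos.2 hs).ne'
  have hpow : (I ^ (1 / n : ℝ)) ^ n = I := by
    rw [← ENNReal.rpow_natCast, ← ENNReal.rpow_mul, one_div_mul_cancel (by exact_mod_cast hn),
      ENNReal.rpow_one]
  have h1 : detourCost ρ C z s ^ n ≤ 2 ^ n * (S ^ n + I) := by
    have h2 : detourCost ρ C z s ≤ 2 * max S (I ^ (1 / n : ℝ)) := by
      rw [detourCost, two_mul]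
      exact add_le_add (le_max_left _ _) (le_max_right _ _)
    calc _ ≤ (2 * max S (I ^ (1 / n : ℝ))) ^ n := pow_le_pow_left₀ zero_le h2 n
      _ = 2 ^ n * max S (I ^ (1 / n : ℝ)) ^ n := mul_pow _ _ _
      _ ≤ _ := by
        refine mul_le_mul_right ?_ _
        rcases le_total S (I ^ (1 / n : ℝ)) with h | h
        · rw [max_eq_right h, hpow]; exact le_add_self
        · rw [max_eq_left h]; exact le_self_add
  have h2 : volume (ball z (2 * s)) = 2 ^ n * S ^ n * unitBallVolume n := by
    rw [volume_ball_eq z (by positivity), mul_pow, ENNReal.ofReal_mul (by positivity),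
      ENNReal.ofReal_pow hs.le, ENNReal.ofReal_pow (by norm_num),
      ENNReal.ofReal_ofNat]
  have h3 : S ^ n * unitBallVolume n ≤ volume (ball z (C * s)) := by
    rw [hS, ← ENNReal.ofReal_pow hs.le, ← volume_ball_eq z hs]
    exact measure_mono (ball_subset_ball (by nlinarith))
  have h4 : ∫⁻ x in ball z (C * s), (1 + ρ x ^ n) = volume (ball z (C * s)) + I := by
    rw [lintegral_add_left measurable_const, lintegral_const, Measure.restrict_apply_univ, one_mul]
  rw [h4, h2, ENNReal.div_eq_inv_mul, mul_pow]
  calc S⁻¹ ^ n * detourCost ρ C z s ^ n * (2 ^ n * S ^ n * unitBallVolume n)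
      = (S⁻¹ * S) ^ n * detourCost ρ C z s ^ n * 2 ^ n * unitBallVolume n := by
        rw [mul_pow]; ring
    _ = detourCost ρ C z s ^ n * 2 ^ n * unitBallVolume n := by
        rw [ENNReal.inv_mul_cancel hS0 ENNReal.ofReal_ne_top, one_pow, one_mul]
    _ ≤ 2 ^ n * (S ^ n + I) * 2 ^ n * unitBallVolume n := by gcongr
    _ = 4 ^ n * (S ^ n * unitBallVolume n + unitBallVolume n * I) := by
        rw [show (4 : ℝ≥0∞) = 2 * 2 by norm_num, mul_pow]; ring
    _ ≤ 4 ^ n * ((1 + unitBallVolume n) * volume (ball z (C * s)) +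
          (1 + unitBallVolume n) * I) := by
        refine mul_le_mul_right (add_le_add (h3.trans ?_) (mul_le_mul_left le_add_self _)) _
        exact le_mul_of_one_le_left zero_le le_self_add
    _ = _ := by ring

/-- Covers of a compact null set by balls of a small radius `s` that overlap boundedly: the
`Lⁿ`-norm of the density is controlled by an integral over a small neighbourhood of the set. -/
theorem exists_cover_detourDensity_le (hn : n ≠ 0) {K : Set (Eu n)} (hK : IsCompact K)
    (hK0 : volume K = 0) {ρ : Eu n → ℝ≥0∞} (hρ : IsBorelLnLoc ρ) {C : ℝ} (hC : 2 ≤ C) {r : ℝ}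
    (hr : 0 < r) {ε : ℝ≥0∞} (hε : 0 < ε) :
    ∃ s ∈ Ioo 0 r, ∃ Z : Finset (Eu n), ↑Z ⊆ K ∧ K ⊆ (⋃ z ∈ Z, ball z s) ∧
      ∫⁻ x, detourDensity ρ C Z s x ^ n ≤ ε := by
  set N : ℝ≥0∞ := ENNReal.ofReal ((4 * (C + 1)) ^ n) with hN
  set Q : ℝ≥0∞ := N ^ n * (4 ^ n * (1 + unitBallVolume n)) * N with hQ
  have hQt : Q ≠ ∞ := by
    have := unitBallVolume_lt_top (n := n)
    finiteness
  have hw : Measurable fun x => 1 + ρ x ^ n := (hρ.1.pow_const n).const_add 1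
  set μ : Measure (Eu n) := volume.withDensity fun x => 1 + ρ x ^ n with hμ
  have hlim : Tendsto (fun s : ℝ => Q * μ (cthickening (C * s) K)) (𝓝[>] 0) (𝓝 0) := by
    have h1 : Tendsto (fun e : ℝ => μ (cthickening e K)) (𝓝 0) (𝓝 (μ (closure K))) := by
      refine tendsto_measure_cthickening ⟨1, one_pos, ?_⟩
      have hc : IsCompact (cthickening 1 K) := hK.cthickening
      rw [hμ, withDensity_apply _ hc.measurableSet, lintegral_add_left measurable_const]
      refine ENNReal.add_ne_top.2 ⟨?_, (hρ.2 _ hc).ne⟩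
      simpa using hc.measure_lt_top.ne
    have h2 : μ (closure K) = 0 := by
      rw [hK.isClosed.closure_eq]
      exact withDensity_absolutelyContinuous _ _ hK0
    rw [h2] at h1
    have h3 : Tendsto (fun s : ℝ => C * s) (𝓝[>] 0) (𝓝 0) := by
      have : Tendsto (fun s : ℝ => C * s) (𝓝 0) (𝓝 (C * 0)) := tendsto_const_nhds.mul tendsto_id
      rw [mul_zero] at this
      exact this.mono_left nhdsWithin_le_nhds
    have := ENNReal.Tendsto.const_mul (h1.comp h3) (Or.inr hQt)
    rwa [mul_zero] at this
  obtain ⟨s, hsε, hs⟩ := ((hlim.eventually_lt_const hε).and (Ioo_mem_nhdsGT hr)).exists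
  obtain ⟨Z, hZK, hcov, hsep⟩ := exists_separated_net hK hs.1
  refine ⟨s, hs, Z, hZK, hcov, le_trans ?_ hsε.le⟩
  classical
  have hcard : ∀ x, ((Z.filter fun z => dist x z < C * s).card : ℝ≥0∞) ≤ N := fun x =>
    card_le_of_separated hs.1 (by linarith) (fun z hz => (Finset.mem_filter.1 hz).2)
      fun z hz w hw => hsep z (Finset.mem_filter.1 hz).1 w (Finset.mem_filter.1 hw).1
  set b : Eu n → ℝ≥0∞ := fun z => detourCost ρ C z s / ENNReal.ofReal s with hb
  have hpt : ∀ x, detourDensity ρ C Z s x ^ n ≤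
      N ^ n * ∑ z ∈ Z, (ball z (2 * s)).indicator (fun _ => b z ^ n) x := by
    intro x
    have hsum : ∀ f : Eu n → ℝ≥0∞, ∑ z ∈ Z, (ball z (2 * s)).indicator (fun _ => f z) x =
        ∑ z ∈ Z.filter (fun z => dist x z < 2 * s), f z := fun f => by
      rw [Finset.sum_filter]
      exact Finset.sum_congr rfl fun z _ => rfl
    rw [detourDensity, hsum, hsum]
    refine (sum_pow_le_card_pow_mul _ _ hn).trans (mul_le_mul_left (pow_le_pow_left₀ zero_le ?_ n) _)
    refine le_trans (Nat.cast_le.2 (Finset.card_le_card fun z hz => ?_)) (hcard x)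
    rw [Finset.mem_filter] at hz ⊢
    exact ⟨hz.1, hz.2.trans_le (by nlinarith [hs.1])⟩
  calc ∫⁻ x, detourDensity ρ C Z s x ^ n
      ≤ ∫⁻ x, N ^ n * ∑ z ∈ Z, (ball z (2 * s)).indicator (fun _ => b z ^ n) x :=
        lintegral_mono hpt
    _ = N ^ n * ∑ z ∈ Z, b z ^ n * volume (ball z (2 * s)) := by
        rw [lintegral_const_mul' _ _ (by finiteness),
          lintegral_finsetSum _ fun _ _ => measurable_const.indicator measurableSet_ball]
        congr 1
        exact Finset.sum_congr rfl fun z _ => lintegral_indicator_const measurableSet_ball _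
    _ ≤ N ^ n * ∑ z ∈ Z, 4 ^ n * (1 + unitBallVolume n) * μ (ball z (C * s)) := by
        refine mul_le_mul_right (Finset.sum_le_sum fun z _ => ?_) _
        rw [hμ, withDensity_apply _ measurableSet_ball]
        exact detourCost_pow_mul_le hn ρ (by linarith) z hs.1
    _ = N ^ n * (4 ^ n * (1 + unitBallVolume n)) * ∑ z ∈ Z, μ (ball z (C * s)) := by
        rw [← Finset.mul_sum, ← mul_assoc]
    _ ≤ N ^ n * (4 ^ n * (1 + unitBallVolume n)) * (N * μ (cthickening (C * s) K)) := by
        refine mul_le_mul_right ?_ _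
        calc _ = ∫⁻ x, ∑ z ∈ Z, (ball z (C * s)).indicator (fun _ => (1 : ℝ≥0∞)) x ∂μ := by
              rw [lintegral_finsetSum _ fun _ _ => measurable_const.indicator measurableSet_ball]
              refine Finset.sum_congr rfl fun z _ => ?_
              rw [lintegral_indicator_const measurableSet_ball, one_mul]
          _ ≤ ∫⁻ x, (cthickening (C * s) K).indicator (fun _ => N) x ∂μ := by
              refine lintegral_mono fun x => ?_
              have h1 : ∑ z ∈ Z, (ball z (C * s)).indicator (fun _ => (1 : ℝ≥0∞)) x =
                  ((Z.filter fun z => dist x z < C * s).card : ℝ≥0∞) := by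
                rw [Finset.card_filter, Nat.cast_sum]
                refine Finset.sum_congr rfl fun z _ => ?_
                by_cases h : dist x z < C * s <;> simp [h]
              dsimp only
              by_cases hx : x ∈ cthickening (C * s) K
              · rw [indicator_of_mem hx, h1]
                exact hcard x
              · rw [indicator_of_notMem hx]
                refine (Finset.sum_eq_zero fun z hz => indicator_of_notMem (fun hxz => hx ?_) _).le
                exact thickening_subset_cthickening _ _ (mem_thickening_iff.2 ⟨z, hZK hz, hxz⟩)
          _ = _ := lintegral_indicator_const isClosed_cthickening.measurableSet _
    _ = _ := by rw [hQ]; ring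

end

/-! ### Detours along almost every path -/

section

open Metric

variable {n : ℕ} {k : Kind} {E : Set (Eu n)}

/-- The local Loewner bound applies to continua in `B(z, R s)` that come close to `z` and reach the
boundary, since their relative distance is at most `4 / (R - 2) = t`. -/
theorem LocalLoewnerBound.exists_suppliesDetours (hn : 2 ≤ n) (h : LocalLoewnerBound k E) :
    ∃ (R C : ℝ) (A : ℝ≥0∞), 2 < R ∧ R ≤ C ∧ A ≠ ∞ ∧ ∀ M : ℝ, ∃ r > 0,
      ∀ z ∈ closedBall (0 : Eu n) M, ∀ s : ℝ, 0 < s → s < r → ∀ ρ : Eu n → ℝ≥0∞, Measurable ρ →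
        ∀ Γ' : Set (Curve n), modulus Γ' = 0 → SuppliesDetours k E R s z
          {α | α ∉ Γ' ∧ α.trace ⊆ ball z (C * s) ∧
            α.length + α.lineIntegral ρ ≤ A * detourCost ρ C z s} := by
  obtain ⟨t, φ, ht, hφ, hL⟩ := h
  choose r₀ hr₀ hF using hL
  set R : ℝ := 2 + 4 / t with hR
  have hR2 : 2 < R := lt_add_of_pos_right _ (by positivity)
  have hR0 : 0 < R := by linarith
  obtain ⟨C, A, hRC, hA, hdet⟩ :=
    exists_detour_constants hn (ENNReal.ofReal φ) (ENNReal.ofReal_pos.2 hφ) hR0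
  refine ⟨R, C, A, hR2, hRC, hA, fun M => ?_⟩
  obtain ⟨r, hr, hleb⟩ := lebesgue_number_lemma_of_metric (isCompact_closedBall (0 : Eu n) M)
    (fun x : Eu n => isOpen_ball (x := x) (ε := r₀ x))
    fun x _ => mem_iUnion.2 ⟨x, mem_ball_self (hr₀ x)⟩
  refine ⟨r / R, by positivity, fun z hz s hs hsr ρ hρ Γ' hΓ' F₁ F₂ h₁ h₂ hd hs₁ hs₂ hp₁ hp₂ hq₁
    hq₂ => ?_⟩
  obtain ⟨x₀, hx₀⟩ := hleb z hz
  have hsr' : R * s < r := by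
    rw [lt_div_iff₀ hR0] at hsr
    linarith
  have hball : closedBall z (R * s) ⊆ ball x₀ (r₀ x₀) := (closedBall_subset_ball hsr').trans hx₀
  have hm : 0 < (R - 2) * s := mul_pos (by linarith) hs
  have hdiam : ∀ F : Set (Eu n), IsContinuum F → (∃ p ∈ F, dist p z ≤ 2 * s) →
      (∃ p ∈ F, R * s ≤ dist p z) → (R - 2) * s ≤ diam F := by
    rintro F hF ⟨p, hp, hpz⟩ ⟨q, hq, hqz⟩
    have h1 := dist_le_diam_of_mem hF.1.isBounded hq hp
    have h2 := dist_triangle q p z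
    linarith
  have hnt : ∀ F : Set (Eu n), (R - 2) * s ≤ diam F → F.Nontrivial := fun F hF => by
    by_contra hns
    rw [Set.not_nontrivial_iff] at hns
    rw [diam_subsingleton hns] at hF
    linarith
  have hd₁ := hdiam F₁ h₁ hp₁ hq₁
  have hd₂ := hdiam F₂ h₂ hp₂ hq₂
  obtain ⟨p, hp, hpz⟩ := hp₁
  obtain ⟨q, hq, hqz⟩ := hp₂
  have hrel : relDist F₁ F₂ ≤ t := by
    refine (relDist_le hp hq hm hd₁ hd₂ (a := 4 * s) ?_).trans_eq ?_
    · have := dist_triangle_right p q z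
      linarith
    · rw [hR]
      field_simp
      ring
  have hmod := hF x₀ F₁ F₂ h₁ h₂ (hnt _ hd₁) (hnt _ hd₂) hd (hs₁.trans hball) (hs₂.trans hball) hrel
  obtain ⟨α, hα, hαΓ, hαr, hαt, hαc⟩ := hdet _ z s hs (fun α hα => hs₁ hα.1.1) hmod ρ hρ Γ' hΓ'
  exact ⟨α, ⟨hαΓ, hαt, hαc⟩, hα.1.1, hα.1.2.1, hα.2, hαr⟩

open Classical in
/-- The total cost of the detours around those points of `Z` that are close to the set `T`. -/
noncomputable def totalDetourCost (ρ : Eu n → ℝ≥0∞) (C : ℝ) (Z : Finset (Eu n)) (s : ℝ)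
    (T : Set (Eu n)) : ℝ≥0∞ :=
  ∑ z ∈ Z with (ball z s ∩ T).Nonempty, detourCost ρ C z s

theorem sum_le_totalDetourCost (ρ : Eu n → ℝ≥0∞) (C : ℝ) {Z V : Finset (Eu n)} (s : ℝ)
    {T : Set (Eu n)} (hVZ : V ⊆ Z) (hV : ∀ z ∈ V, (ball z s ∩ T).Nonempty) :
    ∑ z ∈ V, detourCost ρ C z s ≤ totalDetourCost ρ C Z s T := by
  classical
  exact Finset.sum_le_sum_of_subset fun z hz => Finset.mem_filter.2 ⟨hVZ hz, hV z hz⟩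

theorem totalDetourCost_le_sum (ρ : Eu n → ℝ≥0∞) (C : ℝ) (Z : Finset (Eu n)) (s : ℝ)
    {T : Set (Eu n)} {J : Finset (Curve n)} (hT : T ⊆ ⋃ η ∈ J, η.trace) :
    totalDetourCost ρ C Z s T ≤ ∑ η ∈ J, totalDetourCost ρ C Z s η.trace := by
  classical
  simp only [totalDetourCost, Finset.sum_filter]
  rw [Finset.sum_comm]
  refine Finset.sum_le_sum fun z _ => ?_
  split_ifs with h
  · obtain ⟨x, hxz, hxT⟩ := h
    obtain ⟨η, hη, hxη⟩ := mem_iUnion₂.1 (hT hxT)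
    refine le_trans (le_of_eq ?_) (Finset.single_le_sum (f := fun η : Curve n =>
      if (ball z s ∩ η.trace).Nonempty then detourCost ρ C z s else 0) (fun _ _ => zero_le) hη)
    exact (if_pos ⟨x, hxz, hxη⟩).symm
  · exact zero_le

/-- A connected set that is large compared with `s` and meets `B(z, s)` has `ℋ¹`-measure at least
`s` in `B(z, 2 s)`. -/
theorem totalDetourCost_le_lintegral (ρ : Eu n → ℝ≥0∞) (C : ℝ) (Z : Finset (Eu n)) {s : ℝ}
    (hs : 0 < s) {T : Set (Eu n)} (hT : IsPreconnected T) {x y : Eu n} (hx : x ∈ T) (hy : y ∈ T)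
    (hxy : 4 * s ≤ dist x y) :
    totalDetourCost ρ C Z s T ≤ ∫⁻ x in T, detourDensity ρ C Z s x ∂μH[1] := by
  classical
  have hS0 : ENNReal.ofReal s ≠ 0 := (ENNReal.ofReal_pos.2 hs).ne'
  rw [lintegral_detourDensity, totalDetourCost]
  refine (Finset.sum_le_sum fun z hz => ?_).trans
    (Finset.sum_le_sum_of_subset (Finset.filter_subset _ _))
  obtain ⟨p, hpz, hpT⟩ := (Finset.mem_filter.1 hz).2
  obtain ⟨q, hq, hqz⟩ : ∃ q ∈ T, 2 * s ≤ dist q z := by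
    by_contra! hcon
    have h1 := hcon x hx
    have h2 := hcon y hy
    have := dist_triangle_right x y z
    linarith
  have h3 := le_hausdorff_shell hT hpT hq (le_of_lt (show dist p z < s from hpz)) hqz
  rw [show 2 * s - s = s by ring] at h3
  calc detourCost ρ C z s = detourCost ρ C z s / ENNReal.ofReal s * ENNReal.ofReal s :=
        (ENNReal.div_mul_cancel hS0 ENNReal.ofReal_ne_top).symm
    _ ≤ _ := by
        refine mul_le_mul_right ?_ _
        rw [Measure.restrict_apply measurableSet_ball]
        exact h3.trans (measure_mono fun w hw => ⟨hw.2.2, hw.1⟩)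

/-- Covers of a closed null set at scales tending to zero such that the total cost of the detours
along almost every path tends to zero. -/
theorem exists_covers (hn : n ≠ 0) (hE : IsClosed E) (hE0 : volume E = 0) {ρ : Eu n → ℝ≥0∞}
    (hρ : IsBorelLnLoc ρ) {C : ℝ} (hC : 2 ≤ C) {r : ℕ → ℝ} (hr : ∀ j, 0 < r j)
    (hr0 : Tendsto r atTop (𝓝 0)) :
    ∃ (s : ℕ → ℝ) (Z : ℕ → Finset (Eu n)), (∀ j, s j ∈ Ioo 0 (r j)) ∧
      (∀ j : ℕ, ↑(Z j) ⊆ E ∩ closedBall 0 j ∧ E ∩ closedBall 0 j ⊆ ⋃ z ∈ Z j, ball z (s j)) ∧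
      modulus {γ : Curve n | γ.trace.Nontrivial ∧
        ¬ Tendsto (fun j => totalDetourCost ρ C (Z j) (s j) γ.trace) atTop (𝓝 0)} = 0 := by
  obtain ⟨e, he, hesum⟩ := ENNReal.exists_pos_sum_of_countable' one_ne_zero ℕ
  -- weights that tend to infinity: a path whose costs do not tend to zero has infinite integral
  set w : ℕ → ℝ≥0∞ := fun j => (j : ℝ≥0∞) + 1 with hw
  have hwt : ∀ j, w j ≠ ∞ := fun j => by simp [hw]
  have hw0 : ∀ j, w j ≠ 0 := fun j => by simp [hw]
  have hstep : ∀ j : ℕ, ∃ s ∈ Ioo 0 (r j), ∃ Z : Finset (Eu n), ↑Z ⊆ E ∩ closedBall 0 j ∧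
      E ∩ closedBall 0 j ⊆ (⋃ z ∈ Z, ball z s) ∧
      ∫⁻ x, detourDensity ρ C Z s x ^ n ≤ (w j ^ n)⁻¹ * e j := fun j =>
    exists_cover_detourDensity_le hn ((isCompact_closedBall _ _).inter_left hE)
      (measure_mono_null inter_subset_left hE0) hρ hC (hr j)
      (ENNReal.mul_pos (ENNReal.inv_ne_zero.2 (ENNReal.pow_ne_top (hwt j))) (he j).ne')
  choose s hs Z hZ hcov hint using hstep
  have hs0 : Tendsto s atTop (𝓝 0) :=
    squeeze_zero (fun j => (hs j).1.le) (fun j => (hs j).2.le) hr0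
  refine ⟨s, Z, hs, fun j => ⟨hZ j, hcov j⟩, ?_⟩
  set g : ℕ → Eu n → ℝ≥0∞ := fun j => detourDensity ρ C (Z j) (s j) with hg
  have hgm : ∀ j, Measurable (g j) := fun j => measurable_detourDensity _ _ _ _
  set G : Eu n → ℝ≥0∞ := fun x => (∑' j, (w j * g j x) ^ n) ^ (1 / n : ℝ) with hG
  have hterm : ∀ j, Measurable fun x => (w j * g j x) ^ n := fun j =>
    ((hgm j).const_mul _).pow_const n
  have hGm : Measurable G := (Measurable.tsum hterm).pow_const _
  have hn' : (n : ℝ) ≠ 0 := by exact_mod_cast hn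
  have hGn : ∀ x, G x ^ n = ∑' j, (w j * g j x) ^ n := fun x => by
    rw [hG]
    dsimp only
    rw [← ENNReal.rpow_natCast, ← ENNReal.rpow_mul, one_div_mul_cancel hn', ENNReal.rpow_one]
  have hle : ∀ j x, w j * g j x ≤ G x := fun j x => by
    have h1 : (w j * g j x) ^ n ≤ ∑' j, (w j * g j x) ^ n := ENNReal.le_tsum j
    rw [← hGn x] at h1
    exact (ENNReal.pow_le_pow_left_iff hn).1 h1
  refine modulus_eq_zero hn hGm ?_ ?_
  · simp_rw [hGn]
    rw [lintegral_tsum fun j => (hterm j).aemeasurable]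
    refine ((ENNReal.tsum_le_tsum fun j => ?_).trans_lt (hesum.trans ENNReal.one_lt_top)).ne
    simp_rw [mul_pow]
    rw [lintegral_const_mul' _ _ (ENNReal.pow_ne_top (hwt j))]
    refine (mul_le_mul_right (hint j) _).trans_eq ?_
    rw [← mul_assoc, ENNReal.mul_inv_cancel (pow_ne_zero n (hw0 j)) (ENNReal.pow_ne_top (hwt j)),
      one_mul]
  · rintro γ ⟨⟨x, hx, y, hy, hxy⟩, hbad⟩ hγ
    rw [ENNReal.tendsto_nhds_zero] at hbad
    push Not at hbad
    obtain ⟨ε, hε, hfreq⟩ := hbad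
    by_contra htop
    obtain ⟨N, hN⟩ := ENNReal.exists_nat_gt (ENNReal.div_ne_top htop hε.ne')
    have hev : ∀ᶠ j in atTop, s j < dist x y / 4 :=
      hs0.eventually_lt_const (by have := dist_pos.2 hxy; positivity)
    obtain ⟨j, hj, hjs, hjN⟩ := (hfreq.and_eventually (hev.and (eventually_ge_atTop N))).exists
    have h1 := totalDetourCost_le_lintegral ρ C (Z j) (hs j).1 γ.isPreconnected_trace hx hy
      (by linarith)
    have h2 : w j * ε ≤ γ.lineIntegral G :=
      calc w j * ε ≤ w j * ∫⁻ x in γ.trace, g j x ∂μH[1] := mul_le_mul_right (hj.le.trans h1) _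
        _ ≤ w j * γ.lineIntegral (g j) := mul_le_mul_right (hγ.lintegral_trace_le (hgm j)) _
        _ = γ.lineIntegral fun x => w j * g j x := (Curve.lineIntegral_const_mul (hwt j)).symm
        _ ≤ _ := Curve.lineIntegral_mono (hle j)
    have h3 : (N : ℝ≥0∞) * ε ≤ γ.lineIntegral G :=
      le_trans (mul_le_mul_left ((Nat.cast_le.2 hjN).trans le_self_add) _) h2
    exact absurd (ENNReal.le_div_iff_mul_le (Or.inl hε.ne') (Or.inr htop) |>.2 h3) (not_le.2 hN)

/-- Lipschitz arcs in `T` with endpoints outside `E` can be modified by finitely many detours of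
small total length and `ρ`-length in any neighbourhood of their intersection with `E`. -/
def ArcModifiable (k : Kind) (E : Set (Eu n)) (ρ : Eu n → ℝ≥0∞) (T : Set (Eu n)) : Prop :=
  ∀ (L : ℝ≥0) (g : ℝ → Eu n) (a b : ℝ), LipschitzWith L g → a ≤ b → g '' Icc a b ⊆ T →
    g a ∉ E → g b ∉ E → ∀ U : Set (Eu n), IsOpen U → g '' Icc a b ∩ E ⊆ U →
    ∀ ε : ℝ≥0∞, 0 < ε → ∀ Γ' : Set (Curve n), modulus Γ' = 0 →
    ∃ (V : Finset (Eu n)) (α : Eu n → Curve n) (K : Set (Eu n)), IsCompact K ∧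
      LipJoined K (g a) (g b) ∧ k.Good E K ∧ K ⊆ (g '' Icc a b \ E) ∪ (⋃ z ∈ V, (α z).trace) ∧
      (∀ z ∈ V, (α z).trace ⊆ U ∧ α z ∉ Γ') ∧
      ∑ z ∈ V, ((α z).length + (α z).lineIntegral ρ) ≤ ε

/-- The traces of constant paths do not contribute to a cover of a nontrivial connected set by
finitely many traces: by connectedness, points of it have no neighbourhoods of zero
`ℋ¹`-measure. -/
theorem subset_iUnion_nontrivial {T : Set (Eu n)} (hT : IsPreconnected T) (hnt : T.Nontrivial)
    {J : Set (Curve n)} (hJ : J.Finite) (hTJ : T ⊆ ⋃ η ∈ J, η.trace) :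
    T ⊆ ⋃ η ∈ {η ∈ J | η.trace.Nontrivial}, η.trace := by
  set S : Set (Eu n) := ⋃ η ∈ {η ∈ J | η.trace.Nontrivial}, η.trace with hS
  have hSc : IsClosed S :=
    (hJ.subset (sep_subset _ _)).isClosed_biUnion fun η _ => η.isCompact_trace.isClosed
  have hrest : (T \ S).Countable := by
    have : (⋃ η ∈ {η ∈ J | ¬ η.trace.Nontrivial}, η.trace).Finite :=
      (hJ.subset (sep_subset _ _)).biUnion fun η hη => (not_nontrivial_iff.1 hη.2).finite
    refine (this.subset fun x hx => ?_).countable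
    obtain ⟨η, hη, hxη⟩ := mem_iUnion₂.1 (hTJ hx.1)
    refine mem_iUnion₂.2 ⟨η, ⟨hη, fun h => hx.2 ?_⟩, hxη⟩
    exact mem_iUnion₂.2 ⟨η, ⟨hη, h⟩, hxη⟩
  intro x hx
  by_contra hxS
  obtain ⟨y, hy, hyx⟩ := hnt.exists_ne x
  obtain ⟨e, he, heS⟩ := Metric.isOpen_iff.1 hSc.isOpen_compl x hxS
  have h1 := le_hausdorff_shell hT (c := x) (a := 0) (b := min e (dist y x)) hx hy
    (by simp) (min_le_right _ _)
  have h2 : μH[1] (T \ S) = 0 := hrest.measure_zero _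
  have h3 : T ∩ {z | 0 ≤ dist z x ∧ dist z x < min e (dist y x)} ⊆ T \ S := fun z hz =>
    ⟨hz.1, heS (mem_ball.2 (hz.2.2.trans_le (min_le_left _ _)))⟩
  have h4 := h1.trans ((measure_mono h3).trans_eq h2)
  rw [sub_zero, nonpos_iff_eq_zero, ENNReal.ofReal_eq_zero] at h4
  exact absurd h4 (not_le.2 (lt_min he (dist_pos.2 hyx)))

/-- If `E` is a closed null set for which the local Loewner bound holds, then all arcs in the trace
of almost every path can be modified. The exceptional paths are those that meet `E` in positive
`ℋ¹`-measure or along which the costs of detours do not tend to zero with the scale. -/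
theorem LocalLoewnerBound.exists_arcModifiable (hn : 2 ≤ n) (hE : IsClosed E)
    (h : LocalLoewnerBound k E) {ρ : Eu n → ℝ≥0∞} (hρ : IsBorelLnLoc ρ) :
    ∃ Γ₀ : Set (Curve n), modulus Γ₀ = 0 ∧
      (∀ γ ∉ Γ₀, γ.trace.Nontrivial → μH[1] (γ.trace ∩ E) = 0 ∧ ArcModifiable k E ρ γ.trace) ∧
      ∀ (J : Set (Curve n)) (γ : Curve n), J.Finite → (∀ η ∈ J, η ∉ Γ₀) →
        γ.trace ⊆ ⋃ η ∈ J, η.trace → γ ∉ Γ₀ := by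
  have hn0 : n ≠ 0 := by omega
  have hE0 := h.volume_eq_zero hn0 hE
  obtain ⟨R, C, A, hR, hRC, hA, hdet⟩ := h.exists_suppliesDetours hn
  choose r hr hdet using fun j : ℕ => hdet j
  set r' : ℕ → ℝ := fun j => min (r j) (1 / ((j : ℝ) + 1)) with hr'
  have hr'0 : ∀ j, 0 < r' j := fun j => lt_min (hr j) (by positivity)
  have hr'lim : Tendsto r' atTop (𝓝 0) :=
    squeeze_zero (fun j => (hr'0 j).le) (fun j => min_le_right _ _)
      tendsto_one_div_add_atTop_nhds_zero_nat
  obtain ⟨s, Z, hs, hZ, hmod⟩ := exists_covers hn0 hE hE0 hρ (by linarith) hr'0 hr'lim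
  have hs0 : Tendsto s atTop (𝓝 0) :=
    squeeze_zero (fun j => (hs j).1.le) (fun j => (hs j).2.le) hr'lim
  refine ⟨{γ | γ.trace.Nontrivial ∧ (μH[1] (γ.trace ∩ E) ≠ 0 ∨
    ¬ Tendsto (fun j => totalDetourCost ρ C (Z j) (s j) γ.trace) atTop (𝓝 0))}, ?_, ?_, ?_⟩
  · refine nonpos_iff_eq_zero.1 ((modulus_mono ?_).trans_eq
      (modulus_union_eq_zero (modulus_of_volume_eq_zero hn0 hE0) hmod))
    rintro γ ⟨hnt, hγ | hγ⟩
    exacts [Or.inl hγ, Or.inr ⟨hnt, hγ⟩]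
  · intro γ hγ hnt
    have hγ' : μH[1] (γ.trace ∩ E) = 0 ∧
        Tendsto (fun j => totalDetourCost ρ C (Z j) (s j) γ.trace) atTop (𝓝 0) := by
      by_contra hcon
      exact hγ ⟨hnt, not_and_or.1 hcon⟩
    refine ⟨hγ'.1, ?_⟩
    intro L g a b hg hab hgT haE hbE U hU hgU ε hε Γ' hΓ'
    set B := g '' Icc a b ∩ E with hB
    have hBc : IsCompact B := (isCompact_Icc.image hg.continuous).inter_right hE
    obtain ⟨d, hd, hdU⟩ := hBc.exists_thickening_subset_open hU hgU
    obtain ⟨ea, hea, haE'⟩ := Metric.isOpen_iff.1 hE.isOpen_compl (g a) haE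
    obtain ⟨eb, heb, hbE'⟩ := Metric.isOpen_iff.1 hE.isOpen_compl (g b) hbE
    obtain ⟨M, hM⟩ := γ.isCompact_trace.isBounded.subset_closedBall 0
    have hlim : ∀ c : ℝ, Tendsto (fun j => c * s j) atTop (𝓝 0) := fun c => by
      have := hs0.const_mul c
      rwa [mul_zero] at this
    have hcost : Tendsto (fun j => A * totalDetourCost ρ C (Z j) (s j) γ.trace) atTop (𝓝 0) := by
      have := ENNReal.Tendsto.const_mul hγ'.2 (Or.inr hA)
      rwa [mul_zero] at this
    obtain ⟨j, hjd, hja, hjb, hjε, hjM⟩ := ((hlim (C + 1)).eventually_lt_const hd |>.and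
      (((hlim R).eventually_lt_const hea).and (((hlim R).eventually_lt_const heb).and
      ((hcost.eventually_lt_const hε).and (eventually_ge_atTop ⌈M⌉₊))))).exists
    have hTj : γ.trace ⊆ closedBall 0 (j : ℝ) :=
      hM.trans (closedBall_subset_closedBall (Nat.ceil_le.1 hjM))
    have hsr : s j < r j := (hs j).2.trans_le (min_le_left _ _)
    classical
    set Z' := (Z j).filter fun z => (ball z (s j) ∩ B).Nonempty with hZ'
    have hZ'Z : Z' ⊆ Z j := Finset.filter_subset _ _
    have hfar : ∀ x e, ball x e ⊆ Eᶜ → R * s j < e → ∀ z ∈ Z', R * s j ≤ dist x z := by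
      intro x e hxe he z hz
      by_contra! hlt
      refine hxe (mem_ball'.2 (hlt.trans he)) ((hZ j).1 (hZ'Z hz)).1
    obtain ⟨V, α, K, hV, hα, hK, hj, hgood, hsub⟩ := exists_finite_detours (k := k) hR (hs j).1 hE
      (fun z hz => hdet j z ((hZ j).1 (hZ'Z hz)).2 (s j) (hs j).1 hsr ρ hρ.1 Γ' hΓ') hg hab
      (hfar _ _ haE' hja) (hfar _ _ hbE' hjb) (by
        intro x hx
        obtain ⟨z, hz, hxz⟩ := mem_iUnion₂.1 ((hZ j).2 ⟨hx.2, hTj (hgT hx.1)⟩)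
        exact mem_iUnion₂.2 ⟨z, Finset.mem_filter.2 ⟨hz, x, hxz, hx⟩, hxz⟩)
    refine ⟨V, α, K, hK, hj, hgood, hsub, fun z hz => ⟨?_, (hα z hz).1⟩, ?_⟩
    · refine (hα z hz).2.1.trans (Subset.trans (fun y hy => ?_) hdU)
      obtain ⟨x, hxz, hxB⟩ := (Finset.mem_filter.1 (hV hz)).2
      refine mem_thickening_iff.2 ⟨x, hxB, ?_⟩
      have h1 := dist_triangle_right y x z
      have h2 : dist y z < C * s j := hy
      have h3 : dist x z < s j := hxz
      linarith
    · calc _ ≤ ∑ z ∈ V, A * detourCost ρ C z (s j) := Finset.sum_le_sum fun z hz => (hα z hz).2.2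
        _ = A * ∑ z ∈ V, detourCost ρ C z (s j) := (Finset.mul_sum _ _ _).symm
        _ ≤ A * totalDetourCost ρ C (Z j) (s j) γ.trace := by
          refine mul_le_mul_right (sum_le_totalDetourCost ρ C _ (hV.trans hZ'Z) fun z hz => ?_) _
          obtain ⟨x, hxz, hxB⟩ := (Finset.mem_filter.1 (hV hz)).2
          exact ⟨x, hxz, hgT hxB.1⟩
        _ ≤ ε := hjε.le
  · rintro J γ hJ hJ₀ hsub ⟨hnt, hbad⟩
    have hsub' := subset_iUnion_nontrivial γ.isPreconnected_trace hnt hJ hsub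
    have hJ' : {η ∈ J | η.trace.Nontrivial}.Finite := hJ.subset (sep_subset _ _)
    have hgood : ∀ η ∈ hJ'.toFinset, μH[1] (η.trace ∩ E) = 0 ∧
        Tendsto (fun j => totalDetourCost ρ C (Z j) (s j) η.trace) atTop (𝓝 0) := by
      intro η hη
      have hη' := hJ'.mem_toFinset.1 hη
      by_contra hcon
      exact hJ₀ η hη'.1 ⟨hη'.2, not_and_or.1 hcon⟩
    have hsub'' : γ.trace ⊆ ⋃ η ∈ hJ'.toFinset, η.trace := by
      simpa only [Finite.mem_toFinset] using hsub'
    rcases hbad with hbad | hbad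
    · refine hbad (measure_mono_null (fun x hx => ?_)
        ((measure_biUnion_null_iff hJ'.toFinset.countable_toSet).2 fun η hη => (hgood η hη).1))
      obtain ⟨η, hη, hxη⟩ := mem_iUnion₂.1 (hsub'' hx.1)
      exact mem_iUnion₂.2 ⟨η, hη, hxη, hx.2⟩
    · refine hbad (tendsto_of_tendsto_of_tendsto_of_le_of_le tendsto_const_nhds ?_
        (fun _ => zero_le) fun j => totalDetourCost_le_sum ρ C (Z j) (s j) hsub'')
      have := tendsto_finsetSum hJ'.toFinset fun η hη => (hgood η hη).2
      rwa [Finset.sum_const_zero] at this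

end

/-! ### Modification of almost every path -/

section

open Metric

variable {n : ℕ} {k : Kind} {E : Set (Eu n)}

/-- Reindexing a countable family of paths by a subset of `ℕ`. -/
theorem exists_nat_indexing {ι : Type*} [Countable ι] (δ : ι → Curve n) (β : Curve n) :
    ∃ (I : Set ℕ) (δ' : ℕ → Curve n) (e : ι → ℕ), Function.Injective e ∧ I = range e ∧
      ∀ i, δ' (e i) = δ i := by
  obtain ⟨e, he⟩ := Countable.exists_injective_nat ι
  exact ⟨range e, Function.extend e δ fun _ => β, e, he, rfl, fun i => he.extend_apply _ _ i⟩

theorem Curve.IsStrictSubpath.trace_subset {η γ : Curve n} (h : η.IsStrictSubpath γ)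
    (hγ : γ.IsSimple) : η.trace ⊆ γ.trace \ γ.bdry := by
  obtain ⟨ha, hb, heq⟩ := h
  rintro _ ⟨⟨t, ht⟩, rfl⟩
  have ht' : t ∈ Icc γ.a γ.b := ⟨ha.le.trans ht.1, ht.2.trans hb.le⟩
  rw [heq t ht ht']
  refine ⟨⟨_, rfl⟩, ?_⟩
  rintro (h | h)
  · have : t = γ.a := congrArg Subtype.val (hγ h)
    linarith [ht.1]
  · have : t = γ.b := congrArg Subtype.val (hγ h)
    linarith [ht.2]

/-- A compact set `K` that joins the endpoints of `γ` inside `|γ|` and countably many paths `δ i`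
contains a path as in the first conclusion. -/
theorem exists_conclusionA {ρ : Eu n → ℝ≥0∞} {γ : Curve n} (hne : γ.start ≠ γ.finish)
    {K : Set (Eu n)} (hK : IsCompact K) (hj : LipJoined K γ.start γ.finish)
    (hgood : k.Good E (K \ γ.bdry)) {ι : Type*} [Countable ι] {δ : ι → Curve n}
    (hsub : K \ γ.bdry ⊆ (γ.trace \ E) ∪ ⋃ i, (δ i).trace) {U : Set (Eu n)}
    (hU : ∀ i, (δ i).trace ⊆ U) {ε : ℝ≥0∞}
    (hsum : ∑' i, ((δ i).length + (δ i).lineIntegral ρ) < ε) {Γ' : Set (Curve n)}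
    (hΓ' : ∀ i, δ i ∉ Γ') (hfin : Disjoint E γ.bdry → Finite ι)
    (hloc : ∀ S : Set (Eu n), IsCompact S → Disjoint S γ.bdry →
      {i | (S ∩ (δ i).trace).Nonempty}.Finite) :
    ∃ (I : Set ℕ) (δ : ℕ → Curve n) (γ' : Curve n), γ'.IsSimple ∧
      γ' ∈ k.family E ∧
      γ'.bdry = γ.bdry ∧
      γ'.trace \ γ.bdry ⊆ (γ.trace \ E) ∪ ⋃ i ∈ I, (δ i).trace ∧
      ⋃ i ∈ I, (δ i).trace ⊆ U ∧
      ∑' i : I, (δ i).length < ε ∧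
      ∑' i : I, (δ i).lineIntegral ρ < ε ∧
      (∀ i ∈ I, δ i ∉ Γ') ∧
      (Disjoint E γ.bdry → I.Finite) ∧
      ∀ η : Curve n, η.IsStrictSubpath γ' →
        {i ∈ I | (η.trace ∩ (δ i).trace).Nonempty}.Finite := by
  obtain ⟨γ', hs, -, hγ'K, h0, h1⟩ := hj.exists_curve hK hne
  have hb : γ'.bdry = γ.bdry := Curve.bdry_eq h0 h1
  obtain ⟨I, δ', e, he, rfl, hδ⟩ := exists_nat_indexing δ γ
  have hUn : ⋃ i ∈ range e, (δ' i).trace = ⋃ i, (δ i).trace := by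
    rw [biUnion_range]
    exact iUnion_congr fun i => by rw [hδ]
  have hts : ∀ F : Curve n → ℝ≥0∞, ∑' i : range e, F (δ' i) = ∑' i, F (δ i) := fun F => by
    rw [tsum_range (fun i => F (δ' i)) he]
    exact tsum_congr fun i => by rw [hδ]
  refine ⟨range e, δ', γ', hs, mem_family_iff.2 (hgood.mono ?_), hb, ?_, ?_, ?_, ?_, ?_, ?_, ?_⟩
  · rw [hb]
    exact sdiff_subset_sdiff_left hγ'K
  · rw [hUn]
    exact (sdiff_subset_sdiff_left hγ'K).trans hsub
  · rw [hUn]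
    exact iUnion_subset hU
  · rw [hts Curve.length]
    exact (ENNReal.tsum_le_tsum fun i => le_self_add).trans_lt hsum
  · rw [hts fun η => η.lineIntegral ρ]
    exact (ENNReal.tsum_le_tsum fun i => le_add_self).trans_lt hsum
  · rintro _ ⟨i, rfl⟩
    rw [hδ]
    exact hΓ' i
  · intro h
    have := hfin h
    exact finite_range e
  · intro η hη
    have hηs := hη.trace_subset hs
    refine ((hloc η.trace η.isCompact_trace ?_).image e).subset ?_
    · rw [← hb]
      exact disjoint_sdiff_left.mono_left hηs
    · rintro _ ⟨⟨i, rfl⟩, hi⟩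
      rw [hδ] at hi
      exact ⟨i, hi, rfl⟩

/-- If an endpoint of the path may lie in `E`, then the path is cut at countably many points
outside `E` that accumulate at its endpoints, and the pieces are modified in neighbourhoods that
shrink to the endpoints. -/
theorem ArcModifiable.conclusionA {ρ : Eu n → ℝ≥0∞} {γ : Curve n} (hγ : γ.IsRectifiable)
    (hne : γ.start ≠ γ.finish) (hE0 : μH[1] (γ.trace ∩ E) = 0)
    (h : ArcModifiable k E ρ γ.trace) : ConclusionA k E ρ γ := by
  intro U hU hγU ε hε Γ' hΓ'
  have hε' : 0 < ENNReal.ofReal ε := ENNReal.ofReal_pos.2 hε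
  obtain ⟨L, g, hg, hgγ, hg0, hg1, hinj⟩ := hγ.lipJoined.exists_injOn γ.isCompact_trace hne
  have hgsub : ∀ S, g '' S ⊆ γ.trace := fun S => by
    rintro _ ⟨t, -, rfl⟩
    exact hgγ t
  by_cases hEb : Disjoint E γ.bdry
  · have h0E : g 0 ∉ E := fun hE => disjoint_left.1 hEb hE (by rw [hg0]; exact Or.inl rfl)
    have h1E : g 1 ∉ E := fun hE => disjoint_left.1 hEb hE (by rw [hg1]; exact Or.inr rfl)
    obtain ⟨V, α, K, hK, hj, hgood, hsub, hα, hsum⟩ := h L g 0 1 hg zero_le_one (hgsub _) h0E h1E U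
      hU (fun x hx => hγU ⟨hgsub _ hx.1, fun hb => disjoint_left.1 hEb hx.2 hb⟩)
      (ENNReal.ofReal ε / 2) (ENNReal.half_pos hε'.ne') Γ' hΓ'
    rw [hg0, hg1] at hj
    refine exists_conclusionA hne hK hj (hgood.mono sdiff_subset) (δ := fun z : V => α z)
      (sdiff_subset.trans (hsub.trans ?_)) (fun z => (hα z z.2).1) ?_ (fun z => (hα z z.2).2)
      (fun _ => inferInstance) fun _ _ _ => toFinite _
    · refine union_subset_union (sdiff_subset_sdiff_left (hgsub _)) ?_
      exact iUnion₂_subset fun z hz => subset_iUnion (fun z : V => (α z).trace) ⟨z, hz⟩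
    · rw [Finset.tsum_subtype V fun z => (α z).length + (α z).lineIntegral ρ]
      exact hsum.trans_lt (ENNReal.half_lt_self hε'.ne' ENNReal.ofReal_ne_top)
  · obtain ⟨τ, hτ, hτE, hτ1, hτ0⟩ := exists_times (P := fun t => g t ∉ E) fun a b ha hab hb =>
      exists_notMem_of_hausdorff_eq_zero hg.continuous hinj
        (measure_mono_null (inter_subset_inter_left _ (hgsub _)) hE0) ha hab hb
    have hlt : ∀ j, τ j < τ (j + 1) := fun j => hτ (by omega)
    obtain ⟨e, he, hesum⟩ := ENNReal.exists_pos_sum_of_countable' hε'.ne' ℤ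
    set d : ℤ → ℝ := fun j => 1 / (|(j : ℝ)| + 1) with hd
    have hd0 : ∀ j, 0 < d j := fun j => by positivity
    set T : ℤ → Set (Eu n) := fun j => thickening (d j) (g '' Icc (τ j) (τ (j + 1))) with hT
    have hgT : ∀ j, g '' Icc (τ j) (τ (j + 1)) ⊆ T j := fun j => self_subset_thickening (hd0 j) _
    have hinner : ∀ j, g '' Icc (τ j) (τ (j + 1)) ⊆ γ.trace \ γ.bdry := by
      rintro j _ ⟨t, ht, rfl⟩
      have ht0 : 0 < t := (hτE j).1.1.trans_le ht.1
      have ht1 : t < 1 := ht.2.trans_lt (hτE (j + 1)).1.2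
      refine ⟨hgγ t, ?_⟩
      rintro (hb | hb)
      · rw [← hg0] at hb
        exact ht0.ne' (hinj ⟨ht0.le, ht1.le⟩ (left_mem_Icc.2 zero_le_one) hb)
      · rw [mem_singleton_iff, ← hg1] at hb
        exact ht1.ne (hinj ⟨ht0.le, ht1.le⟩ (right_mem_Icc.2 zero_le_one) hb)
    choose V α K hK hj hgood hsub hα hsum using fun j : ℤ =>
      h L g (τ j) (τ (j + 1)) hg (hlt j).le (hgsub _) (hτE j).2 (hτE (j + 1)).2 (U ∩ T j)
        (hU.inter isOpen_thickening) (inter_subset_left.trans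
          (subset_inter ((hinner j).trans hγU) (hgT j))) (e j) (he j) Γ' hΓ'
    have hαT : ∀ j, ∀ z ∈ V j, (α j z).trace ⊆ T j := fun j z hz =>
      (hα j z hz).1.trans inter_subset_right
    have hKT : ∀ j, K j ⊆ T j := fun j => (hsub j).trans
      (union_subset (sdiff_subset.trans (hgT j)) (iUnion₂_subset (hαT j)))
    have hTy : ∀ r > 0, ∀ᶠ j in atTop, T j ⊆ ball (g 1) r := fun r hr =>
      eventually_subset_ball hg.continuous.continuousAt hτ1
        (hτ1.comp (tendsto_atTop_add_const_right _ 1 tendsto_id)) tendsto_one_div_abs_add_one.1 hr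
    have hTx : ∀ r > 0, ∀ᶠ j in atBot, T j ⊆ ball (g 0) r := fun r hr =>
      eventually_subset_ball hg.continuous.continuousAt hτ0
        (hτ0.comp (tendsto_atBot_add_const_right _ 1 tendsto_id)) tendsto_one_div_abs_add_one.2 hr
    have hH : ∀ j, μH[1] (K j) ≤ μH[1] (g '' Icc (τ j) (τ (j + 1))) + e j := by
      intro j
      refine (measure_mono (hsub j)).trans ((measure_union_le _ _).trans
        (add_le_add (measure_mono sdiff_subset) ?_))
      refine (measure_biUnion_finset_le _ _).trans (le_trans ?_ (hsum j))
      exact Finset.sum_le_sum fun z _ => Curve.hausdorff_trace_le.trans le_self_add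
    have hHfin : ∑' j, μH[1] (K j) ≠ ∞ := by
      refine ((ENNReal.tsum_le_tsum hH).trans_lt ?_).ne
      rw [ENNReal.tsum_add]
      refine ENNReal.add_lt_top.2 ⟨?_, hesum.trans ENNReal.ofReal_lt_top⟩
      have := tsum_lintegral_subarcs_le hg.continuous hinj hτ (fun j => (hτE j).1) fun _ => 1
      simp only [setLIntegral_one] at this
      exact this.trans_lt (hausdorff_image_Icc_lt_top hg 0 1)
    obtain ⟨hC, hCj⟩ := lipJoined_iUnion (p := fun j => g (τ j)) (x := g 0) (y := g 1) hK hj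
      (fun r hr => (hTy r hr).mono fun j hj => (hKT j).trans hj)
      (fun r hr => (hTx r hr).mono fun j hj => (hKT j).trans hj) hHfin
    have hbd : ({g 0, g 1} : Set (Eu n)) = γ.bdry := by rw [hg0, hg1]; rfl
    rw [hbd] at hC hCj
    have hCK : ((⋃ j, K j) ∪ γ.bdry) \ γ.bdry ⊆ ⋃ j, K j := by
      rw [union_sdiff_right]
      exact sdiff_subset
    rw [hg0, hg1] at hCj
    refine exists_conclusionA hne hC hCj ((Kind.Good.iUnion hgood).mono hCK)
      (δ := fun i : Σ j, V j => α i.1 i.2) ?_ (fun i => (hα i.1 i.2 i.2.2).1.trans inter_subset_left)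
      ?_ (fun i => (hα i.1 i.2 i.2.2).2) (fun h => absurd h hEb) ?_
    · refine hCK.trans (iUnion_subset fun j => (hsub j).trans (union_subset_union
        (sdiff_subset_sdiff_left (hgsub _)) (iUnion₂_subset fun z hz => ?_)))
      exact subset_iUnion (fun i : Σ j, V j => (α i.1 i.2).trace) ⟨j, z, hz⟩
    · rw [ENNReal.tsum_sigma']
      refine lt_of_le_of_lt (ENNReal.tsum_le_tsum fun j => ?_) hesum
      rw [Finset.tsum_subtype (V j) fun z => (α j z).length + (α j z).lineIntegral ρ]
      exact hsum j
    · intro S hS hSb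
      have hball : ∀ x ∈ γ.bdry, ∃ r > 0, ball x r ⊆ Sᶜ := fun x hx =>
        Metric.isOpen_iff.1 hS.isClosed.isOpen_compl x fun hxS => disjoint_left.1 hSb hxS hx
      obtain ⟨r, hr, hrS⟩ := hball (g 0) (hbd ▸ Or.inl rfl)
      obtain ⟨r', hr', hrS'⟩ := hball (g 1) (hbd ▸ Or.inr rfl)
      obtain ⟨N, hN⟩ := eventually_atTop.1 (hTy r' hr')
      obtain ⟨M, hM⟩ := eventually_atBot.1 (hTx r hr)
      refine ((finite_Icc M N).biUnion fun j _ => finite_range (Sigma.mk j)).subset ?_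
      rintro ⟨j, z⟩ ⟨x, hxS, hx⟩
      have hxT := hαT j z z.2 hx
      refine mem_iUnion₂.2 ⟨j, ⟨?_, ?_⟩, z, rfl⟩
      · by_contra! hlt
        exact hrS (hM j hlt.le hxT) hxS
      · by_contra! hlt
        exact hrS' (hN j hlt.le hxT) hxS

theorem LocalLoewnerBound.modificationA (hn : 2 ≤ n) (hE : IsClosed E)
    (h : LocalLoewnerBound k E) : ModificationA k E := by
  intro ρ hρ
  obtain ⟨Γ₀, hΓ₀, hmod, hstab⟩ := h.exists_arcModifiable hn hE hρ
  refine ⟨Γ₀, hΓ₀, fun γ hγ hne hγ₀ => ?_, hstab⟩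
  obtain ⟨hE0, hA⟩ := hmod γ hγ₀ ⟨_, γ.start_mem_trace, _, γ.finish_mem_trace, hne⟩
  exact hA.conclusionA hγ hne hE0

theorem IsNegligible.isWeaklyNegligible {Ω : Set (Eu n)} (h : IsNegligible k Ω E) :
    IsWeaklyNegligible k Ω E :=
  ⟨1, le_rfl, fun F₁ F₂ h₁ h₂ h₁Ω h₂Ω hd => by
    rw [ENNReal.coe_one, one_mul]
    exact (h F₁ F₂ h₁ h₂ h₁Ω h₂Ω hd).le⟩

end

end NegExt

theorem theorem6p1 {n : ℕ} (hn : 2 ≤ n) (k : NegExt.Kind)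
    (E : Set (EuclideanSpace ℝ (Fin n))) :
    (IsClosed E →
      List.TFAE [
        ∀ Ω : Set (EuclideanSpace ℝ (Fin n)), IsOpen Ω → NegExt.IsNegligible k Ω E,
        NegExt.IsNegligible k Set.univ E,
        ∃ Ω : Set (EuclideanSpace ℝ (Fin n)),
          IsOpen Ω ∧ E ⊆ Ω ∧ NegExt.IsWeaklyNegligible k Ω E,
        NegExt.LocalLoewnerBound k E,
        NegExt.ModificationA k E,
        NegExt.ModificationB k E,
        MeasureTheory.volume E = 0 ∧ NegExt.ModificationBOff k E]) ∧
    (MeasureTheory.NullMeasurableSet E MeasureTheory.volume →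
      (NegExt.ModificationA k E → NegExt.ModificationB k E) ∧
      (NegExt.ModificationB k E ↔
        MeasureTheory.volume E = 0 ∧ NegExt.ModificationBOff k E) ∧
      (MeasureTheory.volume E = 0 ∧ NegExt.ModificationBOff k E →
        ∀ Ω : Set (EuclideanSpace ℝ (Fin n)), IsOpen Ω → NegExt.IsNegligible k Ω E) ∧
      ((∀ Ω : Set (EuclideanSpace ℝ (Fin n)), IsOpen Ω → NegExt.IsNegligible k Ω E) →
        NegExt.IsNegligible k Set.univ E) ∧
      (NegExt.IsNegligible k Set.univ E →
        ∃ Ω : Set (EuclideanSpace ℝ (Fin n)),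
          IsOpen Ω ∧ E ⊆ Ω ∧ NegExt.IsWeaklyNegligible k Ω E)) := by
  have hn0 : n ≠ 0 := by omega
  have h56 : NegExt.ModificationA k E → NegExt.ModificationB k E := fun h => h.modificationB hn0
  have h67 : NullMeasurableSet E volume → NegExt.ModificationB k E →
      volume E = 0 ∧ NegExt.ModificationBOff k E := fun hE h =>
    ⟨h.volume_eq_zero hn0 hE, fun ρ hρ => (h ρ hρ).imp fun _ hΓ =>
      ⟨hΓ.1, fun γ hγ hne _ _ => hΓ.2 γ hγ hne⟩⟩
  have h76 : volume E = 0 ∧ NegExt.ModificationBOff k E → NegExt.ModificationB k E :=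
    fun h => h.2.modificationB hn0 h.1
  have h71 : volume E = 0 ∧ NegExt.ModificationBOff k E →
      ∀ Ω : Set (EuclideanSpace ℝ (Fin n)), IsOpen Ω → NegExt.IsNegligible k Ω E :=
    fun h Ω hΩ => (h76 h).isNegligible hΩ
  have h12 : (∀ Ω : Set (EuclideanSpace ℝ (Fin n)), IsOpen Ω → NegExt.IsNegligible k Ω E) →
      NegExt.IsNegligible k univ E := fun h => h univ isOpen_univ
  have h23 : NegExt.IsNegligible k univ E → ∃ Ω : Set (EuclideanSpace ℝ (Fin n)),
      IsOpen Ω ∧ E ⊆ Ω ∧ NegExt.IsWeaklyNegligible k Ω E :=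
    fun h => ⟨univ, isOpen_univ, subset_univ E, h.isWeaklyNegligible⟩
  refine ⟨fun hE => ?_, fun hE => ⟨h56, ⟨h67 hE, h76⟩, h71, h12, h23⟩⟩
  tfae_have 1 → 2 := h12
  tfae_have 2 → 3 := h23
  tfae_have 3 → 4 := fun ⟨_, hΩ, hEΩ, h⟩ => h.localLoewnerBound hn0 hE hΩ hEΩ
  tfae_have 4 → 5 := fun h => h.modificationA hn hE
  tfae_have 5 → 6 := h56
  tfae_have 6 → 7 := h67 hE.nullMeasurableSet
  tfae_have 7 → 1 := h71
  tfae_finish
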